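/- Let $\Gamma_1,\Gamma_2$ be finitely generated groups. Then $$\operatorname{obdim}(\Gamma_1\times\Gamma_2)\ \ge\ \operatorname{obdim}(\Gamma_1)+\operatorname{obdim}(\Gamma_2),$$ $$\operatorname{updim}(\Gamma_1\times\Gamma_2)\ \le\ \operatorname{updim}(\Gamma_1)+\operatorname{updim}(\Gamma_2),$$ $$\operatorname{actdim}(\Gamma_1\times\Gamma_2)\ \le\ \operatorname{actdim}(\Gamma_1)+\operatorname{actdim}(\Gamma_2).$$ All three invariants take values in $\{0,1,2,\dots\}\cup\{\infty\}$, and $\Gamma_1$, $\Gamma_2$, $\Gamma_1\times\Gamma_2$ carry word metrics with respect to arbitrary finite generating sets. The notions are as follows. **Obstructor complexes.** Let $m\ge 0$ be an integer. A finite simplicial complex $K$ of dimension $\le m$ is an *$m$-obstructor complex* if there is a finite set $\Sigma$ of unordered pairs $\{\sigma,\tau\}$ of disjoint simplices of $K$ with $\dim\sigma+\dim\tau=m$ such that (1) the cells $\sigma\times\tau$, $\{\sigma,\tau\}\in\Sigma$, form an $m$-cycle over $\mathbb Z/2$ in $\bigcup\{\sigma\times\tau\subset K\times K:\sigma\cap\tau=\emptyset\}/(x,y)\sim(y,x)$;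 (2) for some map $f:K\to\mathbb R^m$ that is affine on every simplex and sends the vertices to points in general position, $\sum_{\{\sigma,\tau\}\in\Sigma}|f(\sigma)\cap f(\tau)|$ is odd; (3) for every $m$-simplex $\sigma$ of $K$ the number of vertices $v$ with $\{\sigma,v\}\in\Sigma$ is even. **Obstructor dimension.** Let $\operatorname{cone}(K)=K\times[0,\infty)/K\times\{0\}$, triangulated by a locally finite simplicial complex so that $\operatorname{cone}(\sigma)$ is a subcomplex for every simplex $\sigma$ of $K$. A map $f:\operatorname{cone}(K)^{(0)}\to\Gamma$ on the vertex set is *proper* if preimages of finite sets are finite, *Lipschitz* if the distances between the images of adjacent vertices are uniformly bounded, and *expanding* if for all disjoint simplices $\sigma,\tau$ of $K$ and every $D>0$ there are finite sets $C_1,C_2$ of vertices such that $d(f(v),f(w))>D$ whenever $v\in\operatorname{cone}(\sigma)^{(0)}\setminus C_1$ and $w\in\operatorname{cone}(\tau)^{(0)}\setminus C_2$. For a finitely generated group $\Gamma$, $\operatorname{obdim}(\Gamma)$ is $0$ if $\Gamma$ is finite, $1$ if $\Gamma$ is 2-ended, and otherwise $m+2$, where $m$ is the largest integer such that for some $m$-obstructor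 complex $K$ and some such triangulation of $\operatorname{cone}(K)$ there is a proper, Lipschitz, expanding map $\operatorname{cone}(K)^{(0)}\to\Gamma$; if these $m$ are unbounded, $\operatorname{obdim}(\Gamma)=\infty$. **Uniformly proper dimension.** $\operatorname{updim}(\Gamma)$ is the smallest $n$ such that there are a contractible $n$-manifold $W$ with a proper metric $d_W$, a Lipschitz map $g:\Gamma\to W$, a proper function $\phi:[0,\infty)\to[0,\infty)$ with $d_W(g(x),g(y))\ge\phi(d(x,y))$ for all $x,y\in\Gamma$, and a function $\rho:(0,\infty)\to(0,\infty)$ such that every ball of radius $r$ centered at a point of $g(\Gamma)$ is contractible in the ball of radius $\rho(r)$ with the same center; it is $\infty$ if there is no such $n$. **Action dimension.** $\operatorname{actdim}(\Gamma)$ is the smallest $n$ such that $\Gamma$ admits a properly discontinuous action by homeomorphisms on a contractible $n$-manifold; it is $\infty$ if there is no such $n$. -/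

import Mathlib

open scoped NNReal Topology

noncomputable section

namespace ObstructorDim

universe u

/-! ### Obstructor complexes -/

section Obstructor

variable {V : Type}

/-- The images of the vertices are in general position in `ℝ^m`: any `m + 1` or fewer of them
(counted with their labels) are affinely independent. Such an `f` determines a general position
map that is affine on every simplex. -/
def GeneralPosition (m : ℕ) (f : V → EuclideanSpace ℝ (Fin m)) : Prop :=
  ∀ s : Finset V, s.card ≤ m + 1 → AffineIndependent ℝ (fun v : s => f v)

/-- For an unordered pair `p = {σ, τ}` of simplices, the number `|f(σ) ∩ f(τ)|`, where `f` is
extended affinely over the simplices. -/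
def intersectionNumber {m : ℕ} (f : V → EuclideanSpace ℝ (Fin m)) (p : Sym2 (Finset V)) : ℕ :=
  {y | ∀ σ ∈ p, y ∈ convexHull ℝ (f '' (σ : Set V))}.ncard

/-- The number of cells of `P` having the cell `α × β` (up to the swap) as a face, where the
unordered pair `{σ, τ}` stands for the cell `σ × τ` (up to the swap). -/
def cofaceCount (P : Finset (Sym2 (Finset V))) (α β : Finset V) : ℕ :=
  {p ∈ (P : Set (Sym2 (Finset V))) | ∃ σ τ, p = s(σ, τ) ∧ α ⊆ σ ∧ β ⊆ τ}.ncard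

/-- `K` is an `m`-obstructor complex. A simplex with `k` vertices has dimension `k - 1`. -/
def IsObstructor [Finite V] (K : AbstractSimplicialComplex V) (m : ℕ) : Prop :=
  (∀ σ ∈ K.faces, σ.card ≤ m + 1) ∧
  ∃ P : Finset (Sym2 (Finset V)),
    -- unordered pairs of disjoint simplices with dimensions adding up to `m`
    (∀ σ τ, s(σ, τ) ∈ P →
      σ ∈ K.faces ∧ τ ∈ K.faces ∧ Disjoint σ τ ∧ σ.card + τ.card = m + 2) ∧
    -- the corresponding cells form a mod 2 cycle: every `(m-1)`-cell `{α, β}` of the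
    -- unordered deleted product is a face of an even number of them
    (∀ α ∈ K.faces, ∀ β ∈ K.faces, Disjoint α β → α.card + β.card = m + 1 →
      Even (cofaceCount P α β)) ∧
    -- the number of intersections under a general position map is odd
    (∃ f : V → EuclideanSpace ℝ (Fin m), GeneralPosition m f ∧
      Odd (∑ p ∈ P, intersectionNumber f p)) ∧
    -- every `m`-simplex is paired with an even number of vertices
    (∀ σ ∈ K.faces, σ.card = m + 1 → Even {v : V | s(σ, {v}) ∈ P}.ncard)

end Obstructor

/-! ### Open cones and their triangulations -/

section Cone

variable {V : Type}

/-- The open cone over a simplex `σ`, inside `ℝ^V`. The point `t • x`, with `t ≥ 0` and `x` in the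
standard simplex spanned by `σ`, is the class of `(x, t)` in `σ × [0, ∞) / σ × {0}`. -/
def coneSimplex (σ : Finset V) : Set (V → ℝ) :=
  {x | (∀ v, 0 ≤ x v) ∧ ∀ v, v ∉ σ → x v = 0}

/-- The open cone `K × [0, ∞) / K × {0}` over a finite simplicial complex `K`. -/
def openCone (K : AbstractSimplicialComplex V) : Set (V → ℝ) :=
  ⋃ σ ∈ K.faces, coneSimplex σ

/-- The geometric closed simplex with vertex set `s`, in barycentric coordinates. -/
def closedSimplex {X : Type} (s : Finset X) : Set (X → ℝ) :=
  {x | (∀ v, 0 ≤ x v) ∧ (∀ v, v ∉ s → x v = 0) ∧ ∑ v ∈ s, x v = 1}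

/-- The geometric realization of a simplicial complex. It is used for locally finite complexes
only, where the topology of pointwise convergence is the usual (weak) topology. -/
def realization {X : Type} (T : AbstractSimplicialComplex X) : Set (X → ℝ) :=
  ⋃ s ∈ T.faces, closedSimplex s

/-- The vertex `v`, as a point of the geometric realization. -/
def vertexPoint {X : Type} (T : AbstractSimplicialComplex X) (v : X) : realization T := by
  classical
  exact ⟨Pi.single v 1, Set.mem_biUnion (T.singleton_mem v) (by
    refine ⟨fun w => ?_, fun w hw => ?_, by simp⟩
    · by_cases h : w = v
      · subst h; simp
      · simp [h]
    · rw [Finset.mem_singleton] at hw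
      simp [hw])⟩

/-- A (locally finite) triangulation of the open cone over `K` by a simplicial complex with
vertex set `X`, in which the cone over every simplex of `K` is a subcomplex. -/
structure ConeTriangulation (K : AbstractSimplicialComplex V) (X : Type) where
  /-- the triangulating complex -/
  complex : AbstractSimplicialComplex X
  locallyFinite : ∀ v : X, {s ∈ complex.faces | v ∈ s}.Finite
  /-- the triangulating homeomorphism -/
  homeo : realization complex ≃ₜ openCone K
  subcomplex : ∀ σ ∈ K.faces, ∃ L ⊆ complex.faces,
    {x : realization complex | (homeo x : V → ℝ) ∈ coneSimplex σ} =
      {x : realization complex | (x : X → ℝ) ∈ ⋃ s ∈ L, closedSimplex s}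

/-- The vertices of the triangulation that lie in the cone over `σ`. -/
def ConeTriangulation.verticesIn {K : AbstractSimplicialComplex V} {X : Type}
    (T : ConeTriangulation K X) (σ : Finset V) : Set X :=
  {v | (T.homeo (vertexPoint T.complex v) : V → ℝ) ∈ coneSimplex σ}

end Cone

/-! ### Word metrics and ends -/

section WordMetric

variable {Γ : Type u} [Group Γ]

/-- The word distance of `Γ` with respect to `S`, i.e. the distance in the Cayley graph. -/
def wordDist (S : Finset Γ) (x y : Γ) : ℕ :=
  (SimpleGraph.mulCayley (S : Set Γ)).dist x y

/-- The group generated by `S` is 2-ended: its Cayley graph has exactly two ends. -/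
def TwoEnded (S : Finset Γ) : Prop :=
  (SimpleGraph.mulCayley (S : Set Γ)).end.ncard = 2

/-! ### The obstructor dimension -/

/-- There is a proper, Lipschitz, expanding map `cone(K)^(0) → Γ` for some triangulation of the
open cone over some `m`-obstructor complex `K`. -/
def AdmitsObstructor (S : Finset Γ) (m : ℕ) : Prop :=
  ∃ (V : Type) (_ : Finite V) (K : AbstractSimplicialComplex V) (X : Type)
    (T : ConeTriangulation K X) (f : X → Γ),
    IsObstructor K m ∧
    -- proper
    (∀ C : Set Γ, C.Finite → (f ⁻¹' C).Finite) ∧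
    -- Lipschitz for the edge-path metric
    (∃ L : ℕ, ∀ v w : X, (∃ s ∈ T.complex.faces, v ∈ s ∧ w ∈ s) → wordDist S (f v) (f w) ≤ L) ∧
    -- expanding: the restrictions to cones over disjoint simplices diverge
    (∀ σ ∈ K.faces, ∀ τ ∈ K.faces, Disjoint σ τ → ∀ D : ℕ, ∃ C₁ C₂ : Set X,
      C₁.Finite ∧ C₂.Finite ∧
      ∀ v ∈ T.verticesIn σ \ C₁, ∀ w ∈ T.verticesIn τ \ C₂, D < wordDist S (f v) (f w))

open Classical in
/-- The obstructor dimension of the group `Γ` with finite generating set `S`. -/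
def obdim (S : Finset Γ) : ℕ∞ :=
  if Finite Γ then 0
  else if TwoEnded S then 1
  else ⨆ (m : ℕ) (_ : AdmitsObstructor S m), ((m + 2 : ℕ) : ℕ∞)

/-! ### The uniformly proper dimension -/

/-- The ball of radius `r` about `x` is contained in the concentric ball of radius `R` and
contractible in it (the inclusion is null-homotopic). -/
def BallContractsIn {W : Type} [MetricSpace W] (x : W) (r R : ℝ) : Prop :=
  ∃ h : Metric.ball x r ⊆ Metric.ball x R,
    (ContinuousMap.mk (Set.inclusion h) (continuous_inclusion h)).Nullhomotopic

/-- There is a contractible `n`-manifold `W` with a proper metric and a Lipschitz, uniformly proper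
map `g : Γ → W` that has a contractibility function `ρ` for balls centred at its image. -/
def UniformlyProperIn (S : Finset Γ) (n : ℕ) : Prop :=
  ∃ (W : Type) (_ : MetricSpace W) (_ : ProperSpace W)
    (_ : ChartedSpace (EuclideanSpace ℝ (Fin n)) W) (_ : ContractibleSpace W) (g : Γ → W),
    (∃ L : ℝ, ∀ x y, dist (g x) (g y) ≤ L * wordDist S x y) ∧
    (∃ φ : ℝ≥0 → ℝ≥0, IsProperMap φ ∧ ∀ x y, φ (wordDist S x y) ≤ nndist (g x) (g y)) ∧
    (∃ ρ : ℝ → ℝ, (∀ r, 0 < r → 0 < ρ r) ∧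
      ∀ r, 0 < r → ∀ x, BallContractsIn (g x) r (ρ r))

/-- The uniformly proper dimension of the group `Γ` with finite generating set `S`. -/
def updim (S : Finset Γ) : ℕ∞ :=
  ⨅ (n : ℕ) (_ : UniformlyProperIn S n), (n : ℕ∞)

end WordMetric

/-! ### The action dimension -/

/-- `Γ` acts properly discontinuously on a contractible `n`-manifold. -/
def ActsOn (Γ : Type u) [Group Γ] (n : ℕ) : Prop :=
  ∃ (W : Type) (_ : TopologicalSpace W) (_ : T2Space W) (_ : SecondCountableTopology W)
    (_ : ChartedSpace (EuclideanSpace ℝ (Fin n)) W) (_ : ContractibleSpace W)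
    (_ : MulAction Γ W) (_ : ContinuousConstSMul Γ W), ProperlyDiscontinuousSMul Γ W

/-- The action dimension of `Γ`. -/
def actdim (Γ : Type u) [Group Γ] : ℕ∞ :=
  ⨅ (n : ℕ) (_ : ActsOn Γ n), (n : ℕ∞)

end ObstructorDim

end

namespace ObstructorDim
universe u v

/-! ### Word metrics on Cayley graphs and geodesic rays. -/

section WordMetric

variable {Γ : Type u} [Group Γ] {S : Finset Γ}

/-! The bounds on `updim` and `actdim` come from taking products of spaces. A product of
contractible manifolds is a contractible manifold, the factorwise action is properly discontinuous,
and in the sup metric balls are products of balls, so the maximum of two contractibility functions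
is one. The remaining point is a proper lower bound for distances (`exists_isProperMap_le`).

For `obdim`, let both groups be infinite. The product then has at most one end (`not_hasEnds_prod`),
so its `obdim` is the supremum of m + 2 over the obstructors it admits. The `obdim` of each factor
is at most the supremum of 1 and its values m + 2. Hence three constructions in the product suffice:
(m₁ + 2) + (m₂ + 2) asks for an (m₁ + m₂ + 2)-obstructor, the join; (m + 2) + 1 asks for an (m +
1)-obstructor, the join with a point; 1 + 1 asks for a 0-obstructor, three points, mapped along
three diverging rays. If one factor is finite, the projection to the other is a retraction with
finite kernel: it preserves the number of ends, seen through almost invariant sets, and obstructors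
are pushed along the inclusion.

That joins are obstructors is linear algebra. If σ and τ are disjoint with m + 2 vertices in total
and f is in general position, these vertices carry one affine dependence up to scale, and f(σ) meets
f(τ), in one point, exactly when its signs separate σ from τ (Radon). Two vertex sets can be placed
so that the dependences of their union are the pairs (c₁, c₂) of dependences with h₁(c₁) + h₂(c₂) =
0, where the functionals h₁, h₂ vanish on none of the relevant circuits. Given patterns {σ₁, τ₁} and
{σ₂, τ₂}, this relation selects exactly one of the two pairs {σ₁ * σ₂, τ₁ * τ₂} and {σ₁ * τ₂, τ₁ *
σ₂}. So intersection counts multiply, and odd times odd is odd. Once empty simplices are admitted,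
conditions (1) and (3) merge into a single cycle condition, which joins inherit by a Leibniz rule.

For the maps, cone(K₁ * K₂) is cone(K₁) × cone(K₂) by splitting coordinates. The product is
triangulated by chains in the product of the vertex orders; the barycentric coordinates of a pair of
points are their monotone coupling. A product of two cone maps is again expanding because properness
permits exceptional vertices on one side only. -/

theorem cayley_reachable_mul (x : Γ) {s : Γ} (hs : s ∈ S) :
    (SimpleGraph.mulCayley (S : Set Γ)).Reachable x (x * s) := by
  by_cases h : x = x * s
  · rw [← h]
  · exact SimpleGraph.Adj.reachable
      ((SimpleGraph.mulCayley_adj' _ _ _).2 ⟨h, s, hs, Or.inl rfl⟩)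

theorem cayley_connected (hS : Subgroup.closure (S : Set Γ) = ⊤) :
    (SimpleGraph.mulCayley (S : Set Γ)).Connected := by
  have key : ∀ x : Γ, (SimpleGraph.mulCayley (S : Set Γ)).Reachable 1 x := by
    intro x
    have hx : x ∈ Subgroup.closure (S : Set Γ) := hS ▸ Subgroup.mem_top x
    induction hx using Subgroup.closure_induction_right with
    | one => exact .refl _
    | mul_right x hx y hy ih => exact ih.trans (cayley_reachable_mul x hy)
    | mul_inv_cancel x hx y hy ih =>
      refine ih.trans ?_
      have := cayley_reachable_mul (x * y⁻¹) hy
      rw [inv_mul_cancel_right] at this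
      exact this.symm
  exact ⟨fun x y => (key x).symm.trans (key y)⟩

theorem wordDist_comm (x y : Γ) : wordDist S x y = wordDist S y x :=
  SimpleGraph.dist_comm

theorem wordDist_self (x : Γ) : wordDist S x x = 0 := SimpleGraph.dist_self

theorem wordDist_triangle (hS : Subgroup.closure (S : Set Γ) = ⊤) (x y z : Γ) :
    wordDist S x z ≤ wordDist S x y + wordDist S y z :=
  (cayley_connected hS).dist_triangle

theorem dist_le_mul_dist {V W : Type*} {G : SimpleGraph V} {H : SimpleGraph W}
    (hG : G.Connected) (hH : H.Connected) (f : V → W) (C : ℕ)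
    (hf : ∀ x y, G.Adj x y → H.dist (f x) (f y) ≤ C) (x y : V) :
    H.dist (f x) (f y) ≤ C * G.dist x y := by
  obtain ⟨p, hp⟩ := hG.exists_walk_length_eq_dist x y
  rw [← hp]
  clear hp
  induction p with
  | nil => simp
  | cons h p ih =>
    rw [SimpleGraph.Walk.length_cons, Nat.mul_succ, add_comm]
    exact hH.dist_triangle.trans (Nat.add_le_add (hf _ _ h) ih)

theorem wordDist_mul_left (hS : Subgroup.closure (S : Set Γ) = ⊤) (g x y : Γ) :
    wordDist S (g * x) (g * y) = wordDist S x y := by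
  have key : ∀ g x y : Γ, wordDist S (g * x) (g * y) ≤ wordDist S x y := by
    intro g x y
    have := dist_le_mul_dist (cayley_connected hS) (cayley_connected hS) (g * ·) 1
      (fun x y h => (SimpleGraph.dist_eq_one_iff_adj.2 (SimpleGraph.mulCayley_adj_mul_iff_right.2 h)).le) x y
    rw [one_mul] at this
    exact this
  refine le_antisymm (key g x y) ?_
  simpa using key g⁻¹ (g * x) (g * y)

/-- A homomorphism of finitely generated groups is Lipschitz for the word metrics. -/
theorem exists_wordDist_map_le {Δ : Type v} [Group Δ] {T : Finset Δ}
    (hS : Subgroup.closure (S : Set Γ) = ⊤) (hT : Subgroup.closure (T : Set Δ) = ⊤)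
    (φ : Γ →* Δ) : ∃ C : ℕ, ∀ x y, wordDist T (φ x) (φ y) ≤ C * wordDist S x y := by
  refine ⟨S.sup fun s => wordDist T 1 (φ s), dist_le_mul_dist (cayley_connected hS)
    (cayley_connected hT) φ _ ?_⟩
  have key : ∀ (x : Γ), ∀ s ∈ S,
      wordDist T (φ x) (φ (x * s)) ≤ S.sup fun s => wordDist T 1 (φ s) := by
    intro x s hs
    rw [map_mul]
    conv_lhs => rw [← mul_one (φ x), mul_assoc, one_mul, wordDist_mul_left hT]
    exact Finset.le_sup (f := fun s => wordDist T 1 (φ s)) hs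
  intro x y h
  obtain ⟨-, s, hs, rfl | rfl⟩ := (SimpleGraph.mulCayley_adj' _ _ _).1 h
  · exact key x s hs
  · rw [SimpleGraph.dist_comm]
    exact key y s hs

theorem wordDist_pos (hS : Subgroup.closure (S : Set Γ) = ⊤) {x y : Γ} (h : x ≠ y) :
    0 < wordDist S x y := (cayley_connected hS).pos_dist_of_ne h

theorem cayley_neighborSet_finite (x : Γ) :
    ((SimpleGraph.mulCayley (S : Set Γ)).neighborSet x).Finite := by
  refine ((S.finite_toSet.image (x * ·)).union (S.finite_toSet.image (fun s => x * s⁻¹))).subset ?_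
  intro y hy
  obtain ⟨-, s, hs, rfl | rfl⟩ := (SimpleGraph.mulCayley_adj' _ _ _).1 hy
  · exact Or.inl ⟨s, hs, rfl⟩
  · exact Or.inr ⟨s, hs, by simp⟩

theorem wordDist_ball_finite (hS : Subgroup.closure (S : Set Γ) = ⊤) (x : Γ) (n : ℕ) :
    {y | wordDist S x y ≤ n}.Finite := by
  induction n with
  | zero =>
    refine (Set.finite_singleton x).subset fun y hy => ?_
    by_contra h
    have := wordDist_pos hS (x := x) (y := y) (fun e => h e.symm)
    simp only [Set.mem_ofPred_eq] at hy
    omega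
  | succ n ih =>
    refine (ih.union (ih.biUnion fun y _ => cayley_neighborSet_finite (S := S) y)).subset ?_
    intro y hy
    obtain ⟨p, hp⟩ := (cayley_connected hS).exists_walk_length_eq_dist y x
    cases p with
    | nil => exact Or.inl (by simp [wordDist_self])
    | @cons _ z _ h q =>
      right
      refine Set.mem_biUnion (x := z) ?_ h.symm
      have h1 : wordDist S z x ≤ q.length := SimpleGraph.dist_le q
      have h2 : wordDist S x y = (SimpleGraph.mulCayley (S : Set Γ)).dist y x := wordDist_comm _ _
      rw [SimpleGraph.Walk.length_cons] at hp
      simp only [Set.mem_ofPred_eq] at hy ⊢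
      rw [wordDist_comm]
      omega

theorem wordDist_nhd_finite (hS : Subgroup.closure (S : Set Γ) = ⊤) {A : Set Γ} (hA : A.Finite)
    (n : ℕ) : {y | ∃ x ∈ A, wordDist S x y ≤ n}.Finite := by
  refine (hA.biUnion fun x _ => wordDist_ball_finite hS x n).subset ?_
  rintro y ⟨x, hx, hy⟩
  exact Set.mem_biUnion hx hy

/-- Balls are finite, so some element lies at distance greater than n from 1; a shortest walk to it
realizes distances along the way. The walk is prolonged by a constant so that p is defined on all of
ℕ. -/
theorem exists_geodesic (hS : Subgroup.closure (S : Set Γ) = ⊤) [Infinite Γ] (n : ℕ) :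
    ∃ p : ℕ → Γ, p 0 = 1 ∧ (∀ i, wordDist S (p i) (p (i + 1)) ≤ 1) ∧
      ∀ i ≤ n, wordDist S 1 (p i) = i := by
  obtain ⟨y, hy⟩ := (wordDist_ball_finite hS (1 : Γ) n).exists_notMem
  simp only [Set.mem_ofPred_eq, not_le] at hy
  obtain ⟨p, hp⟩ := (cayley_connected hS).exists_walk_length_eq_dist 1 y
  have h1 : ∀ i, wordDist S (p.getVert i) (p.getVert (i + 1)) ≤ 1 := by
    intro i
    by_cases hi : i < p.length
    · exact (SimpleGraph.dist_eq_one_iff_adj.2 (p.adj_getVert_succ hi)).le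
    · rw [p.getVert_of_length_le (by omega), p.getVert_of_length_le (by omega), wordDist_self]
      exact Nat.zero_le _
  refine ⟨p.getVert, p.getVert_zero, h1, fun i hi => ?_⟩
  have h2 : ∀ a b, wordDist S (p.getVert a) (p.getVert (a + b)) ≤ b := by
    intro a b
    induction b with
    | zero => simp [wordDist_self]
    | succ b ih =>
      exact (wordDist_triangle hS _ (p.getVert (a + b)) _).trans (Nat.add_le_add ih (h1 _))
  have h3 : wordDist S 1 y = p.length := hp.symm
  have ha := h2 0 i
  have hb := h2 i (p.length - i)
  rw [zero_add, p.getVert_zero] at ha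
  rw [Nat.add_sub_cancel' (by omega), p.getVert_length] at hb
  have := wordDist_triangle hS 1 (p.getVert i) y
  omega

/-- An infinite finitely generated group contains a geodesic ray. -/
theorem exists_ray (hS : Subgroup.closure (S : Set Γ) = ⊤) [Infinite Γ] :
    ∃ r : ℕ → Γ, (∀ i, wordDist S (r i) (r (i + 1)) ≤ 1) ∧ ∀ i, wordDist S 1 (r i) = i := by
  -- König's lemma: geodesic segments of length n form finite nonempty sets, an inverse system under
  -- restriction, and a compatible sequence of segments is a ray.
  let α : ℕ → Type _ := fun n => {p : Fin (n + 1) → Γ // (∀ i : Fin (n + 1),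
    wordDist S 1 (p i) = i) ∧ ∀ i : Fin n, wordDist S (p i.castSucc) (p i.succ) ≤ 1}
  have hne : ∀ n, Nonempty (α n) := fun n => by
    obtain ⟨p, -, h1, h2⟩ := exists_geodesic hS n
    exact ⟨fun i => p i, fun i => h2 _ (by omega), fun i => by simpa using h1 i⟩
  have hfin : ∀ n, Finite (α n) := fun n => by
    have hA : {p : Fin (n + 1) → Γ | ∀ i, p i ∈ {y | wordDist S 1 y ≤ n}}.Finite :=
      Set.Finite.pi' fun _ => wordDist_ball_finite hS 1 n
    have : Finite {p : Fin (n + 1) → Γ | ∀ i, p i ∈ {y | wordDist S 1 y ≤ n}} := hA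
    refine Finite.of_injective (β := {p : Fin (n + 1) → Γ | ∀ i, p i ∈ {y | wordDist S 1 y ≤ n}})
      (fun p => ⟨p.1, fun i => ?_⟩) fun p q h => Subtype.ext (Subtype.mk.inj h)
    have := p.2.1 i
    simp only [Set.mem_ofPred_eq]
    omega
  let π : {i j : ℕ} → i ≤ j → α j → α i := fun {i j} hij p =>
    ⟨fun k => p.1 (Fin.castLE (by omega) k), fun k => p.2.1 (Fin.castLE (by omega) k),
      fun k => p.2.2 (Fin.castLE hij k)⟩
  have := hfin 0
  obtain ⟨f, hf⟩ := exists_seq_forall_proj_of_forall_finite (α := α) π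
    (fun _ _ => rfl) (fun _ _ _ _ _ _ => rfl) (fun i a => by
      have := hfin (i + 1)
      exact Set.toFinite _)
  have hcomp : ∀ i j (h : i ≤ j), (f i).1 (Fin.last i) = (f j).1 ⟨i, by omega⟩ := by
    intro i j h
    rw [← hf h]
    rfl
  refine ⟨fun n => (f n).1 (Fin.last n), fun i => ?_, fun i => by simpa using (f i).2.1 (Fin.last i)⟩
  beta_reduce
  rw [hcomp i (i + 1) (by omega)]
  exact (f (i + 1)).2.2 (Fin.last i)

end WordMetric

end ObstructorDim

namespace ObstructorDim

universe u v

/-! ### Action dimension and uniformly proper dimension of products. -/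

section Product

variable {Γ₁ : Type u} {Γ₂ : Type v} [Group Γ₁] [Group Γ₂]
  {S₁ : Finset Γ₁} {S₂ : Finset Γ₂} {S : Finset (Γ₁ × Γ₂)}

/-- Euclidean charts on a product. -/
@[reducible] noncomputable def euclideanChartedProd (W₁ W₂ : Type) [TopologicalSpace W₁] [TopologicalSpace W₂]
    (n₁ n₂ : ℕ) [ChartedSpace (EuclideanSpace ℝ (Fin n₁)) W₁]
    [ChartedSpace (EuclideanSpace ℝ (Fin n₂)) W₂] :
    ChartedSpace (EuclideanSpace ℝ (Fin (n₁ + n₂))) (W₁ × W₂) :=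
  letI : ChartedSpace (EuclideanSpace ℝ (Fin (n₁ + n₂)))
      (ModelProd (EuclideanSpace ℝ (Fin n₁)) (EuclideanSpace ℝ (Fin n₂))) :=
    ((EuclideanSpace.finAddEquivProd (𝕜 := ℝ) (n := n₁) (m := n₂)).symm.toHomeomorph.isOpenEmbedding :
      Topology.IsOpenEmbedding (X := ModelProd (EuclideanSpace ℝ (Fin n₁))
        (EuclideanSpace ℝ (Fin n₂))) _).singletonChartedSpace
  ChartedSpace.comp _ (ModelProd (EuclideanSpace ℝ (Fin n₁)) (EuclideanSpace ℝ (Fin n₂))) _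

theorem ActsOn.prod {n₁ n₂ : ℕ} (h₁ : ActsOn Γ₁ n₁) (h₂ : ActsOn Γ₂ n₂) :
    ActsOn (Γ₁ × Γ₂) (n₁ + n₂) := by
  obtain ⟨W₁, _, _, _, _, _, _, _, _⟩ := h₁
  obtain ⟨W₂, _, _, _, _, _, _, _, _⟩ := h₂
  let act : MulAction (Γ₁ × Γ₂) (W₁ × W₂) :=
    { smul := fun g w => (g.1 • w.1, g.2 • w.2)
      one_smul := fun w => Prod.ext (one_smul _ _) (one_smul _ _)
      mul_smul := fun g h w => Prod.ext (mul_smul _ _ _) (mul_smul _ _ _) }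
  refine ⟨W₁ × W₂, inferInstance, inferInstance, inferInstance,
    euclideanChartedProd W₁ W₂ n₁ n₂, inferInstance, act, ⟨fun g => ?_⟩, ⟨fun {K L} hK hL => ?_⟩⟩
  · exact ((continuous_const_smul g.1).comp continuous_fst).prodMk
      ((continuous_const_smul g.2).comp continuous_snd)
  -- If g moves a point of K into L, each component of g moves the projection of K to meet the
  -- projection of L, so it has only finitely many values.
  · refine ((ProperlyDiscontinuousSMul.finite_disjoint_inter_image (Γ := Γ₁)
      (hK.image continuous_fst) (hL.image continuous_fst)).prod
      (ProperlyDiscontinuousSMul.finite_disjoint_inter_image (Γ := Γ₂)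
      (hK.image continuous_snd) (hL.image continuous_snd))).subset ?_
    rintro g ⟨_, ⟨w, hw, rfl⟩, hL'⟩
    exact ⟨⟨_, ⟨_, ⟨w, hw, rfl⟩, rfl⟩, _, hL', rfl⟩, ⟨_, ⟨_, ⟨w, hw, rfl⟩, rfl⟩, _, hL', rfl⟩⟩

/-- Subadditivity of the minimum of a set of natural numbers. -/
theorem iInf_natCast_le_add {P Q R : ℕ → Prop} (h : ∀ m n, P m → Q n → R (m + n)) :
    ⨅ (n : ℕ) (_ : R n), (n : ℕ∞) ≤ (⨅ (n : ℕ) (_ : P n), (n : ℕ∞)) + ⨅ (n : ℕ) (_ : Q n), (n : ℕ∞) := by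
  have key : ∀ P : ℕ → Prop, (⨅ (n : ℕ) (_ : P n), (n : ℕ∞)) = ⊤ ∨
      ∃ n, P n ∧ (⨅ (n : ℕ) (_ : P n), (n : ℕ∞)) = n := by
    intro P
    by_cases hP : ∃ n, P n
    · classical
      refine Or.inr ⟨Nat.find hP, Nat.find_spec hP, le_antisymm (iInf₂_le _ (Nat.find_spec hP)) ?_⟩
      exact le_iInf₂ fun n hn => Nat.cast_le.2 (Nat.find_min' hP hn)
    · push Not at hP
      simp [hP]
  obtain hP | ⟨m, hm, hP⟩ := key P
  · simp [hP]
  obtain hQ | ⟨n, hn, hQ⟩ := key Q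
  · simp [hQ]
  rw [hP, hQ, ← Nat.cast_add]
  exact iInf₂_le _ (h m n hm hn)

theorem actdim_prod_le : actdim (Γ₁ × Γ₂) ≤ actdim Γ₁ + actdim Γ₂ :=
  iInf_natCast_le_add fun _ _ h₁ h₂ => h₁.prod h₂

/-- If bounded values of `a` force bounded values of `d`, then `a` is bounded below by a proper
function of `d`. -/
theorem exists_isProperMap_le {ι : Type*} [Nonempty ι] (a : ι → ℝ≥0) (d : ι → ℕ)
    (h : ∀ R : ℝ≥0, ∃ N : ℕ, ∀ i, a i ≤ R → d i ≤ N) :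
    ∃ φ : ℝ≥0 → ℝ≥0, IsProperMap φ ∧ ∀ i, φ (d i) ≤ a i := by
  -- An infimum of 1-Lipschitz functions of t; the term of index i shows ψ(d i) ≤ a i. For t ≥ N + R
  -- every term is at least R: either a i > R, or d i ≤ N and the second summand is at least R.
  let ψ : ℝ → ℝ := fun t => ⨅ i, ((a i : ℝ) + max (t - d i) 0)
  have hbdd : ∀ t : ℝ, BddBelow (Set.range fun i => ((a i : ℝ) + max (t - (d i : ℝ)) 0)) := fun t =>
    ⟨0, by rintro _ ⟨i, rfl⟩; positivity⟩
  have hψ : LipschitzWith 1 ψ := LipschitzWith.of_le_add fun x y => by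
    rw [← sub_le_iff_le_add]
    refine le_ciInf fun i => ?_
    rw [sub_le_iff_le_add]
    refine (ciInf_le (hbdd x) i).trans ?_
    have : max (x - d i) 0 ≤ max (y - d i) 0 + dist x y := by
      have h1 := le_abs_self (x - y)
      have h2 := le_max_left (y - d i) 0
      have h3 := le_max_right (y - d i) 0
      rw [Real.dist_eq]
      exact max_le (by linarith) (by linarith [abs_nonneg (x - y)])
    linarith
  refine ⟨fun t => (ψ t).toNNReal, ?_, fun i => ?_⟩
  · rw [isProperMap_iff_tendsto_cocompact]
    refine ⟨continuous_real_toNNReal.comp (hψ.continuous.comp NNReal.continuous_coe), ?_⟩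
    rw [cocompact_eq_atTop, Filter.tendsto_atTop]
    intro R
    obtain ⟨N, hN⟩ := h R
    filter_upwards [Filter.eventually_ge_atTop ((N : ℝ≥0) + R)] with t ht
    refine NNReal.le_toNNReal_of_coe_le ?_
    · refine le_ciInf fun i => ?_
      by_cases hi : a i ≤ R
      · have h1 : (d i : ℝ) ≤ N := by exact_mod_cast hN i hi
        have h2 : (N : ℝ) + R ≤ t := by exact_mod_cast ht
        have := le_max_left ((t : ℝ) - d i) 0
        have : (0 : ℝ) ≤ a i := (a i).2
        linarith
      · have h1 : (R : ℝ) ≤ a i := by exact_mod_cast (not_le.1 hi).le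
        have := le_max_right ((t : ℝ) - d i) 0
        linarith
  · rw [Real.toNNReal_le_iff_le_coe]
    refine (ciInf_le (hbdd (d i : ℝ)) i).trans ?_
    simp

theorem IsProperMap.exists_nat_bound {φ : ℝ≥0 → ℝ≥0} (hφ : IsProperMap φ) (R : ℝ≥0) :
    ∃ N : ℕ, ∀ n : ℕ, φ n ≤ R → n ≤ N := by
  have hc := hφ.isCompact_preimage (isCompact_Icc (a := 0) (b := R))
  obtain ⟨B, hB⟩ := hc.bddAbove
  obtain ⟨N, hN⟩ := exists_nat_ge B
  exact ⟨N, fun n hn => by exact_mod_cast (hB (show (n : ℝ≥0) ∈ _ from ⟨zero_le, hn⟩)).trans hN⟩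

theorem BallContractsIn.mono {W : Type} [MetricSpace W] {x : W} {r R R' : ℝ}
    (h : BallContractsIn x r R) (hR : R ≤ R') : BallContractsIn x r R' := by
  obtain ⟨h, hn⟩ := h
  have h' := Metric.ball_subset_ball (x := x) hR
  exact ⟨h.trans h', hn.comp_right ⟨Set.inclusion h', continuous_inclusion h'⟩⟩

/-- Balls of the sup metric are products of balls, so the inclusion is the product of the two
inclusions up to these identifications, and a product of null-homotopic maps is null-homotopic. -/
theorem BallContractsIn.prod {W₁ W₂ : Type} [MetricSpace W₁] [MetricSpace W₂] {x : W₁ × W₂}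
    {r R : ℝ} (h₁ : BallContractsIn x.1 r R) (h₂ : BallContractsIn x.2 r R) :
    BallContractsIn x r R := by
  obtain ⟨h₁, y₁, hn₁⟩ := h₁
  obtain ⟨h₂, y₂, hn₂⟩ := h₂
  have hb : ∀ r (z : W₁ × W₂), z ∈ Metric.ball x r ↔
      z.1 ∈ Metric.ball x.1 r ∧ z.2 ∈ Metric.ball x.2 r := fun r z => by
    rw [← ball_prod_same, Set.mem_prod]
  have h : Metric.ball x r ⊆ Metric.ball x R := fun z hz =>
    (hb R z).2 ⟨h₁ ((hb r z).1 hz).1, h₂ ((hb r z).1 hz).2⟩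
  let p : C(Metric.ball x r, Metric.ball x.1 r × Metric.ball x.2 r) :=
    ⟨fun z => (⟨z.1.1, ((hb r z).1 z.2).1⟩, ⟨z.1.2, ((hb r z).1 z.2).2⟩), by fun_prop⟩
  let q : C(Metric.ball x.1 R × Metric.ball x.2 R, Metric.ball x R) :=
    ⟨fun z => ⟨(z.1, z.2), (hb R _).2 ⟨z.1.2, z.2.2⟩⟩, by fun_prop⟩
  have hn : (ContinuousMap.prodMap ⟨Set.inclusion h₁, continuous_inclusion h₁⟩
      ⟨Set.inclusion h₂, continuous_inclusion h₂⟩).Nullhomotopic :=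
    ⟨(y₁, y₂), hn₁.prodMap hn₂⟩
  exact ⟨h, (hn.comp_left p).comp_right q⟩

theorem wordDist_fst_le (hS₁ : Subgroup.closure (S₁ : Set Γ₁) = ⊤)
    (hS : Subgroup.closure (S : Set (Γ₁ × Γ₂)) = ⊤) :
    ∃ C : ℕ, ∀ x y : Γ₁ × Γ₂, wordDist S₁ x.1 y.1 ≤ C * wordDist S x y :=
  exists_wordDist_map_le hS hS₁ (MonoidHom.fst Γ₁ Γ₂)

theorem wordDist_snd_le (hS₂ : Subgroup.closure (S₂ : Set Γ₂) = ⊤)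
    (hS : Subgroup.closure (S : Set (Γ₁ × Γ₂)) = ⊤) :
    ∃ C : ℕ, ∀ x y : Γ₁ × Γ₂, wordDist S₂ x.2 y.2 ≤ C * wordDist S x y :=
  exists_wordDist_map_le hS hS₂ (MonoidHom.snd Γ₁ Γ₂)

/-- Pass from x to y through (y.1, x.2). Each leg is a left translate of a segment inside one
factor, on which the inclusion of that factor is Lipschitz. -/
theorem wordDist_prod_le (hS₁ : Subgroup.closure (S₁ : Set Γ₁) = ⊤)
    (hS₂ : Subgroup.closure (S₂ : Set Γ₂) = ⊤)
    (hS : Subgroup.closure (S : Set (Γ₁ × Γ₂)) = ⊤) :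
    ∃ C : ℕ, ∀ x y : Γ₁ × Γ₂,
      wordDist S x y ≤ C * (wordDist S₁ x.1 y.1 + wordDist S₂ x.2 y.2) := by
  obtain ⟨C₁, h₁⟩ := exists_wordDist_map_le hS₁ hS (MonoidHom.inl Γ₁ Γ₂)
  obtain ⟨C₂, h₂⟩ := exists_wordDist_map_le hS₂ hS (MonoidHom.inr Γ₁ Γ₂)
  refine ⟨C₁ + C₂, fun x y => ?_⟩
  have h3 := wordDist_triangle hS x (y.1, x.2) y
  have h4 := wordDist_mul_left hS (1, x.2) (x.1, 1) (y.1, 1)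
  have h5 := wordDist_mul_left hS (y.1, 1) (1, x.2) (1, y.2)
  have h6 := h₁ x.1 y.1
  have h7 := h₂ x.2 y.2
  simp only [MonoidHom.inl_apply, MonoidHom.inr_apply] at h6 h7
  simp only [Prod.mk_mul_mk, one_mul, mul_one] at h4 h5
  rw [← h4] at h6
  rw [← h5] at h7
  refine h3.trans ((Nat.add_le_add h6 h7).trans ?_)
  nlinarith [Nat.zero_le (C₁ * wordDist S₂ x.2 y.2), Nat.zero_le (C₂ * wordDist S₁ x.1 y.1)]

theorem UniformlyProperIn.prod (hS₁ : Subgroup.closure (S₁ : Set Γ₁) = ⊤)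
    (hS₂ : Subgroup.closure (S₂ : Set Γ₂) = ⊤)
    (hS : Subgroup.closure (S : Set (Γ₁ × Γ₂)) = ⊤) {n₁ n₂ : ℕ}
    (h₁ : UniformlyProperIn S₁ n₁) (h₂ : UniformlyProperIn S₂ n₂) :
    UniformlyProperIn S (n₁ + n₂) := by
  obtain ⟨W₁, _, _, _, _, g₁, ⟨L₁, hL₁⟩, ⟨φ₁, hφ₁, hg₁⟩, ρ₁, hρ₁, hb₁⟩ := h₁
  obtain ⟨W₂, _, _, _, _, g₂, ⟨L₂, hL₂⟩, ⟨φ₂, hφ₂, hg₂⟩, ρ₂, hρ₂, hb₂⟩ := h₂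
  refine ⟨W₁ × W₂, inferInstance, inferInstance, euclideanChartedProd W₁ W₂ n₁ n₂,
    inferInstance, fun x => (g₁ x.1, g₂ x.2), ?_, ?_, fun r => max (ρ₁ r) (ρ₂ r),
    fun r hr => lt_max_of_lt_left (hρ₁ r hr), fun r hr x =>
      .prod ((hb₁ r hr x.1).mono (le_max_left _ _)) ((hb₂ r hr x.2).mono (le_max_right _ _))⟩
  · obtain ⟨C₁, hC₁⟩ := wordDist_fst_le hS₁ hS
    obtain ⟨C₂, hC₂⟩ := wordDist_snd_le hS₂ hS
    -- The given constants are arbitrary reals; with absolute values both summands are nonnegative,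
    -- so their sum dominates each of them and hence the sup metric.
    refine ⟨|L₁| * C₁ + |L₂| * C₂, fun x y => ?_⟩
    have h1 : (wordDist S₁ x.1 y.1 : ℝ) ≤ C₁ * wordDist S x y := by exact_mod_cast hC₁ x y
    have h2 : (wordDist S₂ x.2 y.2 : ℝ) ≤ C₂ * wordDist S x y := by exact_mod_cast hC₂ x y
    have h3 : dist (g₁ x.1) (g₁ y.1) ≤ |L₁| * (C₁ * wordDist S x y) :=
      (hL₁ _ _).trans ((mul_le_mul_of_nonneg_right (le_abs_self _) (Nat.cast_nonneg _)).trans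
        (mul_le_mul_of_nonneg_left h1 (abs_nonneg _)))
    have h4 : dist (g₂ x.2) (g₂ y.2) ≤ |L₂| * (C₂ * wordDist S x y) :=
      (hL₂ _ _).trans ((mul_le_mul_of_nonneg_right (le_abs_self _) (Nat.cast_nonneg _)).trans
        (mul_le_mul_of_nonneg_left h2 (abs_nonneg _)))
    have h5 : 0 ≤ |L₁| * (C₁ * wordDist S x y) := by positivity
    have h6 : 0 ≤ |L₂| * (C₂ * wordDist S x y) := by positivity
    rw [Prod.dist_eq]
    exact max_le (by linarith) (by linarith)
  · obtain ⟨C, hC⟩ := wordDist_prod_le hS₁ hS₂ hS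
    obtain ⟨φ, hφ, h⟩ := exists_isProperMap_le
      (fun p : (Γ₁ × Γ₂) × (Γ₁ × Γ₂) => nndist (g₁ p.1.1, g₂ p.1.2) (g₁ p.2.1, g₂ p.2.2))
      (fun p => wordDist S p.1 p.2) (fun R => by
        obtain ⟨N₁, hN₁⟩ := IsProperMap.exists_nat_bound hφ₁ R
        obtain ⟨N₂, hN₂⟩ := IsProperMap.exists_nat_bound hφ₂ R
        refine ⟨C * (N₁ + N₂), fun p hp => (hC _ _).trans ?_⟩
        have hp : max (nndist (g₁ p.1.1) (g₁ p.2.1)) (nndist (g₂ p.1.2) (g₂ p.2.2)) ≤ R := hp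
        exact Nat.mul_le_mul_left _ (Nat.add_le_add
          (hN₁ _ ((hg₁ _ _).trans ((le_max_left _ _).trans hp)))
          (hN₂ _ ((hg₂ _ _).trans ((le_max_right _ _).trans hp)))))
    exact ⟨φ, hφ, fun x y => h (x, y)⟩

theorem updim_prod_le (hS₁ : Subgroup.closure (S₁ : Set Γ₁) = ⊤)
    (hS₂ : Subgroup.closure (S₂ : Set Γ₂) = ⊤)
    (hS : Subgroup.closure (S : Set (Γ₁ × Γ₂)) = ⊤) : updim S ≤ updim S₁ + updim S₂ :=
  iInf_natCast_le_add fun _ _ h₁ h₂ => h₁.prod hS₁ hS₂ hS h₂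

end Product

end ObstructorDim

namespace ObstructorDim

universe u v

/-! ### Ends of groups through almost invariant sets. -/

section Ends

/-- `A` changes by a finite set under right translations. -/
def AlmostInvariant {Γ : Type u} [Group Γ] (A : Set Γ) : Prop :=
  ∀ g : Γ, {x | ¬(x ∈ A ↔ x * g ∈ A)}.Finite

/-- `Γ` contains `n` disjoint infinite almost invariant sets. -/
def HasEnds (Γ : Type u) [Group Γ] (n : ℕ) : Prop :=
  ∃ A : Fin n → Set Γ, Pairwise (fun i j => Disjoint (A i) (A j)) ∧
    ∀ i, (A i).Infinite ∧ AlmostInvariant (A i)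

variable {Γ : Type u} [Group Γ] {S : Finset Γ}

/-- The elements g whose right translation changes A by a finite set form a subgroup. -/
theorem AlmostInvariant.of_generators (hS : Subgroup.closure (S : Set Γ) = ⊤) {A : Set Γ}
    (h : ∀ s ∈ S, {x | ¬(x ∈ A ↔ x * s ∈ A)}.Finite) : AlmostInvariant A := by
  intro g
  have hg : g ∈ Subgroup.closure (S : Set Γ) := hS ▸ Subgroup.mem_top g
  induction hg using Subgroup.closure_induction with
  | mem x hx => exact h x hx
  | one => simp
  | mul g k _ _ hg hk =>
    refine (hg.union (hk.preimage (f := (· * g)) (mul_left_injective g).injOn)).subset ?_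
    intro x hx
    by_cases h1 : x ∈ A ↔ x * g ∈ A
    · refine Or.inr fun h2 => hx (h1.trans ?_)
      rwa [mul_assoc] at h2
    · exact Or.inl h1
  | inv g _ hg =>
    refine (hg.preimage (f := (· * g⁻¹)) (mul_left_injective g⁻¹).injOn).subset ?_
    intro x hx h1
    simp only [inv_mul_cancel_right] at h1
    exact hx h1.symm

theorem iff_of_generators (hS : Subgroup.closure (S : Set Γ) = ⊤) {p : Γ → Prop}
    (h : ∀ x, ∀ s ∈ S, p x ↔ p (x * s)) (x y : Γ) : p x ↔ p y := by
  have key : ∀ x, p 1 ↔ p x := by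
    intro x
    have hx : x ∈ Subgroup.closure (S : Set Γ) := hS ▸ Subgroup.mem_top x
    induction hx using Subgroup.closure_induction_right with
    | one => rfl
    | mul_right x hx y hy ih => exact ih.trans (h x y hy)
    | mul_inv_cancel x hx y hy ih =>
      refine ih.trans ?_
      have := h (x * y⁻¹) y hy
      rw [inv_mul_cancel_right] at this
      exact this.symm
  exact (key x).symm.trans (key y)

/-- Complements of finite sets have finitely many components, so the inverse system of components is
Mittag-Leffler. An infinite component belongs to the eventual range, and sections surject onto
eventual ranges. -/
theorem mem_end_of_infinite (hS : Subgroup.closure (S : Set Γ) = ⊤) (K : Finset Γ)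
    (C : (SimpleGraph.mulCayley (S : Set Γ)).ComponentCompl K) (hC : (C : Set Γ).Infinite) :
    ∃ e ∈ (SimpleGraph.mulCayley (S : Set Γ)).end, e (Opposite.op K) = C := by
  have : Infinite Γ := by
    rw [← Set.infinite_univ_iff]
    exact hC.mono (Set.subset_univ _)
  let G := SimpleGraph.mulCayley (S : Set Γ)
  let _ : G.LocallyFinite := fun x => (cayley_neighborSet_finite x).fintype
  have _ : Fact G.Preconnected := ⟨(cayley_connected hS).preconnected⟩
  let F := G.componentComplFunctor
  have _ : ∀ j, Finite (F.obj j) := fun j => G.componentCompl_finite j.unop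
  have _ : ∀ j, Nonempty (F.obj j) := fun j => G.componentCompl_nonempty_of_infinite j.unop
  have hF : F.IsMittagLeffler :=
    F.isMittagLeffler_of_exists_finite_range fun j => ⟨j, CategoryTheory.CategoryStruct.id j,
      Set.toFinite _⟩
  have _ := F.toEventualRanges_nonempty hF
  have hC' : C ∈ F.eventualRange (Opposite.op K) :=
    (SimpleGraph.infinite_iff_in_eventualRange (K := Opposite.op K) _ C).1 hC
  obtain ⟨e, he⟩ := F.toEventualRanges.eval_section_surjective_of_surjective
    (F.surjective_toEventualRanges hF) (Opposite.op K) ⟨C, hC'⟩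
  exact ⟨_, (F.toEventualRangesSectionsEquiv e).2, congrArg Subtype.val he⟩

theorem end_infinite {e : (K : (Finset Γ)ᵒᵖ) →
      (SimpleGraph.mulCayley (S : Set Γ)).componentComplFunctor.obj K}
    (he : e ∈ (SimpleGraph.mulCayley (S : Set Γ)).end) (K : (Finset Γ)ᵒᵖ) :
    (e K).supp.Infinite := by
  refine (e K).infinite_iff_in_all_ranges.mpr fun L h => ?_
  exact ⟨e (Opposite.op L), he (CategoryTheory.opHomOfLE h)⟩

theorem componentCompl_almostInvariant (hS : Subgroup.closure (S : Set Γ) = ⊤) (K : Finset Γ)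
    (C : (SimpleGraph.mulCayley (S : Set Γ)).ComponentCompl K) :
    AlmostInvariant (C : Set Γ) := by
  refine .of_generators hS fun s hs => ?_
  refine (K.finite_toSet.union
    (K.finite_toSet.preimage (f := (· * s)) (mul_left_injective s).injOn)).subset ?_
  intro x hx
  by_contra h
  simp only [Set.mem_union, Set.mem_preimage, Finset.mem_coe, not_or] at h
  by_cases hxs : x = x * s
  · exact hx (by rw [← hxs])
  have hadj : (SimpleGraph.mulCayley (S : Set Γ)).Adj x (x * s) :=
    (SimpleGraph.mulCayley_adj' _ _ _).2 ⟨hxs, s, hs, Or.inl rfl⟩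
  exact hx ⟨fun hx => C.mem_of_adj _ _ hx h.2 hadj, fun hx => C.mem_of_adj _ _ hx h.1 hadj.symm⟩

/-- Let K contain the endpoints of all edges leaving some A i. Outside K each A i is a union of
components, and there are only finitely many, so the infinite set A i contains an infinite one.
Extending these components to ends gives n distinct ends, since the A i are disjoint. -/
theorem HasEnds.le_encard (hS : Subgroup.closure (S : Set Γ) = ⊤) {n : ℕ} (h : HasEnds Γ n) :
    (n : ℕ∞) ≤ (SimpleGraph.mulCayley (S : Set Γ)).end.encard := by
  classical
  obtain ⟨A, hA, hA'⟩ := h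
  let G := SimpleGraph.mulCayley (S : Set Γ)
  let _ : G.LocallyFinite := fun x => (cayley_neighborSet_finite x).fintype
  have _ : Fact G.Preconnected := ⟨(cayley_connected hS).preconnected⟩
  have hfin : (⋃ i, ⋃ s ∈ S, {x | ¬(x ∈ A i ↔ x * s ∈ A i)} ∪
      (· * s) '' {x | ¬(x ∈ A i ↔ x * s ∈ A i)}).Finite := by
    refine Set.finite_iUnion fun i => S.finite_toSet.biUnion fun s _ => ?_
    exact ((hA' i).2 s).union (((hA' i).2 s).image _)
  let K := hfin.toFinset
  have hK : ∀ i, ∀ s ∈ S, ∀ x, ¬(x ∈ A i ↔ x * s ∈ A i) → x ∈ K ∧ x * s ∈ K := by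
    intro i s hs x hx
    simp only [K, Set.Finite.mem_toFinset, Set.mem_iUnion]
    exact ⟨⟨i, s, hs, Or.inl hx⟩, ⟨i, s, hs, Or.inr ⟨x, hx, rfl⟩⟩⟩
  have hmem : ∀ i, ∀ C : G.ComponentCompl K, ∀ x ∈ C, ∀ y ∈ C, (x ∈ A i ↔ y ∈ A i) := by
    intro i C x hx y hy
    obtain ⟨hxK, rfl⟩ := hx
    obtain ⟨hyK, hy⟩ := hy
    let f : G.ComponentCompl K → Prop := SimpleGraph.ComponentCompl.lift (fun v _ => v ∈ A i) (by
      intro v w hv hw h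
      obtain ⟨-, s, hs, rfl | rfl⟩ := (SimpleGraph.mulCayley_adj' _ _ _).1 h
      · exact propext (not_not.1 fun h => hv (hK i s hs _ h).1)
      · exact propext (not_not.1 fun h => hw (hK i s hs _ h).1).symm)
    exact iff_of_eq (congrArg f hy).symm
  have hex : ∀ i, ∃ C : G.ComponentCompl K, (C : Set Γ).Infinite ∧ (C : Set Γ) ⊆ A i := by
    intro i
    by_contra! hne
    refine (hA' i).1 ((K.finite_toSet.union (Set.finite_iUnion
      (f := fun C : {C : G.ComponentCompl K // (C : Set Γ).Finite} => (C.1 : Set Γ))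
      fun C => C.2)).subset fun x hx => ?_)
    by_cases hxK : x ∈ K
    · exact Or.inl hxK
    · right
      have hxC : x ∈ G.componentComplMk hxK := ⟨hxK, rfl⟩
      refine Set.mem_iUnion.2 ⟨⟨G.componentComplMk hxK, ?_⟩, hxC⟩
      by_contra hinf
      exact hne _ hinf fun y hy => (hmem i _ x hxC y hy).1 hx
  choose C hCinf hCA using hex
  choose e he heC using fun i => mem_end_of_infinite hS K (C i) (hCinf i)
  have hinj : Function.Injective e := by
    intro i j hij
    by_contra hne
    have hC : C i = C j := by rw [← heC i, ← heC j, hij]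
    obtain ⟨x, hx⟩ := (hCinf i).nonempty
    exact Set.disjoint_left.1 (hA hne) (hCA i hx) (hCA j (hC ▸ hx))
  calc (n : ℕ∞) = (Set.range e).encard := by
        rw [← Set.image_univ, hinj.encard_image]; simp
    _ ≤ _ := Set.encard_le_encard (Set.range_subset_iff.2 he)

/-- Finitely many distinct ends are separated by one finite set K'. The components of its complement
that they choose are disjoint, infinite and almost invariant. -/
theorem HasEnds.of_le_encard (hS : Subgroup.closure (S : Set Γ) = ⊤) {n : ℕ}
    (h : (n : ℕ∞) ≤ (SimpleGraph.mulCayley (S : Set Γ)).end.encard) : HasEnds Γ n := by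
  classical
  obtain ⟨E, hE, hn⟩ := Set.exists_subset_encard_eq h
  have hfin : E.Finite := Set.finite_of_encard_eq_coe hn
  have hcard : Nat.card E = n := by
    rw [Nat.card_coe_set_eq, Set.ncard, hn, ENat.toNat_natCast]
  have := hfin.to_subtype
  let e : Fin n ≃ E := (Finite.equivFinOfCardEq hcard).symm
  have hsep : ∀ i j, ∃ K : Finset Γ, i ≠ j → (e i).1 (Opposite.op K) ≠ (e j).1 (Opposite.op K) := by
    intro i j
    by_contra! hne
    refine (hne ∅).1 (e.injective (Subtype.ext (funext fun K => ?_)))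
    exact (hne K.unop).2
  choose K hK using hsep
  let K' : Finset Γ := Finset.univ.biUnion fun i => Finset.univ.biUnion (K i)
  have hsub : ∀ i j, K i j ⊆ K' := fun i j =>
    (Finset.subset_biUnion_of_mem (K i) (Finset.mem_univ j)).trans
      (Finset.subset_biUnion_of_mem (fun i => Finset.univ.biUnion (K i)) (Finset.mem_univ i))
  let C : Fin n → (SimpleGraph.mulCayley (S : Set Γ)).ComponentCompl K' :=
    fun i => (e i).1 (Opposite.op K')
  refine ⟨fun i => C i, fun i j hij => ?_, fun i =>
    ⟨end_infinite (hE (e i).2) _, componentCompl_almostInvariant hS _ _⟩⟩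
  refine SimpleGraph.ComponentCompl.pairwise_disjoint fun hC => hK i j hij ?_
  have h1 := hE (e i).2 (CategoryTheory.opHomOfLE (y := Opposite.op K')
    (x := Opposite.op (K i j)) (hsub i j))
  have h2 := hE (e j).2 (CategoryTheory.opHomOfLE (y := Opposite.op K')
    (x := Opposite.op (K i j)) (hsub i j))
  rw [← h1, ← h2]
  exact congrArg _ hC

/-- The right-hand side does not mention the generating set, so it can be transported along
homomorphisms. A Cayley graph with infinitely many ends has `ncard` equal to 0, which agrees with
both sides being false. -/
theorem twoEnded_iff (hS : Subgroup.closure (S : Set Γ) = ⊤) :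
    TwoEnded S ↔ HasEnds Γ 2 ∧ ¬ HasEnds Γ 3 := by
  have key : ∀ n, HasEnds Γ n ↔ (n : ℕ∞) ≤ (SimpleGraph.mulCayley (S : Set Γ)).end.encard :=
    fun n => ⟨fun h => h.le_encard hS, .of_le_encard hS⟩
  rw [key, key, TwoEnded, Set.ncard]
  generalize (SimpleGraph.mulCayley (S : Set Γ)).end.encard = c
  induction c using ENat.recTopCoe with
  | top => simp
  | coe c => norm_cast; simp; omega

/-- The ends do not change under retractions with finite kernel. -/
theorem hasEnds_iff_of_retract {Δ : Type v} [Group Δ] (ι : Δ →* Γ) (π : Γ →* Δ)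
    (h : ∀ x, π (ι x) = x) (hk : {g | π g = 1}.Finite) (n : ℕ) : HasEnds Γ n ↔ HasEnds Δ n := by
  have hι : Function.Injective ι := Function.LeftInverse.injective h
  have hdec : ∀ z, ∃ k, π k = 1 ∧ z = ι (π z) * k := fun z =>
    ⟨(ι (π z))⁻¹ * z, by simp [h], by simp⟩
  have hfib : ∀ B : Set Δ, B.Finite → (π ⁻¹' B).Finite := by
    intro B hB
    refine (Set.Finite.image2 (fun b k => ι b * k) hB hk).subset ?_
    intro z hz
    obtain ⟨k, hk, hz'⟩ := hdec z
    exact ⟨π z, hz, k, hk, hz'.symm⟩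
  constructor
  · rintro ⟨A, hA, hA'⟩
    refine ⟨fun i => ι ⁻¹' A i, fun i j hij => (hA hij).preimage _, fun i => ⟨fun hfin => ?_, ?_⟩⟩
    -- If A i met ι Δ in a finite set, it would be finite: for z = ι(π z) k in A i, either ι(π z) is
    -- in A i, or it is one of the finitely many elements whose membership changes under right
    -- multiplication by k. There are finitely many k.
    · refine (hA' i).1 ((hk.biUnion fun k _ => (hfin.union
        (((hA' i).2 k).preimage hι.injOn)).image fun y => ι y * k).subset fun z hz => ?_)
      obtain ⟨k, hk, hz'⟩ := hdec z
      refine Set.mem_biUnion hk ⟨π z, ?_, hz'.symm⟩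
      by_cases h1 : ι (π z) ∈ A i
      · exact Or.inl h1
      · refine Or.inr fun h2 => h1 (h2.2 ?_)
        rwa [← hz']
    · intro g
      refine (((hA' i).2 (ι g)).preimage hι.injOn).subset fun x hx => ?_
      simpa using hx
  · rintro ⟨A, hA, hA'⟩
    refine ⟨fun i => π ⁻¹' A i, fun i j hij => (hA hij).preimage _, fun i => ⟨fun hfin => ?_, ?_⟩⟩
    · refine (hA' i).1 ((hfin.image π).subset fun x hx => ⟨ι x, ?_, h x⟩)
      rwa [Set.mem_preimage, h]
    · intro g
      refine (hfib _ ((hA' i).2 (π g))).subset fun x hx => ?_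
      simpa using hx

/-- A product of two infinite finitely generated groups has at most one end. -/
theorem not_hasEnds_prod {Γ₁ : Type u} {Γ₂ : Type v} [Group Γ₁] [Group Γ₂] [Infinite Γ₁]
    [Infinite Γ₂] {S₁ : Finset Γ₁} {S₂ : Finset Γ₂}
    (hS₁ : Subgroup.closure (S₁ : Set Γ₁) = ⊤) (hS₂ : Subgroup.closure (S₂ : Set Γ₂) = ⊤) :
    ¬ HasEnds (Γ₁ × Γ₂) 2 := by
  rintro ⟨A, hA, hA'⟩
  let D : Set (Γ₁ × Γ₂) := (⋃ i, ⋃ s ∈ S₁, {x | ¬(x ∈ A i ↔ x * (s, 1) ∈ A i)}) ∪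
    ⋃ i, ⋃ s ∈ S₂, {x | ¬(x ∈ A i ↔ x * (1, s) ∈ A i)}
  have hD : D.Finite := (Set.finite_iUnion fun i => S₁.finite_toSet.biUnion fun s _ =>
    (hA' i).2 _).union (Set.finite_iUnion fun i => S₂.finite_toSet.biUnion fun s _ => (hA' i).2 _)
  obtain ⟨x₀, hx₀⟩ := (hD.image Prod.fst).exists_notMem
  obtain ⟨y₀, hy₀⟩ := (hD.image Prod.snd).exists_notMem
  -- A line {x} × Γ₂ that misses D is crossed by no boundary edge of A i, so it lies inside A i or
  -- outside it; likewise for Γ₁ × {y}.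
  have hx : ∀ i, ∀ x ∉ Prod.fst '' D, ∀ y y', (x, y) ∈ A i ↔ (x, y') ∈ A i := by
    intro i x hx y y'
    refine iff_of_generators (p := fun y => (x, y) ∈ A i) hS₂ (fun y s hs => ?_) y y'
    by_contra hne
    refine hx ⟨(x, y), Or.inr ?_, rfl⟩
    simp only [Set.mem_iUnion]
    exact ⟨i, s, hs, by simpa using hne⟩
  have hy : ∀ i, ∀ y ∉ Prod.snd '' D, ∀ x x', (x, y) ∈ A i ↔ (x', y) ∈ A i := by
    intro i y hy x x'
    refine iff_of_generators (p := fun x => (x, y) ∈ A i) hS₁ (fun x s hs => ?_) x x'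
    by_contra hne
    refine hy ⟨(x, y), Or.inl ?_, rfl⟩
    simp only [Set.mem_iUnion]
    exact ⟨i, s, hs, by simpa using hne⟩
  -- The infinite set A i has a point with a coordinate outside the projection of D. Membership
  -- travels along the line through that point and then along a line through (x₀, y₀), so all A i
  -- share (x₀, y₀).
  have hall : ∀ i, (x₀, y₀) ∈ A i := by
    intro i
    obtain ⟨⟨x, y⟩, hz, hz'⟩ := (hA' i).1.exists_notMem_finite
      ((hD.image Prod.fst).prod (hD.image Prod.snd))
    by_cases h1 : x ∈ Prod.fst '' D
    · have h2 : y ∉ Prod.snd '' D := fun h2 => hz' ⟨h1, h2⟩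
      exact (hx i x₀ hx₀ y y₀).1 ((hy i y h2 x x₀).1 hz)
    · exact (hy i y₀ hy₀ x x₀).1 ((hx i x h1 y y₀).1 hz)
  exact Set.disjoint_left.1 (hA (show (0 : Fin 2) ≠ 1 by decide)) (hall 0) (hall 1)

end Ends

end ObstructorDim

namespace ObstructorDim

/-! ### Sign patterns and circuits. -/

section Patterns

variable {V : Type*}

/-- Some nonzero element of `D` is nonnegative on `σ`, nonpositive on `τ`, and zero elsewhere. -/
def SignPattern (D : Submodule ℝ (V → ℝ)) (σ τ : Finset V) : Prop :=
  ∃ c ∈ D, c ≠ 0 ∧ (∀ v ∈ σ, 0 ≤ c v) ∧ (∀ v ∈ τ, c v ≤ 0) ∧ ∀ v, v ∉ σ → v ∉ τ → c v = 0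

theorem SignPattern.symm {D : Submodule ℝ (V → ℝ)} {σ τ : Finset V} (h : SignPattern D σ τ) :
    SignPattern D τ σ := by
  obtain ⟨c, hc, h0, h1, h2, h3⟩ := h
  exact ⟨-c, D.neg_mem hc, neg_ne_zero.2 h0, fun v hv => by simpa using h2 v hv,
    fun v hv => by simpa using h1 v hv, fun v h h' => by simpa using h3 v h' h⟩

/-- The unordered pairs that are sign patterns of elements of `D`. -/
def signPatterns (D : Submodule ℝ (V → ℝ)) : Set (Sym2 (Finset V)) :=
  Sym2.fromRel (r := SignPattern D) ⟨fun _ _ h => h.symm⟩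

theorem mem_signPatterns {D : Submodule ℝ (V → ℝ)} {σ τ : Finset V} :
    s(σ, τ) ∈ signPatterns D ↔ SignPattern D σ τ := Iff.rfl

/-- The elements of `D` supported in `s` are the multiples of `d`, whose support is `s`. -/
structure IsCircuit (D : Submodule ℝ (V → ℝ)) (s : Finset V) (d : V → ℝ) : Prop where
  mem : d ∈ D
  ne_zero_iff : ∀ v, d v ≠ 0 ↔ v ∈ s
  eq_smul : ∀ c ∈ D, (∀ v ∉ s, c v = 0) → ∃ r : ℝ, c = r • d

/-- An element of D witnessing the pattern is supported in σ ∪ τ, hence a nonzero multiple of d;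
only the sign of the factor is free. -/
theorem IsCircuit.signPattern_iff [DecidableEq V] {D : Submodule ℝ (V → ℝ)} {σ τ : Finset V}
    {d : V → ℝ} (hd : IsCircuit D (σ ∪ τ) d) (hd0 : d ≠ 0) :
    SignPattern D σ τ ↔ ((∀ v ∈ σ, 0 < d v) ∧ ∀ v ∈ τ, d v < 0) ∨
      ((∀ v ∈ σ, d v < 0) ∧ ∀ v ∈ τ, 0 < d v) := by
  have hσ : ∀ v ∈ σ, d v ≠ 0 := fun v hv => (hd.ne_zero_iff v).2 (Finset.mem_union_left _ hv)
  have hτ : ∀ v ∈ τ, d v ≠ 0 := fun v hv => (hd.ne_zero_iff v).2 (Finset.mem_union_right _ hv)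
  have h0 : ∀ v, v ∉ σ → v ∉ τ → d v = 0 := fun v h h' => by
    by_contra hne
    rcases Finset.mem_union.1 ((hd.ne_zero_iff v).1 hne) with h1 | h1 <;> contradiction
  constructor
  · rintro ⟨c, hc, hc0, h1, h2, h3⟩
    obtain ⟨r, rfl⟩ := hd.eq_smul c hc fun v hv => by
      simp only [Finset.mem_union, not_or] at hv
      exact h3 v hv.1 hv.2
    have hr : r ≠ 0 := fun h => hc0 (by simp [h])
    rcases lt_or_gt_of_ne hr with hr | hr
    · refine Or.inr ⟨fun v hv => lt_of_le_of_ne ?_ (hσ v hv),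
        fun v hv => lt_of_le_of_ne ?_ (hτ v hv).symm⟩
      · exact nonpos_of_mul_nonneg_right (h1 v hv) hr
      · exact nonneg_of_mul_nonpos_right (h2 v hv) hr
    · refine Or.inl ⟨fun v hv => lt_of_le_of_ne ?_ (hσ v hv).symm,
        fun v hv => lt_of_le_of_ne ?_ (hτ v hv)⟩
      · exact nonneg_of_mul_nonneg_right (h1 v hv) hr
      · exact nonpos_of_mul_nonpos_right (h2 v hv) hr
  · intro h
    rcases h with h | h
    · exact ⟨d, hd.mem, hd0, fun v hv => (h.1 v hv).le, fun v hv => (h.2 v hv).le, h0⟩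
    · exact SignPattern.symm
        ⟨d, hd.mem, hd0, fun v hv => (h.2 v hv).le, fun v hv => (h.1 v hv).le, fun v h h' => h0 v h' h⟩

end Patterns

/-! ### Affine dependences and intersection numbers. -/

section AffineDependences

variable {V : Type*} [Fintype V] {E : Type*} [AddCommGroup E] [Module ℝ E]

/-- The affine dependences of a family of points. -/
def affineDependences (f : V → E) : Submodule ℝ (V → ℝ) where
  carrier := {c | ∑ v, c v = 0 ∧ ∑ v, c v • f v = 0}
  add_mem' := by
    rintro a b ⟨ha, ha'⟩ ⟨hb, hb'⟩
    simp [Finset.sum_add_distrib, add_smul, ha, ha', hb, hb']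
  zero_mem' := by simp
  smul_mem' := by
    rintro r a ⟨ha, ha'⟩
    simp [← Finset.mul_sum, ha, mul_smul, ← Finset.smul_sum, ha']

theorem mem_affineDependences {f : V → E} {c : V → ℝ} :
    c ∈ affineDependences f ↔ ∑ v, c v = 0 ∧ ∑ v, c v • f v = 0 := Iff.rfl

theorem affineIndependent_iff_affineDependences {f : V → E} {s : Finset V} :
    AffineIndependent ℝ (fun v : s => f v) ↔
      ∀ c ∈ affineDependences f, (∀ v ∉ s, c v = 0) → c = 0 := by
  classical
  rw [affineIndependent_iff]
  constructor
  · rintro h c ⟨h1, h2⟩ h3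
    have e1 : ∑ v : s, c v = 0 := by
      rw [Finset.sum_coe_sort s c, ← h1]
      exact Finset.sum_subset (Finset.subset_univ s) fun v _ hv => h3 v hv
    have e2 : ∑ v : s, c v • f v = 0 := by
      rw [Finset.sum_coe_sort s fun v => c v • f v, ← h2]
      exact Finset.sum_subset (Finset.subset_univ s) fun v _ hv => by simp [h3 v hv]
    funext v
    by_cases hv : v ∈ s
    · exact h Finset.univ (fun v => c v) e1 e2 ⟨v, hv⟩ (Finset.mem_univ _)
    · exact h3 v hv
  · intro h t w h1 h2 e he
    let c : V → ℝ := fun v => if hv : v ∈ s then if (⟨v, hv⟩ : s) ∈ t then w ⟨v, hv⟩ else 0 else 0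
    have hc : ∀ v : s, c v = if v ∈ t then w v else 0 := fun v => by simp [c]
    have hc0 : ∀ v ∉ s, c v = 0 := fun v hv => by simp [c, hv]
    have e1 : ∑ v, c v = 0 := by
      rw [← Finset.sum_subset (Finset.subset_univ s) fun v _ hv => hc0 v hv,
        ← Finset.sum_coe_sort s c]
      simp only [hc]
      rwa [Finset.sum_ite_mem, Finset.univ_inter]
    have e2 : ∑ v, c v • f v = 0 := by
      rw [← Finset.sum_subset (Finset.subset_univ s) fun v _ hv => by rw [hc0 v hv, zero_smul],
        ← Finset.sum_coe_sort s fun v => c v • f v]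
      simp only [hc, ite_smul, zero_smul]
      rwa [Finset.sum_ite_mem, Finset.univ_inter]
    have := congrFun (h c ⟨e1, e2⟩ hc0) e
    simpa [hc, he] using this

variable [DecidableEq V]

/-- In general position, `m + 2` points in dimension `m` form a circuit. -/
theorem GeneralPosition.exists_isCircuit {V : Type} [Fintype V] [DecidableEq V] {m : ℕ}
    {f : V → EuclideanSpace ℝ (Fin m)}
    (hf : GeneralPosition m f) {s : Finset V} (hs : s.card = m + 2) :
    ∃ d, IsCircuit (affineDependences f) s d := by
  have hdep : ¬ AffineIndependent ℝ (fun v : s => f v) := by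
    intro h
    have := h.card_le_finrank_succ
    have h2 := Submodule.finrank_le (vectorSpan ℝ (Set.range fun v : s => f v))
    simp [hs] at this h2
    omega
  rw [affineIndependent_iff_affineDependences] at hdep
  push Not at hdep
  obtain ⟨d, hd, hds, hd0⟩ := hdep
  -- A dependence on s that vanishes at one vertex lives on m + 1 points, which are independent.
  -- This gives both full support and uniqueness up to scale.
  have key : ∀ c ∈ affineDependences f, (∀ v ∉ s, c v = 0) → ∀ v ∈ s, c v = 0 → c = 0 := by
    intro c hc hcs v hv hcv
    refine affineIndependent_iff_affineDependences.1 (hf (s.erase v) ?_) c hc fun w hw => ?_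
    · rw [Finset.card_erase_of_mem hv]; omega
    · by_cases h : w = v
      · rw [h, hcv]
      · exact hcs w fun h' => hw (Finset.mem_erase.2 ⟨h, h'⟩)
  refine ⟨d, hd, fun v => ⟨fun h => by_contra fun h' => h (hds v h'), fun hv h =>
    hd0 (key d hd hds v hv h)⟩, fun c hc hcs => ?_⟩
  obtain ⟨v, hv⟩ : s.Nonempty := Finset.card_pos.1 (by omega)
  have hdv : d v ≠ 0 := fun h => hd0 (key d hd hds v hv h)
  refine ⟨c v / d v, ?_⟩
  rw [← sub_eq_zero]
  refine key _ (Submodule.sub_mem _ hc (Submodule.smul_mem _ _ hd)) (fun w hw => ?_) v hv ?_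
  · simp [hds w hw, hcs w hw]
  · simp [hdv]

theorem mem_convexHull_image_iff {f : V → E} {σ : Finset V} {y : E} :
    y ∈ convexHull ℝ (f '' (σ : Set V)) ↔
      ∃ w : V → ℝ, (∀ v, 0 ≤ w v) ∧ (∀ v ∉ σ, w v = 0) ∧ ∑ v, w v = 1 ∧ ∑ v, w v • f v = y := by
  constructor
  · intro h
    have hconv : Convex ℝ {y | ∃ w : V → ℝ, (∀ v, 0 ≤ w v) ∧ (∀ v ∉ σ, w v = 0) ∧
        ∑ v, w v = 1 ∧ ∑ v, w v • f v = y} := by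
      rintro x ⟨w, h1, h2, h3, rfl⟩ y ⟨u, g1, g2, g3, rfl⟩ a b ha hb hab
      refine ⟨fun v => a * w v + b * u v, fun v => ?_, fun v hv => ?_, ?_, ?_⟩
      · have := h1 v
        have := g1 v
        positivity
      · simp [h2 v hv, g2 v hv]
      · simp [Finset.sum_add_distrib, ← Finset.mul_sum, h3, g3, hab]
      · simp [Finset.sum_add_distrib, add_smul, mul_smul, ← Finset.smul_sum]
    refine convexHull_min ?_ hconv h
    rintro _ ⟨v, hv, rfl⟩
    refine ⟨Pi.single v 1, fun w => ?_, fun w hw => ?_, by simp, ?_⟩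
    · by_cases h : w = v
      · subst h; simp
      · simp [h]
    · have : w ≠ v := fun h => hw (h ▸ hv)
      simp [this]
    · simp [Pi.single_apply, ite_smul]
  · rintro ⟨w, h1, h2, h3, rfl⟩
    have e1 : ∑ v ∈ σ, w v = 1 := by
      rw [← h3]; exact Finset.sum_subset (Finset.subset_univ σ) fun v _ hv => h2 v hv
    have e2 : ∑ v ∈ σ, w v • f v = ∑ v, w v • f v :=
      Finset.sum_subset (Finset.subset_univ σ) fun v _ hv => by simp [h2 v hv]
    rw [← e2]
    exact (convex_convexHull ℝ _).sum_mem (fun v _ => h1 v) e1 fun v hv =>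
      subset_convexHull ℝ _ ⟨v, hv, rfl⟩

theorem sub_mem_affineDependences {f : V → E} {σ τ : Finset V} (hdisj : Disjoint σ τ)
    {w u : V → ℝ} (h2 : ∀ v ∉ σ, w v = 0) (h3 : ∑ v, w v = 1)
    (g2 : ∀ v ∉ τ, u v = 0) (g3 : ∑ v, u v = 1) (h : ∑ v, w v • f v = ∑ v, u v • f v) :
    w - u ∈ affineDependences f ∧ (∀ v ∈ σ, (w - u) v = w v) ∧ (∀ v ∈ τ, (w - u) v = - u v) ∧
      ∀ v ∉ σ ∪ τ, (w - u) v = 0 := by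
  refine ⟨⟨by simp [h3, g3], by simp [sub_smul, h]⟩, fun v hv => ?_, fun v hv => ?_,
    fun v hv => ?_⟩
  · simp [g2 v (Finset.disjoint_left.1 hdisj hv)]
  · simp [h2 v (Finset.disjoint_right.1 hdisj hv)]
  · simp only [Finset.mem_union, not_or] at hv
    simp [h2 v hv.1, g2 v hv.2]

/-- The convex hulls of two disjoint sets of vertices meet if and only if the pair is a sign
pattern of an affine dependence. -/
theorem convexHull_inter_nonempty_iff {f : V → E} {σ τ : Finset V} (hdisj : Disjoint σ τ) :
    (convexHull ℝ (f '' (σ : Set V)) ∩ convexHull ℝ (f '' (τ : Set V))).Nonempty ↔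
      SignPattern (affineDependences f) σ τ := by
  constructor
  · rintro ⟨y, hy, hy'⟩
    obtain ⟨w, a1, a2, a3, a4⟩ := mem_convexHull_image_iff.1 hy
    obtain ⟨u, b1, b2, b3, b4⟩ := mem_convexHull_image_iff.1 hy'
    obtain ⟨e1, e2, e3, e4⟩ := sub_mem_affineDependences hdisj a2 a3 b2 b3 (a4.trans b4.symm)
    refine ⟨w - u, e1, fun h0 => ?_, fun v hv => (a1 v).trans_eq (e2 v hv).symm,
      fun v hv => (e3 v hv).trans_le (neg_nonpos.2 (b1 v)), fun v h h' => e4 v (by simp [h, h'])⟩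
    have : ∑ v, w v = 0 := Finset.sum_eq_zero fun v _ => by
      by_cases hv : v ∈ σ
      · rw [← e2 v hv, h0, Pi.zero_apply]
      · exact a2 v hv
    rw [a3] at this
    exact one_ne_zero this
  · rintro ⟨c, ⟨hc1, hc2⟩, hc0, h1, h2, h3⟩
    -- Radon's argument: the positive and negative parts of c have the same mass T and the same
    -- weighted sum of points. Dividing by T, which is positive as c is nonzero with total 0, gives
    -- a common point.
    have hpos : 0 < ∑ v, max (c v) 0 := by
      refine lt_of_le_of_ne (Finset.sum_nonneg fun v _ => le_max_right _ _) fun h => hc0 ?_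
      rw [eq_comm, Finset.sum_eq_zero_iff_of_nonneg fun v _ => le_max_right _ _] at h
      have hle : ∀ v, c v ≤ 0 := fun v => (le_max_left _ _).trans (h v (Finset.mem_univ v)).le
      have := (Finset.sum_eq_zero_iff_of_nonpos fun v _ => hle v).1 hc1
      exact funext fun v => this v (Finset.mem_univ v)
    have hc : ∀ v, c v = max (c v) 0 - max (-c v) 0 := fun v => by
      rcases le_total (c v) 0 with h | h <;> simp [h]
    have hT : ∑ v, max (-c v) 0 = ∑ v, max (c v) 0 := by
      rw [Finset.sum_congr rfl fun v _ => hc v, Finset.sum_sub_distrib, sub_eq_zero] at hc1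
      exact hc1.symm
    have hTf : ∑ v, max (-c v) 0 • f v = ∑ v, max (c v) 0 • f v := by
      rw [Finset.sum_congr rfl fun v _ => by rw [hc v, sub_smul], Finset.sum_sub_distrib,
        sub_eq_zero] at hc2
      exact hc2.symm
    set T := ∑ v, max (c v) 0
    refine ⟨∑ v, (T⁻¹ * max (c v) 0) • f v, ?_, ?_⟩
    · refine mem_convexHull_image_iff.2 ⟨fun v => T⁻¹ * max (c v) 0, fun v => by positivity,
        fun v hv => ?_, ?_, rfl⟩
      · have : c v ≤ 0 := by
          by_cases hv' : v ∈ τ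
          · exact h2 v hv'
          · exact (h3 v hv hv').le
        simp [this]
      · rw [← Finset.mul_sum, inv_mul_cancel₀ hpos.ne']
    · refine mem_convexHull_image_iff.2 ⟨fun v => T⁻¹ * max (-c v) 0, fun v => by positivity,
        fun v hv => ?_, ?_, ?_⟩
      · have : 0 ≤ c v := by
          by_cases hv' : v ∈ σ
          · exact h1 v hv'
          · exact (h3 v hv' hv).ge
        simp [this]
      · rw [← Finset.mul_sum, hT, inv_mul_cancel₀ hpos.ne']
      · simp only [mul_smul, ← Finset.smul_sum, hTf]

/-- Two expressions of a common point differ by a multiple of d, and the factor is forced because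
the weights on σ add up to 1. -/
theorem IsCircuit.convexHull_inter_subsingleton {f : V → E} {σ τ : Finset V} {d : V → ℝ}
    (hd : IsCircuit (affineDependences f) (σ ∪ τ) d) (hdisj : Disjoint σ τ) :
    (convexHull ℝ (f '' (σ : Set V)) ∩ convexHull ℝ (f '' (τ : Set V))).Subsingleton := by
  rintro y ⟨hy, hy'⟩ y' ⟨hz, hz'⟩
  obtain ⟨w, a1, a2, a3, a4⟩ := mem_convexHull_image_iff.1 hy
  obtain ⟨u, b1, b2, b3, b4⟩ := mem_convexHull_image_iff.1 hy'
  obtain ⟨w', a1', a2', a3', a4'⟩ := mem_convexHull_image_iff.1 hz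
  obtain ⟨u', b1', b2', b3', b4'⟩ := mem_convexHull_image_iff.1 hz'
  obtain ⟨e1, e2, -, e4⟩ := sub_mem_affineDependences hdisj a2 a3 b2 b3 (a4.trans b4.symm)
  obtain ⟨e1', e2', -, e4'⟩ := sub_mem_affineDependences hdisj a2' a3' b2' b3' (a4'.trans b4'.symm)
  obtain ⟨r, hr⟩ := hd.eq_smul _ e1 e4
  obtain ⟨r', hr'⟩ := hd.eq_smul _ e1' e4'
  have hs : ∑ v ∈ σ, w v = 1 := by
    rw [← a3]; exact Finset.sum_subset (Finset.subset_univ σ) fun v _ hv => a2 v hv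
  have hs' : ∑ v ∈ σ, w' v = 1 := by
    rw [← a3']; exact Finset.sum_subset (Finset.subset_univ σ) fun v _ hv => a2' v hv
  rw [← Finset.sum_congr rfl e2, hr] at hs
  rw [← Finset.sum_congr rfl e2', hr'] at hs'
  simp only [Pi.smul_apply, smul_eq_mul, ← Finset.mul_sum] at hs hs'
  have hd1 : ∑ v ∈ σ, d v ≠ 0 := fun h => by simp [h] at hs
  have hrr : r = r' := mul_right_cancel₀ hd1 (hs.trans hs'.symm)
  rw [← a4, ← a4']
  refine Finset.sum_congr rfl fun v _ => ?_
  by_cases hv : v ∈ σ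
  · rw [← e2 v hv, ← e2' v hv, hr, hr', hrr]
  · rw [a2 v hv, a2' v hv]

open Classical in
/-- For a circuit, the number of intersections is determined by the signs. -/
theorem intersectionNumber_eq {V : Type} [Fintype V] [DecidableEq V] {m : ℕ}
    {f : V → EuclideanSpace ℝ (Fin m)}
    {σ τ : Finset V} {d : V → ℝ} (hd : IsCircuit (affineDependences f) (σ ∪ τ) d)
    (hdisj : Disjoint σ τ) :
    intersectionNumber f s(σ, τ) = if s(σ, τ) ∈ signPatterns (affineDependences f) then 1 else 0 := by
  have hset : {y | ∀ ρ ∈ s(σ, τ), y ∈ convexHull ℝ (f '' (ρ : Set V))} =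
      convexHull ℝ (f '' (σ : Set V)) ∩ convexHull ℝ (f '' (τ : Set V)) := by
    ext y
    simp
  rw [intersectionNumber, hset, mem_signPatterns, ← convexHull_inter_nonempty_iff hdisj]
  have hsub := hd.convexHull_inter_subsingleton hdisj
  split_ifs with hp
  · obtain ⟨y, hy⟩ := hp
    rw [hsub.eq_singleton_of_mem hy, Set.ncard_singleton]
  · rw [Set.not_nonempty_iff_eq_empty.1 hp, Set.ncard_empty]

end AffineDependences

/-! ### Perturbation to general position. -/

section GeneralPosition

variable {V : Type} [Fintype V]

/-- Any family of at most `m + 1` points can be perturbed to be affinely independent. -/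
theorem dense_affineIndependent {m : ℕ} {s : Finset V} (hs : s.card ≤ m + 1) :
    Dense {f : V → EuclideanSpace ℝ (Fin m) | AffineIndependent ℝ (fun v : s => f v)} := by
  classical
  obtain ⟨b⟩ := AffineBasis.exists_affineBasis_of_finiteDimensional (k := ℝ) (ι := Fin (m + 1))
    (P := EuclideanSpace ℝ (Fin m)) (by simp)
  obtain ⟨j⟩ : Nonempty (s ↪ Fin (m + 1)) := Function.Embedding.nonempty_of_card_le (by simpa)
  let g : V → EuclideanSpace ℝ (Fin m) := fun v => if hv : v ∈ s then b (j ⟨v, hv⟩) else 0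
  have hg : AffineIndependent ℝ (fun v : s => g v) := by
    have := b.ind.comp_embedding j
    convert! this using 2 with v
    simp [g]
  intro f
  -- the linear maps whose kernels are the dependences
  let A : (V → EuclideanSpace ℝ (Fin m)) → (s → ℝ) →ₗ[ℝ] ℝ × EuclideanSpace ℝ (Fin m) := fun f =>
    (Fintype.linearCombination ℝ (fun _ => (1 : ℝ))).prod
      (Fintype.linearCombination ℝ (fun v : s => f v))
  have hA : ∀ f, AffineIndependent ℝ (fun v : s => f v) ↔ LinearMap.ker (A f) = ⊥ := by
    intro f
    rw [affineIndependent_iff_of_fintype, LinearMap.ker_eq_bot']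
    refine forall_congr' fun w => ⟨fun h hw => ?_, fun h h1 h2 => ?_⟩
    · have hw' : ∑ v, w v = 0 ∧ ∑ v : s, w v • f v = 0 := by
        simpa [A, Fintype.linearCombination_apply, Prod.ext_iff] using hw
      have := h hw'.1 (by rw [Finset.univ.weightedVSub_eq_linear_combination hw'.1]; exact hw'.2)
      exact funext this
    · rw [Finset.univ.weightedVSub_eq_linear_combination h1] at h2
      have := h (by simpa [A, Fintype.linearCombination_apply, Prod.ext_iff] using ⟨h1, h2⟩)
      exact fun i => congrFun this i
  obtain ⟨P, hP⟩ := (A g).exists_leftInverse_of_injective ((hA g).1 hg)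
  let N : Module.End ℝ (s → ℝ) := P ∘ₗ A f
  let F : ℝ → V → EuclideanSpace ℝ (Fin m) := fun t => (1 - t) • f + t • g
  have hF : ∀ t, A (F t) = (1 - t) • A f + t • A g := by
    intro t
    refine LinearMap.ext fun w => Prod.ext ?_ ?_
    · simp [A, Fintype.linearCombination_apply, ← add_mul]
    · simp [A, F, Fintype.linearCombination_apply, Finset.sum_add_distrib, Finset.smul_sum,
        smul_comm (w _)]
  -- A nonzero vector killed by A (F t) is an eigenvector of N with eigenvalue -t/(1 - t). N has
  -- finitely many eigenvalues, and μ ↦ μ/(μ - 1) recovers t.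
  have hbad : {t : ℝ | t ≠ 1 ∧ N.HasEigenvalue (-(t / (1 - t)))}.Finite := by
    refine (N.finite_hasEigenvalue.image fun μ => μ / (μ - 1)).subset ?_
    rintro t ⟨ht1, ht⟩
    refine ⟨_, ht, ?_⟩
    have h1t : 1 - t ≠ 0 := sub_ne_zero.2 (Ne.symm ht1)
    have : -(t / (1 - t)) - 1 = -(1 / (1 - t)) := by field_simp; ring
    beta_reduce
    rw [this]
    field_simp
  have hgood : ∀ t ∉ {1} ∪ {t : ℝ | t ≠ 1 ∧ N.HasEigenvalue (-(t / (1 - t)))},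
      AffineIndependent ℝ (fun v : s => F t v) := by
    intro t ht
    simp only [Set.mem_union, Set.mem_singleton_iff, Set.mem_ofPred_eq, not_or, not_and] at ht
    obtain ⟨ht1, ht2⟩ := ht
    have h1t : 1 - t ≠ 0 := sub_ne_zero.2 (Ne.symm ht1)
    rw [hA, LinearMap.ker_eq_bot']
    intro w hw
    by_contra hw0
    refine ht2 ht1 (Module.End.hasEigenvalue_of_hasEigenvector (x := w)
      ⟨Module.End.mem_eigenspace_iff.2 ?_, hw0⟩)
    have h2 : P (A (F t) w) = 0 := by rw [hw, map_zero]
    have h3 : P (A g w) = w := by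
      rw [← LinearMap.comp_apply, hP, LinearMap.id_apply]
    rw [hF] at h2
    simp only [LinearMap.add_apply, LinearMap.smul_apply, map_add, map_smul, h3] at h2
    change P (A f w) = _
    have h4 : (1 - t) • P (A f w) = -(t • w) := eq_neg_of_add_eq_zero_left h2
    rw [← smul_right_inj h1t, h4, smul_smul, ← neg_smul]
    congr 1
    field_simp
  have hdense : Dense ({1} ∪ {t : ℝ | t ≠ 1 ∧ N.HasEigenvalue (-(t / (1 - t)))})ᶜ :=
    Set.Countable.dense_compl ℝ ((Set.finite_singleton _).union hbad).countable
  have hcont : Continuous F := by fun_prop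
  have h0 : F 0 = f := by simp [F]
  rw [← h0]
  refine closure_mono ?_ (image_closure_subset_closure_image hcont ⟨0, hdense 0, rfl⟩)
  rintro _ ⟨t, ht, rfl⟩
  exact hgood t ht

theorem dense_generalPosition (m : ℕ) :
    Dense {f : V → EuclideanSpace ℝ (Fin m) | GeneralPosition m f} := by
  have : {f : V → EuclideanSpace ℝ (Fin m) | GeneralPosition m f} =
      ⋂ s ∈ {s : Finset V | s.card ≤ m + 1}, {f | AffineIndependent ℝ (fun v : s => f v)} := by
    ext f
    simp [GeneralPosition]
  rw [this]
  refine dense_biInter_of_isOpen (fun s _ => ?_) (Set.to_countable _)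
    fun s hs => dense_affineIndependent hs
  exact isOpen_setOfPred_affineIndependent.preimage
    (f := fun (f : V → EuclideanSpace ℝ (Fin m)) (v : s) => f v) (by fun_prop)

/-- Witnesses can be normalized to norm 1. The set of pairs (f, c) is then closed, and projection
along a compact set of c is a closed map. -/
theorem isClosed_signPattern (m : ℕ) (σ τ : Finset V) :
    IsClosed {f : V → EuclideanSpace ℝ (Fin m) | SignPattern (affineDependences f) σ τ} := by
  let K : Set (V → ℝ) := Metric.sphere 0 1 ∩ {c | (∀ v ∈ σ, 0 ≤ c v) ∧ (∀ v ∈ τ, c v ≤ 0) ∧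
    ∀ v, v ∉ σ → v ∉ τ → c v = 0}
  have hK : IsCompact K := by
    refine (isCompact_sphere 0 1).inter_right ?_
    simp only [Set.ofPred_and, Set.ofPred_forall]
    refine IsClosed.inter ?_ (IsClosed.inter ?_ ?_)
    · exact isClosed_biInter fun v _ => isClosed_le (by fun_prop) (by fun_prop)
    · exact isClosed_biInter fun v _ => isClosed_le (by fun_prop) (by fun_prop)
    · exact isClosed_iInter fun v => isClosed_iInter fun _ => isClosed_iInter fun _ =>
        isClosed_eq (by fun_prop) (by fun_prop)
  have _ : CompactSpace K := isCompact_iff_compactSpace.1 hK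
  have hZ : IsClosed {p : (V → EuclideanSpace ℝ (Fin m)) × K | (p.2 : V → ℝ) ∈ affineDependences p.1} := by
    simp only [mem_affineDependences, Set.ofPred_and]
    refine IsClosed.inter ?_ ?_
    · exact isClosed_eq (by fun_prop) (by fun_prop)
    · refine isClosed_eq (continuous_finsetSum _ fun v _ => ?_) (by fun_prop)
      exact ((continuous_apply v).comp (continuous_subtype_val.comp continuous_snd)).smul
        ((continuous_apply v).comp continuous_fst)
  convert isClosedMap_fst_of_compactSpace _ hZ using 1
  ext f
  constructor
  · rintro ⟨c, hc, hc0, h1, h2, h3⟩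
    have hn : 0 < ‖c‖ := norm_pos_iff.2 hc0
    refine ⟨(f, ⟨‖c‖⁻¹ • c, ?_, ?_⟩), (affineDependences f).smul_mem _ hc, rfl⟩
    · simp [norm_smul, hn.ne']
    · refine ⟨fun v hv => ?_, fun v hv => ?_, fun v h h' => ?_⟩
      · exact mul_nonneg (inv_nonneg.2 hn.le) (h1 v hv)
      · exact mul_nonpos_of_nonneg_of_nonpos (inv_nonneg.2 hn.le) (h2 v hv)
      · simp [h3 v h h']
  · rintro ⟨⟨f, c, hc, h⟩, hf, rfl⟩
    refine ⟨c, hf, fun h0 => ?_, h⟩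
    rw [h0] at hc
    simp at hc

/-- A map to `ℝ^m` for which the relevant sets of `m + 2` points are circuits can be perturbed to
general position without changing the sign patterns. -/
theorem exists_generalPosition_signPattern [DecidableEq V] {m : ℕ}
    (f₀ : V → EuclideanSpace ℝ (Fin m)) (P : Set (Sym2 (Finset V)))
    (hP : ∀ σ τ, s(σ, τ) ∈ P → σ.card + τ.card = m + 2 ∧ Disjoint σ τ ∧
      ∃ d, IsCircuit (affineDependences f₀) (σ ∪ τ) d) :
    ∃ f : V → EuclideanSpace ℝ (Fin m), GeneralPosition m f ∧
      ∀ p ∈ P, p ∈ signPatterns (affineDependences f) ↔ p ∈ signPatterns (affineDependences f₀) := by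
  -- Failing to be a pattern is an open condition, and there are finitely many pairs; so near f₀ no
  -- new patterns appear.
  have hev : ∀ᶠ f in 𝓝 f₀, ∀ σ τ : Finset V, ¬ SignPattern (affineDependences f₀) σ τ →
      ¬ SignPattern (affineDependences f) σ τ := by
    rw [Filter.eventually_all]
    intro σ
    rw [Filter.eventually_all]
    intro τ
    by_cases h : SignPattern (affineDependences f₀) σ τ
    · exact Filter.Eventually.of_forall fun _ h' => absurd h h'
    · filter_upwards [(isClosed_signPattern m σ τ).isOpen_compl.mem_nhds h] with f hf _
      exact hf
  obtain ⟨f, hgp, hf⟩ := ((dense_generalPosition m).inter_nhds_nonempty hev)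
  refine ⟨f, hgp, ?_⟩
  intro p
  induction p using Sym2.inductionOn with
  | hf σ τ =>
  intro hp
  rw [mem_signPatterns, mem_signPatterns]
  obtain ⟨hcard, hdisj, d₀, hd₀⟩ := hP σ τ hp
  refine ⟨fun h => by_contra fun h' => hf σ τ h' h, fun h => ?_⟩
  obtain ⟨d, hd⟩ := GeneralPosition.exists_isCircuit hgp
    (s := σ ∪ τ) (by rw [Finset.card_union_of_disjoint hdisj, hcard])
  have hne : ∀ {f : V → EuclideanSpace ℝ (Fin m)} {d : V → ℝ},
      IsCircuit (affineDependences f) (σ ∪ τ) d → d ≠ 0 := by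
    rintro f d hd rfl
    have : (σ ∪ τ).Nonempty := Finset.card_pos.1 (by
      rw [Finset.card_union_of_disjoint hdisj, hcard]; omega)
    obtain ⟨v, hv⟩ := this
    exact (hd.ne_zero_iff v).2 hv rfl
  -- No pattern is lost either. The signs of the circuit d of f on σ ∪ τ give some pattern of f,
  -- which by `hf` is also one of f₀. As f₀ has a single circuit there, that pattern is the pair {σ,
  -- τ}.
  let σ' := (σ ∪ τ).filter fun v => 0 < d v
  let τ' := (σ ∪ τ).filter fun v => d v < 0
  have hu : σ' ∪ τ' = σ ∪ τ := by
    ext v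
    have := (hd.ne_zero_iff v)
    simp only [σ', τ', Finset.mem_union, Finset.mem_filter]
    simp only [Finset.mem_union] at this
    constructor
    · rintro (h | h) <;> exact h.1
    · intro h
      rcases lt_or_gt_of_ne (this.2 h) with h' | h'
      · exact Or.inr ⟨h, h'⟩
      · exact Or.inl ⟨h, h'⟩
  have h1 : SignPattern (affineDependences f) σ' τ' :=
    (IsCircuit.signPattern_iff (hu ▸ hd) (hne hd)).2
      (Or.inl ⟨fun v hv => (Finset.mem_filter.1 hv).2, fun v hv => (Finset.mem_filter.1 hv).2⟩)
  have h2 : SignPattern (affineDependences f₀) σ' τ' := by_contra fun h' => hf σ' τ' h' h1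
  rw [hd.signPattern_iff (hne hd)]
  rw [hd₀.signPattern_iff (hne hd₀)] at h
  rw [IsCircuit.signPattern_iff (d := d₀) (hu ▸ hd₀) (hne hd₀)] at h2
  have hmem : ∀ v ∈ σ ∪ τ, (0 < d v ∧ v ∈ σ') ∨ (d v < 0 ∧ v ∈ τ') := fun v hv => by
    rcases lt_or_gt_of_ne ((hd.ne_zero_iff v).2 hv) with h' | h'
    · exact Or.inr ⟨h', Finset.mem_filter.2 ⟨hv, h'⟩⟩
    · exact Or.inl ⟨h', Finset.mem_filter.2 ⟨hv, h'⟩⟩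
  have hl := fun v hv => hmem v (Finset.mem_union_left τ hv)
  have hr := fun v hv => hmem v (Finset.mem_union_right σ hv)
  rcases h2 with ⟨h2, h2'⟩ | ⟨h2, h2'⟩ <;> rcases h with ⟨h, h'⟩ | ⟨h, h'⟩
  · exact Or.inl ⟨fun v hv => (hl v hv).elim (·.1) fun k => absurd (h2' v k.2) (h v hv).asymm,
      fun v hv => (hr v hv).elim (fun k => absurd (h2 v k.2) (h' v hv).asymm) (·.1)⟩
  · exact Or.inr ⟨fun v hv => (hl v hv).elim (fun k => absurd (h2 v k.2) (h v hv).asymm) (·.1),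
      fun v hv => (hr v hv).elim (·.1) fun k => absurd (h2' v k.2) (h' v hv).asymm⟩
  · exact Or.inr ⟨fun v hv => (hl v hv).elim (fun k => absurd (h2 v k.2) (h v hv).asymm) (·.1),
      fun v hv => (hr v hv).elim (·.1) fun k => absurd (h2' v k.2) (h' v hv).asymm⟩
  · exact Or.inl ⟨fun v hv => (hl v hv).elim (·.1) fun k => absurd (h2' v k.2) (h v hv).asymm,
      fun v hv => (hr v hv).elim (fun k => absurd (h2 v k.2) (h' v hv).asymm) (·.1)⟩

end GeneralPosition

end ObstructorDim

namespace ObstructorDim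

/-! ### Obstructor conditions as one cycle condition with empty simplices allowed. -/

section CellSystem

variable {V : Type} [DecidableEq V]

/-- A mod 2 cycle of pairs of disjoint, possibly empty, simplices with `k` vertices in total. -/
structure IsCellCycle (K : AbstractSimplicialComplex V) (k : ℕ) (P : Finset (Sym2 (Finset V))) :
    Prop where
  cells : ∀ σ τ, s(σ, τ) ∈ P →
    (σ ∈ K.faces ∨ σ = ∅) ∧ (τ ∈ K.faces ∨ τ = ∅) ∧ Disjoint σ τ ∧ σ.card + τ.card = k
  even : ∀ α β, Disjoint α β → α.card + β.card + 1 = k →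
    Even ({v | s(insert v α, β) ∈ P}.ncard + {v | s(α, insert v β) ∈ P}.ncard)

/-- A coface has one vertex more, added to α or to β. Since α is nonempty and disjoint from β, they
differ, so no unordered pair is produced in both ways; for α = β = ∅ each pair would be counted
twice on the right. -/
theorem cofaceCount_eq [Finite V] {P : Finset (Sym2 (Finset V))} {k : ℕ} {α β : Finset V}
    (hP : ∀ σ τ, s(σ, τ) ∈ P → σ.card + τ.card = k)
    (hαβ : Disjoint α β) (hne : α.Nonempty) (hcard : α.card + β.card + 1 = k) :
    cofaceCount P α β = {v | s(insert v α, β) ∈ P}.ncard + {v | s(α, insert v β) ∈ P}.ncard := by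
  have hα : ∀ {v}, s(insert v α, β) ∈ P → v ∉ α := fun {v} h hv => by
    have := hP _ _ h
    rw [Finset.insert_eq_of_mem hv] at this
    omega
  have hβ : ∀ {v}, s(α, insert v β) ∈ P → v ∉ β := fun {v} h hv => by
    have := hP _ _ h
    rw [Finset.insert_eq_of_mem hv] at this
    omega
  have hαβ' : α ≠ β := fun h => by
    obtain ⟨v, hv⟩ := hne
    exact Finset.disjoint_left.1 hαβ hv (h ▸ hv)
  have hins : ∀ {v w : V} {γ : Finset V}, v ∉ γ → insert v γ = insert w γ → v = w := by
    intro v w γ hv h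
    have : v ∈ insert w γ := h ▸ Finset.mem_insert_self v γ
    rcases Finset.mem_insert.1 this with h | h
    · exact h
    · exact absurd h hv
  have hset : {p ∈ (P : Set (Sym2 (Finset V))) | ∃ σ τ, p = s(σ, τ) ∧ α ⊆ σ ∧ β ⊆ τ} =
      (fun v => s(insert v α, β)) '' {v | s(insert v α, β) ∈ P} ∪
      (fun v => s(α, insert v β)) '' {v | s(α, insert v β) ∈ P} := by
    ext p
    constructor
    · rintro ⟨hp, σ, τ, rfl, h1, h2⟩
      have hk := hP _ _ hp
      have c1 := Finset.card_le_card h1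
      have c2 := Finset.card_le_card h2
      by_cases h : α = σ
      · subst h
        right
        obtain ⟨v, hv, rfl⟩ := (Finset.covBy_iff_exists_insert (s := β) (t := τ)).1
          (Finset.covBy_iff_card_sdiff_eq_one.2 ⟨h2, by
            rw [Finset.card_sdiff_of_subset h2]; omega⟩)
        exact ⟨v, hp, rfl⟩
      · left
        have c3 : α.card < σ.card := Finset.card_lt_card (Finset.ssubset_iff_subset_ne.2 ⟨h1, h⟩)
        obtain rfl : β = τ := Finset.eq_of_subset_of_card_le h2 (by omega)
        obtain ⟨v, hv, rfl⟩ := (Finset.covBy_iff_exists_insert (s := α) (t := σ)).1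
          (Finset.covBy_iff_card_sdiff_eq_one.2 ⟨h1, by
            rw [Finset.card_sdiff_of_subset h1]; omega⟩)
        exact ⟨v, hp, rfl⟩
    · rintro (⟨v, hv, rfl⟩ | ⟨v, hv, rfl⟩)
      · exact ⟨hv, _, _, rfl, Finset.subset_insert _ _, subset_rfl⟩
      · exact ⟨hv, _, _, rfl, subset_rfl, Finset.subset_insert _ _⟩
  rw [cofaceCount, hset, Set.ncard_union_eq, Set.InjOn.ncard_image, Set.InjOn.ncard_image]
  · intro v hv w hw h
    rcases Sym2.eq_iff.1 h with h | h
    · exact hins (hβ hv) h.2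
    · exact hins (hβ hv) (h.2.trans h.1)
  · intro v hv w hw h
    rcases Sym2.eq_iff.1 h with h | h
    · exact hins (hα hv) h.1
    · exact hins (hα hv) (h.1.trans h.2)
  · rw [Set.disjoint_left]
    rintro _ ⟨v, hv, rfl⟩ ⟨w, hw, h⟩
    rcases Sym2.eq_iff.1 h with h | h
    · exact hα hv (h.1 ▸ Finset.mem_insert_self v α)
    · exact hαβ' h.1

/-- Condition (3) is the cycle condition at faces with an empty factor, and condition (1) is the
rest. Intersection numbers become a count of sign patterns. -/
theorem IsObstructor.exists_isCellCycle [Fintype V] {K : AbstractSimplicialComplex V} {m : ℕ}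
    (h : IsObstructor K m) :
    (∀ σ ∈ K.faces, σ.card ≤ m + 1) ∧ ∃ P, IsCellCycle K (m + 2) P ∧
      ∃ f : V → EuclideanSpace ℝ (Fin m),
        (∀ σ τ, s(σ, τ) ∈ P → ∃ d, IsCircuit (affineDependences f) (σ ∪ τ) d) ∧
        Odd ((P : Set (Sym2 (Finset V))) ∩ signPatterns (affineDependences f)).ncard := by
  classical
  obtain ⟨hdim, P, hcell, hcycle, ⟨f, hf, hodd⟩, htop⟩ := h
  refine ⟨hdim, P, ⟨fun σ τ h => ?_, fun α β hαβ hcard => ?_⟩, f, fun σ τ h => ?_, ?_⟩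
  · obtain ⟨h1, h2, h3, h4⟩ := hcell σ τ h
    exact ⟨Or.inl h1, Or.inl h2, h3, h4⟩
  · have hne : ∀ {σ τ}, s(σ, τ) ∈ P → σ ≠ ∅ ∧ τ ≠ ∅ := fun {σ τ} h =>
      ⟨(K.isRelLowerSet_faces (hcell _ _ h).1).1.ne_empty,
        (K.isRelLowerSet_faces (hcell _ _ h).2.1).1.ne_empty⟩
    have hface : ∀ {α σ : Finset V}, σ ∈ K.faces → α ⊆ σ → α ≠ ∅ → α ∈ K.faces :=
      fun h1 h2 h3 => (K.isRelLowerSet_faces h1).2 h2 (Finset.nonempty_iff_ne_empty.2 h3)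
    -- cells with an empty factor
    have hempty : ∀ β : Finset V, β.card = m + 1 →
        Even ({v | s({v}, β) ∈ P}.ncard + {v | s(∅, insert v β) ∈ P}.ncard) := by
      intro β hβ
      have h2 : {v | s(∅, insert v β) ∈ P} = ∅ :=
        Set.eq_empty_of_forall_notMem fun v hv => (hne hv).1 rfl
      rw [h2, Set.ncard_empty, add_zero]
      by_cases hβK : β ∈ K.faces
      · have := htop β hβK hβ
        simpa only [Sym2.eq_swap] using this
      · have h1 : {v | s({v}, β) ∈ P} = ∅ :=
          Set.eq_empty_of_forall_notMem fun v hv => hβK (hcell _ _ hv).2.1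
        rw [h1, Set.ncard_empty]
        exact Even.zero
    rcases α.eq_empty_or_nonempty with rfl | hα
    · exact hempty β (by simpa using hcard)
    rcases β.eq_empty_or_nonempty with rfl | hβ
    · have := hempty α (by simpa using hcard)
      rw [add_comm]
      simpa only [Sym2.eq_swap, insert_empty_eq] using this
    rw [← cofaceCount_eq (fun σ τ h => (hcell σ τ h).2.2.2) hαβ hα hcard]
    by_cases hK : α ∈ K.faces ∧ β ∈ K.faces
    · exact hcycle α hK.1 β hK.2 hαβ (by omega)
    · have : {p ∈ (P : Set (Sym2 (Finset V))) | ∃ σ τ, p = s(σ, τ) ∧ α ⊆ σ ∧ β ⊆ τ} = ∅ := by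
        refine Set.eq_empty_of_forall_notMem ?_
        rintro p ⟨hp, σ, τ, rfl, h1, h2⟩
        obtain ⟨g1, g2, -, -⟩ := hcell _ _ hp
        exact hK ⟨hface g1 h1 hα.ne_empty, hface g2 h2 hβ.ne_empty⟩
      rw [cofaceCount, this, Set.ncard_empty]
      exact Even.zero
  · obtain ⟨h1, h2, h3, h4⟩ := hcell σ τ h
    exact hf.exists_isCircuit (by rw [Finset.card_union_of_disjoint h3, h4])
  · have : ∑ p ∈ P, intersectionNumber f p =
        ∑ p ∈ P, if p ∈ signPatterns (affineDependences f) then 1 else 0 := by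
      refine Finset.sum_congr rfl fun p hp => ?_
      induction p using Sym2.inductionOn with
      | hf σ τ =>
      obtain ⟨h1, h2, h3, h4⟩ := hcell σ τ hp
      obtain ⟨d, hd⟩ := hf.exists_isCircuit (s := σ ∪ τ)
        (by rw [Finset.card_union_of_disjoint h3, h4])
      exact intersectionNumber_eq hd h3
    rw [this, ← Finset.sum_filter, Finset.sum_const, smul_eq_mul, mul_one] at hodd
    rw [← Set.ncard_coe_finset] at hodd
    convert! hodd using 2
    ext p
    simp

/-- Here f₀ need not be in general position: it suffices that the cells of P are circuits, since a
perturbation then keeps their patterns. The dimension bound excludes cells with an empty factor,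
whose other factor would have m + 2 vertices. -/
theorem IsCellCycle.isObstructor [Fintype V] {K : AbstractSimplicialComplex V} {m : ℕ}
    {P : Finset (Sym2 (Finset V))} (h : IsCellCycle K (m + 2) P)
    (hdim : ∀ σ ∈ K.faces, σ.card ≤ m + 1) (f₀ : V → EuclideanSpace ℝ (Fin m))
    (hcirc : ∀ σ τ, s(σ, τ) ∈ P → ∃ d, IsCircuit (affineDependences f₀) (σ ∪ τ) d)
    (hodd : Odd ((P : Set (Sym2 (Finset V))) ∩ signPatterns (affineDependences f₀)).ncard) :
    IsObstructor K m := by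
  classical
  have hcell : ∀ σ τ, s(σ, τ) ∈ P →
      σ ∈ K.faces ∧ τ ∈ K.faces ∧ Disjoint σ τ ∧ σ.card + τ.card = m + 2 := by
    intro σ τ hp
    obtain ⟨h1, h2, h3, h4⟩ := h.cells σ τ hp
    have hle : ∀ {σ : Finset V}, σ ∈ K.faces ∨ σ = ∅ → σ.card ≤ m + 1 := by
      rintro σ (h | rfl)
      · exact hdim σ h
      · simp
    have c1 := hle h1
    have c2 := hle h2
    refine ⟨h1.resolve_right ?_, h2.resolve_right ?_, h3, h4⟩
    · rintro rfl
      rw [Finset.card_empty] at h4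
      omega
    · rintro rfl
      rw [Finset.card_empty] at h4
      omega
  refine ⟨hdim, P, hcell, fun α hα β hβ hαβ hcard => ?_, ?_, fun σ hσ hcard => ?_⟩
  · rw [cofaceCount_eq (fun σ τ h => (hcell σ τ h).2.2.2) hαβ (K.isRelLowerSet_faces hα).1
      (by omega)]
    exact h.even α β hαβ (by omega)
  · obtain ⟨f, hf, hfP⟩ := exists_generalPosition_signPattern f₀ P fun σ τ hp => by
      obtain ⟨h1, h2, h3, h4⟩ := hcell σ τ hp
      exact ⟨h4, h3, hcirc σ τ hp⟩
    refine ⟨f, hf, ?_⟩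
    have : ∑ p ∈ P, intersectionNumber f p =
        ∑ p ∈ P, if p ∈ signPatterns (affineDependences f) then 1 else 0 := by
      refine Finset.sum_congr rfl fun p hp => ?_
      induction p using Sym2.inductionOn with
      | hf σ τ =>
      obtain ⟨h1, h2, h3, h4⟩ := hcell σ τ hp
      obtain ⟨d, hd⟩ := hf.exists_isCircuit (s := σ ∪ τ)
        (by rw [Finset.card_union_of_disjoint h3, h4])
      exact intersectionNumber_eq hd h3
    rw [this, ← Finset.sum_filter, Finset.sum_const, smul_eq_mul, mul_one, ← Set.ncard_coe_finset]
    convert! hodd using 2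
    ext p
    simp only [Finset.coe_filter, Set.mem_ofPred_eq, Set.mem_inter_iff, Finset.mem_coe]
    exact and_congr_right (hfP p)
  · have := h.even σ ∅ (Finset.disjoint_empty_right σ) (by simp [hcard])
    have h2 : {v | s(insert v σ, ∅) ∈ P} = ∅ :=
      Set.eq_empty_of_forall_notMem fun v hv =>
        (K.isRelLowerSet_faces (hcell _ _ hv).2.1).1.ne_empty rfl
    rwa [h2, Set.ncard_empty, zero_add] at this

end CellSystem

end ObstructorDim

namespace ObstructorDim

set_option linter.unusedSectionVars false

/-! ### Joins of obstructor complexes. -/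

section Join

variable {V₁ V₂ : Type}

/-- The join of two simplicial complexes. -/
def joinComplex (K₁ : AbstractSimplicialComplex V₁) (K₂ : AbstractSimplicialComplex V₂) :
    AbstractSimplicialComplex (V₁ ⊕ V₂) where
  faces := {s | s.Nonempty ∧ (s.toLeft ∈ K₁.faces ∨ s.toLeft = ∅) ∧
    (s.toRight ∈ K₂.faces ∨ s.toRight = ∅)}
  isRelLowerSet_faces := by
    rintro s ⟨hs, h₁, h₂⟩
    refine ⟨hs, fun t hts ht => ⟨ht, ?_, ?_⟩⟩
    · rcases t.toLeft.eq_empty_or_nonempty with h | h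
      · exact Or.inr h
      · refine Or.inl ((K₁.isRelLowerSet_faces (h₁.resolve_right ?_)).2
          (Finset.toLeft_monotone hts) h)
        exact (h.mono (Finset.toLeft_monotone hts)).ne_empty
    · rcases t.toRight.eq_empty_or_nonempty with h | h
      · exact Or.inr h
      · refine Or.inl ((K₂.isRelLowerSet_faces (h₂.resolve_right ?_)).2
          (Finset.toRight_monotone hts) h)
        exact (h.mono (Finset.toRight_monotone hts)).ne_empty
  singleton_mem v := by
    refine ⟨Finset.singleton_nonempty v, ?_⟩
    rcases v with v | v
    · have h1 : ({Sum.inl v} : Finset (V₁ ⊕ V₂)).toLeft = {v} := by ext; simp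
      have h2 : ({Sum.inl v} : Finset (V₁ ⊕ V₂)).toRight = ∅ := by ext; simp
      rw [h1, h2]
      exact ⟨Or.inl (K₁.singleton_mem v), Or.inr rfl⟩
    · have h1 : ({Sum.inr v} : Finset (V₁ ⊕ V₂)).toLeft = ∅ := by ext; simp
      have h2 : ({Sum.inr v} : Finset (V₁ ⊕ V₂)).toRight = {v} := by ext; simp
      rw [h1, h2]
      exact ⟨Or.inr rfl, Or.inl (K₂.singleton_mem v)⟩

theorem joinComplex_card_le {K₁ : AbstractSimplicialComplex V₁} {K₂ : AbstractSimplicialComplex V₂}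
    {d₁ d₂ : ℕ} (h₁ : ∀ σ ∈ K₁.faces, σ.card ≤ d₁) (h₂ : ∀ σ ∈ K₂.faces, σ.card ≤ d₂) :
    ∀ σ ∈ (joinComplex K₁ K₂).faces, σ.card ≤ d₁ + d₂ := by
  rintro σ ⟨-, hl, hr⟩
  rw [← Finset.card_toLeft_add_card_toRight (u := σ)]
  refine Nat.add_le_add ?_ ?_
  · rcases hl with h | h
    · exact h₁ _ h
    · simp [h]
  · rcases hr with h | h
    · exact h₂ _ h
    · simp [h]

theorem disjoint_iff_toLeft_toRight {σ τ : Finset (V₁ ⊕ V₂)} :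
    Disjoint σ τ ↔ Disjoint σ.toLeft τ.toLeft ∧ Disjoint σ.toRight τ.toRight := by
  simp [Finset.disjoint_left]

variable [Fintype V₁] [Fintype V₂] [DecidableEq V₁] [DecidableEq V₂]

/-- The pairs of simplices of the join that restrict to given pairs. -/
noncomputable def joinCells (P₁ : Finset (Sym2 (Finset V₁))) (P₂ : Finset (Sym2 (Finset V₂))) :
    Finset (Sym2 (Finset (V₁ ⊕ V₂))) :=
  (Set.toFinite {p : Sym2 (Finset (V₁ ⊕ V₂)) |
    p.map Finset.toLeft ∈ P₁ ∧ p.map Finset.toRight ∈ P₂}).toFinset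

variable {P₁ : Finset (Sym2 (Finset V₁))} {P₂ : Finset (Sym2 (Finset V₂))}

theorem mem_joinCells {σ τ : Finset (V₁ ⊕ V₂)} : s(σ, τ) ∈ joinCells P₁ P₂ ↔
    s(σ.toLeft, τ.toLeft) ∈ P₁ ∧ s(σ.toRight, τ.toRight) ∈ P₂ := by
  simp [joinCells]

theorem ncard_sum_eq (p : V₁ ⊕ V₂ → Prop) :
    {v | p v}.ncard = {v | p (Sum.inl v)}.ncard + {v | p (Sum.inr v)}.ncard := by
  have : {v | p v} = Sum.inl '' {v | p (Sum.inl v)} ∪ Sum.inr '' {v | p (Sum.inr v)} := by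
    ext v
    rcases v with v | v <;> simp
  rw [this, Set.ncard_union_eq, Sum.inl_injective.injOn.ncard_image,
    Sum.inr_injective.injOn.ncard_image]
  rw [Set.disjoint_left]
  rintro _ ⟨v, -, rfl⟩ ⟨w, -, h⟩
  cases h

/-- Leibniz rule: adding a vertex of V₁ leaves the right-hand pair alone, so those terms vanish
unless that pair is in P₂, and then they form the boundary count of P₁, which is even. The vertices
of V₂ are treated symmetrically. -/
theorem IsCellCycle.join {K₁ : AbstractSimplicialComplex V₁} {K₂ : AbstractSimplicialComplex V₂}
    {k₁ k₂ : ℕ} (h₁ : IsCellCycle K₁ k₁ P₁) (h₂ : IsCellCycle K₂ k₂ P₂) :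
    IsCellCycle (joinComplex K₁ K₂) (k₁ + k₂) (joinCells P₁ P₂) where
  cells σ τ h := by
    obtain ⟨hl, hr⟩ := mem_joinCells.1 h
    obtain ⟨a1, a2, a3, a4⟩ := h₁.cells _ _ hl
    obtain ⟨b1, b2, b3, b4⟩ := h₂.cells _ _ hr
    refine ⟨?_, ?_, disjoint_iff_toLeft_toRight.2 ⟨a3, b3⟩, ?_⟩
    · rcases σ.eq_empty_or_nonempty with h | h
      · exact Or.inr h
      · exact Or.inl ⟨h, a1, b1⟩
    · rcases τ.eq_empty_or_nonempty with h | h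
      · exact Or.inr h
      · exact Or.inl ⟨h, a2, b2⟩
    · rw [← Finset.card_toLeft_add_card_toRight (u := σ),
        ← Finset.card_toLeft_add_card_toRight (u := τ)]
      omega
  even α β hαβ hcard := by
    obtain ⟨hl, hr⟩ := disjoint_iff_toLeft_toRight.1 hαβ
    rw [← Finset.card_toLeft_add_card_toRight (u := α),
      ← Finset.card_toLeft_add_card_toRight (u := β)] at hcard
    rw [ncard_sum_eq, ncard_sum_eq]
    simp only [mem_joinCells, Finset.toLeft_insert_inl, Finset.toLeft_insert_inr,
      Finset.toRight_insert_inl, Finset.toRight_insert_inr]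
    have e1 : Even ({v | s(insert v α.toLeft, β.toLeft) ∈ P₁ ∧ s(α.toRight, β.toRight) ∈ P₂}.ncard +
        {v | s(α.toLeft, insert v β.toLeft) ∈ P₁ ∧ s(α.toRight, β.toRight) ∈ P₂}.ncard) := by
      by_cases h : s(α.toRight, β.toRight) ∈ P₂
      · simp only [h, and_true]
        exact h₁.even _ _ hl (by have := (h₂.cells _ _ h).2.2.2; omega)
      · simp [h]
    have e2 : Even ({v | s(α.toLeft, β.toLeft) ∈ P₁ ∧ s(insert v α.toRight, β.toRight) ∈ P₂}.ncard +
        {v | s(α.toLeft, β.toLeft) ∈ P₁ ∧ s(α.toRight, insert v β.toRight) ∈ P₂}.ncard) := by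
      by_cases h : s(α.toLeft, β.toLeft) ∈ P₁
      · simp only [h, true_and]
        exact h₂.even _ _ hr (by have := (h₁.cells _ _ h).2.2.2; omega)
      · simp [h]
    convert! e1.add e2 using 1
    omega

/-- Pairs of dependences on which the sum of two functionals vanishes. -/
def joinDependences (D₁ : Submodule ℝ (V₁ → ℝ)) (D₂ : Submodule ℝ (V₂ → ℝ)) (h₁ : V₁ → ℝ)
    (h₂ : V₂ → ℝ) : Submodule ℝ (V₁ ⊕ V₂ → ℝ) where
  carrier := {c | c ∘ Sum.inl ∈ D₁ ∧ c ∘ Sum.inr ∈ D₂ ∧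
    ∑ v, c (Sum.inl v) * h₁ v + ∑ v, c (Sum.inr v) * h₂ v = 0}
  add_mem' := by
    rintro a b ⟨a1, a2, a3⟩ ⟨b1, b2, b3⟩
    refine ⟨D₁.add_mem a1 b1, D₂.add_mem a2 b2, ?_⟩
    simp only [Pi.add_apply, add_mul, Finset.sum_add_distrib]
    linarith
  zero_mem' := ⟨D₁.zero_mem, D₂.zero_mem, by simp⟩
  smul_mem' := by
    rintro r a ⟨a1, a2, a3⟩
    refine ⟨D₁.smul_mem r a1, D₂.smul_mem r a2, ?_⟩
    simp only [Pi.smul_apply, smul_eq_mul, mul_assoc, ← Finset.mul_sum, ← mul_add, a3, mul_zero]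

theorem mem_joinDependences {D₁ : Submodule ℝ (V₁ → ℝ)} {D₂ : Submodule ℝ (V₂ → ℝ)} {h₁ : V₁ → ℝ}
    {h₂ : V₂ → ℝ} {c : V₁ ⊕ V₂ → ℝ} : c ∈ joinDependences D₁ D₂ h₁ h₂ ↔
      c ∘ Sum.inl ∈ D₁ ∧ c ∘ Sum.inr ∈ D₂ ∧
        ∑ v, c (Sum.inl v) * h₁ v + ∑ v, c (Sum.inr v) * h₂ v = 0 := Iff.rfl

variable {D₁ : Submodule ℝ (V₁ → ℝ)} {D₂ : Submodule ℝ (V₂ → ℝ)} {h₁ : V₁ → ℝ} {h₂ : V₂ → ℝ}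

/-- The pairs supported in s₁ and s₂ are (r₁ d₁, r₂ d₂), subject to one linear relation on (r₁, r₂).
Both of its coefficients are nonzero, so the solutions form a line on which neither factor vanishes.
-/
theorem IsCircuit.join {s₁ : Finset V₁} {s₂ : Finset V₂} {d₁ : V₁ → ℝ} {d₂ : V₂ → ℝ}
    (hd₁ : IsCircuit D₁ s₁ d₁) (hd₂ : IsCircuit D₂ s₂ d₂) (hη₁ : ∑ v, d₁ v * h₁ v ≠ 0)
    (hη₂ : ∑ v, d₂ v * h₂ v ≠ 0) :
    IsCircuit (joinDependences D₁ D₂ h₁ h₂) (s₁.disjSum s₂)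
      (Sum.elim ((∑ v, d₂ v * h₂ v) • d₁) (-(∑ v, d₁ v * h₁ v) • d₂)) where
  mem := by
    refine ⟨D₁.smul_mem _ hd₁.mem, D₂.smul_mem _ hd₂.mem, ?_⟩
    simp only [Sum.elim_inl, Sum.elim_inr, Pi.smul_apply, smul_eq_mul, mul_assoc,
      ← Finset.mul_sum]
    ring
  ne_zero_iff v := by
    rcases v with v | v
    · simp [hη₂, ← hd₁.ne_zero_iff]
    · simp [hη₁, ← hd₂.ne_zero_iff]
  eq_smul c hc hcs := by
    obtain ⟨c1, c2, c3⟩ := hc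
    obtain ⟨r₁, hr₁⟩ := hd₁.eq_smul _ c1 fun v hv => hcs _ (by simpa using hv)
    obtain ⟨r₂, hr₂⟩ := hd₂.eq_smul _ c2 fun v hv => hcs _ (by simpa using hv)
    have e1 : ∀ v, c (Sum.inl v) = r₁ * d₁ v := fun v => congrFun hr₁ v
    have e2 : ∀ v, c (Sum.inr v) = r₂ * d₂ v := fun v => congrFun hr₂ v
    simp only [e1, e2, mul_assoc, ← Finset.mul_sum] at c3
    refine ⟨r₁ / ∑ v, d₂ v * h₂ v, funext fun v => ?_⟩
    rcases v with v | v
    · simp only [e1, Pi.smul_apply, Sum.elim_inl, smul_eq_mul]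
      field_simp
    · simp only [e2, Pi.smul_apply, Sum.elim_inr, smul_eq_mul]
      have : r₂ = -(r₁ * ∑ v, d₁ v * h₁ v) / ∑ v, d₂ v * h₂ v := by
        rw [eq_div_iff hη₂]; linarith
      rw [this]
      ring

theorem IsCircuit.eq_of_signPattern {V : Type*} [DecidableEq V] {D : Submodule ℝ (V → ℝ)}
    {σ τ s : Finset V} {d : V → ℝ} (hd : IsCircuit D s d) (hd0 : d ≠ 0) (hs : σ ∪ τ = s)
    (h : SignPattern D σ τ) : s(σ, τ) = s(s.filter (0 < d ·), s.filter (d · < 0)) := by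
  subst hs
  rw [hd.signPattern_iff hd0] at h
  have key : ∀ {σ τ : Finset V}, (∀ v ∈ σ, 0 < d v) → (∀ v ∈ τ, d v < 0) →
      σ = (σ ∪ τ).filter (0 < d ·) ∧ τ = (σ ∪ τ).filter (d · < 0) := by
    intro σ τ h1 h2
    constructor
    · ext v
      simp only [Finset.mem_filter, Finset.mem_union]
      exact ⟨fun h => ⟨Or.inl h, h1 v h⟩, fun h => h.1.resolve_right fun h' =>
        (h2 v h').asymm h.2⟩
    · ext v
      simp only [Finset.mem_filter, Finset.mem_union]
      exact ⟨fun h => ⟨Or.inr h, h2 v h⟩, fun h => h.1.resolve_left fun h' =>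
        (h1 v h').asymm h.2⟩
  rcases h with ⟨h1, h2⟩ | ⟨h1, h2⟩
  · obtain ⟨e1, e2⟩ := key h1 h2
    exact Sym2.eq_iff.2 (Or.inl ⟨e1, e2⟩)
  · obtain ⟨e1, e2⟩ := key h2 h1
    rw [Finset.union_comm] at e1 e2
    exact Sym2.eq_iff.2 (Or.inr ⟨e2, e1⟩)

theorem union_eq_of_sym2_eq {α : Type*} [DecidableEq α] {a b c d : Finset α}
    (h : s(a, b) = s(c, d)) : a ∪ b = c ∪ d := by
  rcases Sym2.eq_iff.1 h with ⟨rfl, rfl⟩ | ⟨rfl, rfl⟩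
  · rfl
  · exact Finset.union_comm _ _

/-- The number of sign patterns is multiplicative for joins. -/
theorem ncard_joinCells_inter_signPatterns
    (hc₁ : ∀ σ τ, s(σ, τ) ∈ P₁ → ∃ d, IsCircuit D₁ (σ ∪ τ) d ∧ ∑ v, d v * h₁ v ≠ 0)
    (hc₂ : ∀ σ τ, s(σ, τ) ∈ P₂ → ∃ d, IsCircuit D₂ (σ ∪ τ) d ∧ ∑ v, d v * h₂ v ≠ 0) :
    ((joinCells P₁ P₂ : Set (Sym2 (Finset (V₁ ⊕ V₂)))) ∩
      signPatterns (joinDependences D₁ D₂ h₁ h₂)).ncard =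
    ((P₁ : Set (Sym2 (Finset V₁))) ∩ signPatterns D₁).ncard *
      ((P₂ : Set (Sym2 (Finset V₂))) ∩ signPatterns D₂).ncard := by
  rw [← Set.ncard_prod]
  let F : Sym2 (Finset (V₁ ⊕ V₂)) → Sym2 (Finset V₁) × Sym2 (Finset V₂) :=
    fun p => (p.map Finset.toLeft, p.map Finset.toRight)
  -- Restriction to the two factors is a bijection: of the two ways of joining two patterns, exactly
  -- one is a pattern.
  have hF : Set.BijOn F ((joinCells P₁ P₂ : Set (Sym2 (Finset (V₁ ⊕ V₂)))) ∩
      signPatterns (joinDependences D₁ D₂ h₁ h₂)) (((P₁ : Set (Sym2 (Finset V₁))) ∩ signPatterns D₁) ×ˢ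
      ((P₂ : Set (Sym2 (Finset V₂))) ∩ signPatterns D₂)) := by
    refine ⟨?_, ?_, ?_⟩
    · intro p
      induction p using Sym2.inductionOn with
      | hf σ τ =>
      rintro ⟨hp, hpat⟩
      obtain ⟨hl, hr⟩ := mem_joinCells.1 hp
      obtain ⟨d₁, hd₁, hη₁⟩ := hc₁ _ _ hl
      obtain ⟨d₂, hd₂, hη₂⟩ := hc₂ _ _ hr
      obtain ⟨c, hc, hc0, a1, a2, a3⟩ := hpat
      obtain ⟨r, hr'⟩ := (hd₁.join hd₂ hη₁ hη₂).eq_smul c hc fun v hv => by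
        have hv' : v ∉ σ ∪ τ := by
          rwa [← Finset.toLeft_union, ← Finset.toRight_union, Finset.toLeft_disjSum_toRight] at hv
        simp only [Finset.mem_union, not_or] at hv'
        exact a3 v hv'.1 hv'.2
      have hr0 : r ≠ 0 := fun h => hc0 (by rw [hr', h, zero_smul])
      refine ⟨⟨hl, c ∘ Sum.inl, hc.1, fun h0 => hη₁ (Finset.sum_eq_zero fun v _ => ?_),
        fun v hv => a1 _ (Finset.mem_toLeft.1 hv), fun v hv => a2 _ (Finset.mem_toLeft.1 hv),
        fun v h h' => a3 _ (fun k => h (Finset.mem_toLeft.2 k)) fun k => h' (Finset.mem_toLeft.2 k)⟩,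
        ⟨hr, c ∘ Sum.inr, hc.2.1, fun h0 => hη₂ (Finset.sum_eq_zero fun v _ => ?_),
        fun v hv => a1 _ (Finset.mem_toRight.1 hv), fun v hv => a2 _ (Finset.mem_toRight.1 hv),
        fun v h h' => a3 _ (fun k => h (Finset.mem_toRight.2 k))
          fun k => h' (Finset.mem_toRight.2 k)⟩⟩
      · have := congrFun h0 v
        simp only [hr', Function.comp_apply, Pi.smul_apply, Sum.elim_inl, smul_eq_mul,
          Pi.zero_apply, mul_eq_zero, hr0, hη₂, false_or] at this
        rw [this, zero_mul]
      · have := congrFun h0 v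
        simp only [hr', Function.comp_apply, Pi.smul_apply, Sum.elim_inr, smul_eq_mul,
          Pi.zero_apply, mul_eq_zero, hr0, neg_eq_zero, hη₁, false_or] at this
        rw [this, zero_mul]
    · intro p
      induction p using Sym2.inductionOn with
      | hf σ τ =>
      rintro ⟨hp, hpat⟩ p'
      induction p' using Sym2.inductionOn with
      | hf σ' τ' =>
      rintro ⟨-, hpat'⟩ heq
      obtain ⟨hl, hr⟩ := mem_joinCells.1 hp
      obtain ⟨d₁, hd₁, hη₁⟩ := hc₁ _ _ hl
      obtain ⟨d₂, hd₂, hη₂⟩ := hc₂ _ _ hr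
      have hd := hd₁.join hd₂ hη₁ hη₂
      have hd0 : (Sum.elim ((∑ v, d₂ v * h₂ v) • d₁) (-(∑ v, d₁ v * h₁ v) • d₂)) ≠ 0 := by
        intro h0
        refine hη₁ (Finset.sum_eq_zero fun v _ => ?_)
        have := congrFun h0 (Sum.inl v)
        simp only [Sum.elim_inl, Pi.smul_apply, smul_eq_mul, Pi.zero_apply, mul_eq_zero] at this
        rw [this.resolve_left hη₂, zero_mul]
      -- Both pairs have the same vertex set, and the single circuit on it has only one pattern.
      have e1 := union_eq_of_sym2_eq (show s(σ.toLeft, τ.toLeft) = s(σ'.toLeft, τ'.toLeft) from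
        congrArg Prod.fst heq)
      have e2 := union_eq_of_sym2_eq (show s(σ.toRight, τ.toRight) = s(σ'.toRight, τ'.toRight) from
        congrArg Prod.snd heq)
      rw [hd.eq_of_signPattern hd0 (σ := σ) (τ := τ) ?_ hpat,
        hd.eq_of_signPattern hd0 (σ := σ') (τ := τ') ?_ hpat']
      · rw [Finset.eq_disjSum_iff, Finset.toLeft_union, Finset.toRight_union]
        exact ⟨e1.symm, e2.symm⟩
      · rw [Finset.eq_disjSum_iff, Finset.toLeft_union, Finset.toRight_union]
        exact ⟨rfl, rfl⟩
    · rintro ⟨p₁, p₂⟩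
      induction p₁ using Sym2.inductionOn with
      | hf σ₁ τ₁ =>
      induction p₂ using Sym2.inductionOn with
      | hf σ₂ τ₂ =>
      rintro ⟨⟨hp₁, c₁, hc₁D, hc₁0, a1, a2, a3⟩, ⟨hp₂, c₂, hc₂D, hc₂0, b1, b2, b3⟩⟩
      obtain ⟨d₁, hd₁, hη₁⟩ := hc₁ _ _ hp₁
      obtain ⟨d₂, hd₂, hη₂⟩ := hc₂ _ _ hp₂
      have ha : ∑ v, c₁ v * h₁ v ≠ 0 := by
        obtain ⟨r, rfl⟩ := hd₁.eq_smul c₁ hc₁D fun v hv => by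
          simp only [Finset.mem_union, not_or] at hv
          exact a3 v hv.1 hv.2
        simp only [Pi.smul_apply, smul_eq_mul, mul_assoc, ← Finset.mul_sum]
        exact mul_ne_zero (fun h => hc₁0 (by simp [h])) hη₁
      have hb : ∑ v, c₂ v * h₂ v ≠ 0 := by
        obtain ⟨r, rfl⟩ := hd₂.eq_smul c₂ hc₂D fun v hv => by
          simp only [Finset.mem_union, not_or] at hv
          exact b3 v hv.1 hv.2
        simp only [Pi.smul_apply, smul_eq_mul, mul_assoc, ← Finset.mul_sum]
        exact mul_ne_zero (fun h => hc₂0 (by simp [h])) hη₂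
      -- after reorienting `c₂`, the two functionals have opposite signs
      have key : ∀ (σ₂ τ₂ : Finset V₂) (c₂ : V₂ → ℝ), s(σ₂, τ₂) ∈ P₂ → c₂ ∈ D₂ →
          (∀ v ∈ σ₂, 0 ≤ c₂ v) → (∀ v ∈ τ₂, c₂ v ≤ 0) → (∀ v, v ∉ σ₂ → v ∉ τ₂ → c₂ v = 0) →
          (∑ v, c₁ v * h₁ v) * (∑ v, c₂ v * h₂ v) < 0 →
          ∃ p ∈ (joinCells P₁ P₂ : Set (Sym2 (Finset (V₁ ⊕ V₂)))) ∩
            signPatterns (joinDependences D₁ D₂ h₁ h₂), F p = (s(σ₁, τ₁), s(σ₂, τ₂)) := by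
        intro σ₂ τ₂ c₂ hp₂ hc₂D b1 b2 b3 hab
        refine ⟨s(σ₁.disjSum σ₂, τ₁.disjSum τ₂), ⟨mem_joinCells.2 (by simpa using ⟨hp₁, hp₂⟩), ?_⟩,
          by simp [F]⟩
        set a := ∑ v, c₁ v * h₁ v with ha'
        set b := ∑ v, c₂ v * h₂ v with hb'
        have hb : b ≠ 0 := fun h => by simp [h] at hab
        -- Since a and b have opposite signs, |b| a + |a| b = 0; the positive factors do not disturb
        -- the patterns.
        refine ⟨Sum.elim (|b| • c₁) (|a| • c₂), ⟨D₁.smul_mem _ hc₁D, D₂.smul_mem _ hc₂D, ?_⟩,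
          fun h0 => ?_, ?_, ?_, ?_⟩
        · simp only [Sum.elim_inl, Sum.elim_inr, Pi.smul_apply, smul_eq_mul, mul_assoc,
            ← Finset.mul_sum]
          rw [← ha', ← hb']
          rcases lt_or_gt_of_ne hb with h | h
          · rw [abs_of_neg h, abs_of_pos (pos_of_mul_neg_left hab h.le)]; ring
          · rw [abs_of_pos h, abs_of_neg (neg_of_mul_neg_left hab h.le)]; ring
        · refine hc₁0 (funext fun v => ?_)
          have := congrFun h0 (Sum.inl v)
          simp only [Sum.elim_inl, Pi.smul_apply, smul_eq_mul, Pi.zero_apply, mul_eq_zero,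
            abs_eq_zero] at this
          exact this.resolve_left hb
        · rintro (v | v) hv
          · exact mul_nonneg (abs_nonneg _) (a1 v (by simpa using hv))
          · exact mul_nonneg (abs_nonneg _) (b1 v (by simpa using hv))
        · rintro (v | v) hv
          · exact mul_nonpos_of_nonneg_of_nonpos (abs_nonneg _) (a2 v (by simpa using hv))
          · exact mul_nonpos_of_nonneg_of_nonpos (abs_nonneg _) (b2 v (by simpa using hv))
        · rintro (v | v) hv hv'
          · simp [a3 v (by simpa using hv) (by simpa using hv')]
          · simp [b3 v (by simpa using hv) (by simpa using hv')]
      rcases lt_or_gt_of_ne (mul_ne_zero ha hb) with hab | hab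
      · exact key σ₂ τ₂ c₂ hp₂ hc₂D b1 b2 b3 hab
      -- If the signs agree, negating c₂ exchanges σ₂ and τ₂ without changing the unordered pair.
      · obtain ⟨p, hp, hFp⟩ := key τ₂ σ₂ (-c₂) (Sym2.eq_swap ▸ hp₂) (D₂.neg_mem hc₂D)
          (fun v hv => by simpa using b2 v hv) (fun v hv => by simpa using b1 v hv)
          (fun v h h' => by simpa using b3 v h' h)
          (by simp only [Pi.neg_apply, neg_mul, Finset.sum_neg_distrib, mul_neg]; linarith)
        exact ⟨p, hp, hFp.trans (by rw [Sym2.eq_swap (a := τ₂)])⟩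
  rw [← hF.image_eq, hF.injOn.ncard_image]

/-- A functional that does not vanish on any of the given circuits. -/
theorem exists_functional_ne_zero {V : Type} [Fintype V] [DecidableEq V]
    {P : Finset (Sym2 (Finset V))} {D : Submodule ℝ (V → ℝ)}
    (hc : ∀ σ τ, s(σ, τ) ∈ P → ∃ d, IsCircuit D (σ ∪ τ) d)
    (hne : ∀ σ τ, s(σ, τ) ∈ P → (σ ∪ τ).Nonempty) :
    ∃ h : V → ℝ, ∀ σ τ, s(σ, τ) ∈ P → ∃ d, IsCircuit D (σ ∪ τ) d ∧ ∑ v, d v * h v ≠ 0 := by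
  choose d hd using fun i : {q : Finset V × Finset V // s(q.1, q.2) ∈ P} => hc _ _ i.2
  obtain ⟨φ, hφ⟩ := Module.exists_dual_forall_apply_ne_zero (K := ℝ) d fun i h0 => by
    obtain ⟨v, hv⟩ := hne _ _ i.2
    exact ((hd i).ne_zero_iff v).2 hv (by rw [h0]; rfl)
  refine ⟨fun v => φ (Pi.single v 1), fun σ τ h => ⟨_, hd ⟨(σ, τ), h⟩, ?_⟩⟩
  have := hφ ⟨(σ, τ), h⟩
  have hφd : φ (d ⟨(σ, τ), h⟩) = ∑ v, d ⟨(σ, τ), h⟩ v * φ (Pi.single v 1) := by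
    conv_lhs => rw [← Finset.univ_sum_single (d ⟨(σ, τ), h⟩), map_sum]
    refine Finset.sum_congr rfl fun v _ => ?_
    rw [← smul_eq_mul, ← map_smul, ← Pi.single_smul, smul_eq_mul, mul_one]
  rwa [hφd] at this

theorem affineDependences_comp {V E F : Type*} [Fintype V] [AddCommGroup E] [Module ℝ E]
    [AddCommGroup F] [Module ℝ F] (e : E ≃ₗ[ℝ] F) (f : V → E) :
    affineDependences (fun v => e (f v)) = affineDependences f := by
  ext c
  simp only [mem_affineDependences, ← map_smul, ← map_sum, map_eq_zero_iff e e.injective]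

theorem sum_smul_prod_eq_zero_iff {V E F : Type*} [Fintype V] [AddCommGroup E] [Module ℝ E]
    [AddCommGroup F] [Module ℝ F] {f : V → E} {g : V → F} {c : V → ℝ} :
    ∑ v, c v • (f v, g v) = 0 ↔ ∑ v, c v • f v = 0 ∧ ∑ v, c v • g v = 0 := by
  simp [Prod.ext_iff, Prod.fst_sum, Prod.snd_sum]

/-- The join of two obstructor complexes is an obstructor complex. -/
theorem IsObstructor.join {K₁ : AbstractSimplicialComplex V₁} {K₂ : AbstractSimplicialComplex V₂}
    {m₁ m₂ : ℕ} (hK₁ : IsObstructor K₁ m₁) (hK₂ : IsObstructor K₂ m₂) :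
    IsObstructor (joinComplex K₁ K₂) (m₁ + m₂ + 2) := by
  obtain ⟨hdim₁, P₁, hP₁, f₁, hf₁, hodd₁⟩ := hK₁.exists_isCellCycle
  obtain ⟨hdim₂, P₂, hP₂, f₂, hf₂, hodd₂⟩ := hK₂.exists_isCellCycle
  obtain ⟨h₁, hh₁⟩ := exists_functional_ne_zero hf₁ fun σ τ h => Finset.card_pos.1 (by
    rw [Finset.card_union_of_disjoint (hP₁.cells _ _ h).2.2.1, (hP₁.cells _ _ h).2.2.2]; omega)
  obtain ⟨h₂, hh₂⟩ := exists_functional_ne_zero hf₂ fun σ τ h => Finset.card_pos.1 (by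
    rw [Finset.card_union_of_disjoint (hP₂.cells _ _ h).2.2.1, (hP₂.cells _ _ h).2.2.2]; omega)
  let E := EuclideanSpace ℝ (Fin m₁) × EuclideanSpace ℝ (Fin m₂) × ℝ × ℝ
  let e : E ≃ₗ[ℝ] EuclideanSpace ℝ (Fin (m₁ + m₂ + 2)) :=
    LinearEquiv.ofFinrankEq _ _ (by simp [E]; omega)
  -- The third coordinate, 0 on V₁ and 1 on V₂, splits the condition that the coefficients sum to 0
  -- into one condition for each factor; the fourth imposes the relation between h₁ and h₂. The
  -- dimension is m₁ + m₂ + 2.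
  let f : V₁ ⊕ V₂ → E := fun v => (Sum.elim f₁ 0 v, Sum.elim 0 f₂ v, Sum.elim 0 1 v, Sum.elim h₁ h₂ v)
  have hD : affineDependences (fun v => e (f v)) =
      joinDependences (affineDependences f₁) (affineDependences f₂) h₁ h₂ := by
    rw [affineDependences_comp]
    ext c
    have h : c ∈ affineDependences f ↔ ∑ v, c v = 0 ∧ ∑ v, c v • Sum.elim f₁ 0 v = 0 ∧
        ∑ v, c v • Sum.elim (0 : V₁ → EuclideanSpace ℝ (Fin m₂)) f₂ v = 0 ∧ ∑ v, c v • Sum.elim (0 : V₁ → ℝ) 1 v = 0 ∧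
        ∑ v, c v • Sum.elim h₁ h₂ v = 0 := by
      rw [← sum_smul_prod_eq_zero_iff, ← sum_smul_prod_eq_zero_iff, ← sum_smul_prod_eq_zero_iff]
      rfl
    rw [h, mem_joinDependences]
    simp only [mem_affineDependences, Fintype.sum_sum_type, Sum.elim_inl, Sum.elim_inr,
      Pi.zero_apply, Pi.one_apply, smul_zero, Finset.sum_const_zero, add_zero, zero_add,
      smul_eq_mul, mul_one, mul_zero, Function.comp_apply]
    constructor
    · rintro ⟨a1, a2, a3, a4, a5⟩
      exact ⟨⟨by linarith, a2⟩, ⟨a4, a3⟩, a5⟩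
    · rintro ⟨⟨a1, a2⟩, ⟨a4, a3⟩, a5⟩
      exact ⟨by linarith, a2, a3, a4, a5⟩
  have hcyc : IsCellCycle (joinComplex K₁ K₂) (m₁ + m₂ + 2 + 2) (joinCells P₁ P₂) := by
    convert! hP₁.join hP₂ using 1
    omega
  refine hcyc.isObstructor (fun σ hσ => (joinComplex_card_le hdim₁ hdim₂ σ hσ).trans (by omega))
    (fun v => e (f v)) (fun σ τ h => ?_) ?_
  · rw [hD]
    obtain ⟨hl, hr⟩ := mem_joinCells.1 h
    obtain ⟨d₁, hd₁, hη₁⟩ := hh₁ _ _ hl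
    obtain ⟨d₂, hd₂, hη₂⟩ := hh₂ _ _ hr
    have := hd₁.join hd₂ hη₁ hη₂
    rw [← Finset.toLeft_union, ← Finset.toRight_union, Finset.toLeft_disjSum_toRight] at this
    exact ⟨_, this⟩
  · rw [hD, ncard_joinCells_inter_signPatterns hh₁ hh₂]
    exact hodd₁.mul hodd₂

/-- At α = β = ∅ the only cell {pt, ∅} is counted once in each slot, so the total is 2. In this form
a point, which is not an obstructor, can still serve as a join factor. -/
theorem isCellCycle_point :
    IsCellCycle (⊥ : AbstractSimplicialComplex Unit) 1 {s({()}, ∅)} where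
  cells σ τ h := by
    have hp : ({()} : Finset Unit) ∈ (⊥ : AbstractSimplicialComplex Unit).faces := ⟨(), rfl⟩
    rw [Finset.mem_singleton, Sym2.eq_iff] at h
    rcases h with ⟨rfl, rfl⟩ | ⟨rfl, rfl⟩
    · exact ⟨Or.inl hp, Or.inr rfl, Finset.disjoint_empty_right _, rfl⟩
    · exact ⟨Or.inr rfl, Or.inl hp, Finset.disjoint_empty_left _, rfl⟩
  even α β _ hcard := by
    obtain rfl : α = ∅ := Finset.card_eq_zero.1 (by omega)
    obtain rfl : β = ∅ := Finset.card_eq_zero.1 (by omega)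
    rw [Sym2.eq_swap (a := ({()} : Finset Unit))]
    simp [Sym2.eq_swap]

/-- The closed cone over an obstructor complex is an obstructor complex. -/
theorem IsObstructor.join_point {K₁ : AbstractSimplicialComplex V₁} {m : ℕ}
    (hK₁ : IsObstructor K₁ m) :
    IsObstructor (joinComplex K₁ (⊥ : AbstractSimplicialComplex Unit)) (m + 1) := by
  obtain ⟨hdim₁, P₁, hP₁, f₁, hf₁, hodd₁⟩ := hK₁.exists_isCellCycle
  obtain ⟨h₀, hh₀⟩ := exists_functional_ne_zero hf₁ fun σ τ h => Finset.card_pos.1 (by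
    rw [Finset.card_union_of_disjoint (hP₁.cells _ _ h).2.2.1, (hP₁.cells _ _ h).2.2.2]; omega)
  -- make the functional positive
  obtain ⟨B, hB⟩ : ∃ B : ℝ, ∀ v, 0 < h₀ v + B := by
    obtain ⟨B, hB⟩ := (Set.finite_range fun v => -h₀ v).bddAbove
    exact ⟨B + 1, fun v => by have := hB ⟨v, rfl⟩; linarith⟩
  let g : V₁ → ℝ := fun v => h₀ v + B
  have hg : ∀ v, 0 < 1 + g v := fun v => by have := hB v; simp only [g]; linarith
  have hh₁ : ∀ σ τ, s(σ, τ) ∈ P₁ →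
      ∃ d, IsCircuit (affineDependences f₁) (σ ∪ τ) d ∧ ∑ v, d v * g v ≠ 0 := by
    intro σ τ h
    obtain ⟨d, hd, hne⟩ := hh₀ σ τ h
    refine ⟨d, hd, ?_⟩
    -- Adding a constant to the functional does not affect its values on affine dependences, whose
    -- coefficients sum to 0.
    simpa only [g, mul_add, Finset.sum_add_distrib, ← Finset.sum_mul, hd.mem.1, zero_mul,
      add_zero] using hne
  have hh₂ : ∀ σ τ, s(σ, τ) ∈ ({s({()}, ∅)} : Finset (Sym2 (Finset Unit))) →
      ∃ d, IsCircuit (⊤ : Submodule ℝ (Unit → ℝ)) (σ ∪ τ) d ∧ ∑ v, d v * (fun _ => (1 : ℝ)) v ≠ 0 := by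
    intro σ τ h
    have := union_eq_of_sym2_eq (Finset.mem_singleton.1 h)
    rw [this]
    refine ⟨fun _ => 1, ⟨trivial, fun v => by simp, fun c _ _ => ⟨c (), funext fun v => by simp⟩⟩,
      by simp⟩
  let D := joinDependences (affineDependences f₁) (⊤ : Submodule ℝ (Unit → ℝ)) g fun _ => 1
  let E := EuclideanSpace ℝ (Fin m) × ℝ
  let e : E ≃ₗ[ℝ] EuclideanSpace ℝ (Fin (m + 1)) :=
    LinearEquiv.ofFinrankEq _ _ (by simp [E])
  -- A projective change of coordinates. D is not a space of affine dependences as it stands,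
  -- because ⊤ imposes no condition on the coefficient of the cone point. After rescaling by the
  -- positive weights u, which preserves signs, it is one: subtracting the last coordinate of a
  -- dependence from the sum of its coefficients leaves the sum of (1 + g)⁻¹ c over V₁.
  let u : V₁ ⊕ Unit → ℝ := Sum.elim (fun x => (1 + g x)⁻¹) fun _ => 1
  have hu : ∀ v, 0 < u v := by
    rintro (v | v)
    · exact inv_pos.2 (hg v)
    · exact one_pos
  let a : V₁ ⊕ Unit → EuclideanSpace ℝ (Fin m) := Sum.elim (fun x => (1 + g x)⁻¹ • f₁ x) 0
  let b : V₁ ⊕ Unit → ℝ := Sum.elim (fun x => (1 + g x)⁻¹ * g x) 1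
  let f : V₁ ⊕ Unit → E := fun v => (a v, b v)
  have hD : ∀ c, c ∈ affineDependences (fun v => e (f v)) ↔ u * c ∈ D := by
    intro c
    rw [affineDependences_comp]
    have hsum : ∑ v, c (Sum.inl v) = ∑ v, (1 + g v)⁻¹ * c (Sum.inl v) +
        ∑ v, (1 + g v)⁻¹ * c (Sum.inl v) * g v := by
      rw [← Finset.sum_add_distrib]
      refine Finset.sum_congr rfl fun v _ => ?_
      have := (hg v).ne'
      field_simp
    have hsum2 : ∑ v, c (Sum.inl v) * ((1 + g v)⁻¹ * g v) =
        ∑ v, (1 + g v)⁻¹ * c (Sum.inl v) * g v :=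
      Finset.sum_congr rfl fun v _ => by ring
    have hsum3 : ∑ v, c (Sum.inl v) • (1 + g v)⁻¹ • f₁ v =
        ∑ v, ((1 + g v)⁻¹ * c (Sum.inl v)) • f₁ v :=
      Finset.sum_congr rfl fun v _ => by rw [smul_smul, mul_comm]
    have h : c ∈ affineDependences f ↔ ∑ v, c v = 0 ∧ ∑ v, c v • a v = 0 ∧ ∑ v, c v • b v = 0 := by
      rw [← sum_smul_prod_eq_zero_iff]
      rfl
    rw [h, mem_joinDependences]
    simp only [mem_affineDependences, Fintype.sum_sum_type, Sum.elim_inl, Sum.elim_inr,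
      Pi.zero_apply, Pi.one_apply, smul_zero, Finset.sum_const_zero, add_zero,
      smul_eq_mul, mul_one, Function.comp_apply, a, b, u, Pi.mul_apply,
      Submodule.mem_top, one_mul, true_and, hsum, hsum2, hsum3]
    constructor
    · rintro ⟨a1, a2, a3⟩
      exact ⟨⟨by linarith, a2⟩, a3⟩
    · rintro ⟨⟨a1, a2⟩, a3⟩
      exact ⟨by linarith, a2, a3⟩
  have hdiv : ∀ c : V₁ ⊕ Unit → ℝ, u * (u⁻¹ * c) = c := fun c => funext fun v => by
    simp [(hu v).ne']
  have hpat : signPatterns (affineDependences (fun v => e (f v))) = signPatterns D := by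
    ext p
    induction p using Sym2.inductionOn with
    | hf σ τ =>
    rw [mem_signPatterns, mem_signPatterns]
    constructor
    · rintro ⟨c, hc, hc0, a1, a2, a3⟩
      refine ⟨u * c, (hD c).1 hc, fun h => hc0 (funext fun v => ?_),
        fun v hv => mul_nonneg (hu v).le (a1 v hv),
        fun v hv => mul_nonpos_of_nonneg_of_nonpos (hu v).le (a2 v hv),
        fun v h h' => by simp [a3 v h h']⟩
      exact (mul_eq_zero.1 (congrFun h v)).resolve_left (hu v).ne'
    · rintro ⟨c, hc, hc0, a1, a2, a3⟩
      refine ⟨u⁻¹ * c, (hD _).2 (by rwa [hdiv]), fun h => hc0 ?_,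
        fun v hv => mul_nonneg (inv_nonneg.2 (hu v).le) (a1 v hv),
        fun v hv => mul_nonpos_of_nonneg_of_nonpos (inv_nonneg.2 (hu v).le) (a2 v hv),
        fun v h h' => by simp [a3 v h h']⟩
      rw [← hdiv c, h, mul_zero]
  refine (hP₁.join isCellCycle_point).isObstructor (m := m + 1)
    (fun σ hσ => joinComplex_card_le (d₂ := 1) hdim₁ ?_ σ hσ)
    (fun v => e (f v)) (fun σ τ h => ?_) ?_
  · rintro _ ⟨v, rfl⟩
    simp
  · obtain ⟨hl, hr⟩ := mem_joinCells.1 h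
    obtain ⟨d₁, hd₁, hη₁⟩ := hh₁ _ _ hl
    obtain ⟨d₂, hd₂, hη₂⟩ := hh₂ _ _ hr
    have := hd₁.join hd₂ hη₁ hη₂
    rw [← Finset.toLeft_union, ← Finset.toRight_union, Finset.toLeft_disjSum_toRight] at this
    generalize Sum.elim _ _ = d at this
    refine ⟨u⁻¹ * d, (hD _).2 (by rw [hdiv]; exact this.mem), fun v => ?_, fun c hc hcs => ?_⟩
    · rw [← this.ne_zero_iff]
      simp [(hu v).ne']
    · obtain ⟨r, hr⟩ := this.eq_smul _ ((hD c).1 hc) fun v hv => by simp [hcs v hv]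
      refine ⟨r, funext fun v => ?_⟩
      have := congrFun hr v
      simp only [Pi.mul_apply, Pi.smul_apply, smul_eq_mul, Pi.inv_apply] at this ⊢
      have := (hu v).ne'
      field_simp
      linarith
  · rw [hpat, ncard_joinCells_inter_signPatterns hh₁ hh₂]
    refine hodd₁.mul ?_
    have : (({s({()}, ∅)} : Finset (Sym2 (Finset Unit))) : Set (Sym2 (Finset Unit))) ∩
        signPatterns (⊤ : Submodule ℝ (Unit → ℝ)) = {s({()}, ∅)} := by
      rw [Finset.coe_singleton, Set.inter_eq_left, Set.singleton_subset_iff, mem_signPatterns]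
      exact ⟨fun _ => 1, trivial, fun h => one_ne_zero (congrFun h ()), by simp, by simp, by simp⟩
    rw [this, Set.ncard_singleton]
    exact odd_one

end Join

end ObstructorDim

namespace ObstructorDim

/-! ### Geometric realizations and carriers of points. -/

section Realization

variable {X : Type} {T : AbstractSimplicialComplex X}

theorem support_finite (x : realization T) : {v | (x : X → ℝ) v ≠ 0}.Finite := by
  obtain ⟨s, hs, -, h, -⟩ := Set.mem_iUnion₂.1 x.2
  exact s.finite_toSet.subset fun v hv => by_contra fun h' => hv (h v h')

/-- The vertices of the simplex containing a point in its interior. -/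
noncomputable def carrier (x : realization T) : Finset X := (support_finite x).toFinset

theorem mem_carrier {x : realization T} {v : X} : v ∈ carrier x ↔ (x : X → ℝ) v ≠ 0 :=
  Set.Finite.mem_toFinset _

theorem notMem_carrier {x : realization T} {v : X} : v ∉ carrier x ↔ (x : X → ℝ) v = 0 := by
  rw [mem_carrier, not_not]

theorem coord_nonneg (x : realization T) (v : X) : 0 ≤ (x : X → ℝ) v := by
  obtain ⟨s, hs, h, -, -⟩ := Set.mem_iUnion₂.1 x.2
  exact h v

theorem sum_eq_one_of_carrier_subset (x : realization T) {F : Finset X} (hF : carrier x ⊆ F) :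
    ∑ v ∈ F, (x : X → ℝ) v = 1 := by
  classical
  obtain ⟨s, hs, h0, h1, h2⟩ := Set.mem_iUnion₂.1 x.2
  have hs : carrier x ⊆ s := fun v hv => by_contra fun h => mem_carrier.1 hv (h1 v h)
  rw [← h2, ← Finset.sum_subset hs fun v _ hv => notMem_carrier.1 hv,
    ← Finset.sum_subset hF fun v _ hv => notMem_carrier.1 hv]

theorem carrier_mem_faces (x : realization T) : carrier x ∈ T.faces := by
  obtain ⟨s, hs, h0, h1, h2⟩ := Set.mem_iUnion₂.1 x.2
  refine (T.isRelLowerSet_faces hs).2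
    (fun v hv => by_contra fun h => mem_carrier.1 hv (h1 v h)) ?_
  by_contra hne
  have := sum_eq_one_of_carrier_subset x subset_rfl
  rw [Finset.not_nonempty_iff_eq_empty.1 hne, Finset.sum_empty] at this
  exact zero_ne_one this

theorem mem_realization_of {x : X → ℝ} (h0 : ∀ v, 0 ≤ x v) {s F : Finset X} (hs : s ∈ T.faces)
    (hx : ∀ v, x v ≠ 0 → v ∈ s) (hxF : ∀ v, x v ≠ 0 → v ∈ F) (h1 : ∑ v ∈ F, x v = 1) :
    x ∈ realization T := by
  classical
  refine Set.mem_iUnion₂.2 ⟨s, hs, h0, fun v hv => by_contra fun h => hv (hx v h), ?_⟩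
  rw [← h1]
  exact (Finset.sum_subset (Finset.subset_union_left (s₂ := F)) fun v _ hv =>
    by_contra fun h => hv (hx v h)).trans (Finset.sum_subset (Finset.subset_union_right (s₁ := s))
      fun v _ hv => by_contra fun h => hv (hxF v h)).symm

theorem mem_biUnion_closedSimplex_iff {L : Set (Finset X)} {x : realization T} :
    (x : X → ℝ) ∈ ⋃ s ∈ L, closedSimplex s ↔ ∃ s ∈ L, carrier x ⊆ s := by
  simp only [Set.mem_iUnion, exists_prop]
  refine exists_congr fun s => and_congr_right fun _ => ⟨fun ⟨_, h, _⟩ v hv =>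
    by_contra fun h' => mem_carrier.1 hv (h v h'), fun h => ⟨coord_nonneg x, fun v hv => ?_, ?_⟩⟩
  · exact notMem_carrier.1 fun h' => hv (h h')
  · exact sum_eq_one_of_carrier_subset x h

/-- A vertex v of the carrier of x keeps a nonzero coordinate near x, so nearby carriers are among
the finitely many simplices that contain v. -/
theorem eventually_carrier_subset (hT : ∀ v : X, {s ∈ T.faces | v ∈ s}.Finite)
    (x : realization T) : ∃ F : Finset X, ∀ᶠ y in 𝓝 x, carrier y ⊆ F := by
  classical
  obtain ⟨v, hv⟩ := (T.isRelLowerSet_faces (carrier_mem_faces x)).1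
  refine ⟨(hT v).toFinset.biUnion id, ?_⟩
  have hc : Continuous fun y : realization T => (y : X → ℝ) v :=
    (continuous_apply v).comp continuous_subtype_val
  filter_upwards [hc.continuousAt.eventually_ne (mem_carrier.1 hv)] with y hy w hw
  exact Finset.mem_biUnion.2 ⟨carrier y, (hT v).mem_toFinset.2
    ⟨carrier_mem_faces y, mem_carrier.2 hy⟩, hw⟩

/-- Functions given locally by finite sums of coordinates are continuous. -/
theorem continuous_sum_carrier (hT : ∀ v : X, {s ∈ T.faces | v ∈ s}.Finite) (p : X → Prop)
    [DecidablePred p] (c : X → ℝ) :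
    Continuous fun x : realization T => ∑ v ∈ carrier x with p v, c v * (x : X → ℝ) v := by
  classical
  rw [continuous_iff_continuousAt]
  intro x
  obtain ⟨F, hF⟩ := eventually_carrier_subset hT x
  have hc : Continuous fun x : realization T => ∑ v ∈ F with p v, c v * (x : X → ℝ) v :=
    continuous_finsetSum _ fun v _ =>
      continuous_const.mul ((continuous_apply v).comp continuous_subtype_val)
  refine hc.continuousAt.congr ?_
  filter_upwards [hF] with y hy
  refine (Finset.sum_subset (Finset.filter_subset_filter _ hy) fun v hv hv' => ?_).symm
  rw [Finset.mem_filter] at hv hv'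
  rw [notMem_carrier.1 fun h => hv' ⟨h, hv.2⟩, mul_zero]

theorem carrier_vertexPoint [DecidableEq X] (v : X) : carrier (vertexPoint T v) = {v} := by
  ext w
  rw [mem_carrier, Finset.mem_singleton]
  by_cases h : w = v
  · subst h
    simp [vertexPoint]
  · simp [vertexPoint, h]

theorem vertexPoint_apply [DecidableEq X] (v w : X) :
    (vertexPoint T v : X → ℝ) w = if w = v then 1 else 0 := by
  by_cases h : w = v
  · subst h
    simp [vertexPoint]
  · simp [vertexPoint, h]

end Realization

/-! ### Monotone couplings of finite distributions. -/

section Coupling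

variable {A B : Type} [LinearOrder A] [LinearOrder B]

/-- The mass of the elements `≤ a`. -/
noncomputable def massLE (F : Finset A) (y : A → ℝ) (a : A) : ℝ := ∑ a' ∈ F with a' ≤ a, y a'

/-- The mass of the elements `< a`. -/
noncomputable def massLT (F : Finset A) (y : A → ℝ) (a : A) : ℝ := ∑ a' ∈ F with a' < a, y a'

/-- The monotone coupling of two distributions on linear orders. -/
noncomputable def coupling (F : Finset A) (G : Finset B) (y : A → ℝ) (z : B → ℝ) (p : A × B) : ℝ :=
  max 0 (min (massLE F y p.1) (massLE G z p.2) - max (massLT F y p.1) (massLT G z p.2))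

theorem massLE_eq (F : Finset A) (y : A → ℝ) {a : A} (h : a ∉ F → y a = 0) :
    massLE F y a = massLT F y a + y a := by
  have hdisj : Disjoint (F.filter (· < a)) (F.filter (· = a)) :=
    Finset.disjoint_filter.2 fun x _ h => h.ne
  have : F.filter (· ≤ a) = F.filter (· < a) ∪ F.filter (· = a) := by
    rw [← Finset.filter_or]
    exact Finset.filter_congr fun x _ => le_iff_lt_or_eq
  rw [massLE, this, Finset.sum_union hdisj, massLT, Finset.filter_eq']
  split_ifs with h'
  · simp
  · simp [h h']

theorem massLT_nonneg {F : Finset A} {y : A → ℝ} (hy : ∀ a, 0 ≤ y a) (a : A) :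
    0 ≤ massLT F y a := Finset.sum_nonneg fun _ _ => hy _

theorem massLE_le_sum {F : Finset A} {y : A → ℝ} (hy : ∀ a, 0 ≤ y a) (a : A) :
    massLE F y a ≤ ∑ a ∈ F, y a :=
  Finset.sum_le_sum_of_subset_of_nonneg (Finset.filter_subset _ _) fun _ _ _ => hy _

theorem massLT_le_massLE {F : Finset A} {y : A → ℝ} (hy : ∀ a, 0 ≤ y a) (a : A) :
    massLT F y a ≤ massLE F y a :=
  Finset.sum_le_sum_of_subset_of_nonneg
    (Finset.monotone_filter_right _ fun _ _ h => le_of_lt h) fun _ _ _ => hy _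

theorem massLE_le_massLT {F : Finset A} {y : A → ℝ} (hy : ∀ a, 0 ≤ y a) {a a' : A} (h : a < a') :
    massLE F y a ≤ massLT F y a' :=
  Finset.sum_le_sum_of_subset_of_nonneg
    (Finset.monotone_filter_right _ fun _ _ h' => lt_of_le_of_lt h' h) fun _ _ _ => hy _

/-- The overlap length of the intervals [p, q] and [r, s], written as inclusion–exclusion in minima.
-/
theorem max_min_sub_max_eq {p q r s : ℝ} (hpq : p ≤ q) (hrs : r ≤ s) :
    max 0 (min q s - max p r) = min q s - min p s - min q r + min p r := by
  rcases le_total q s with h1 | h1 <;> rcases le_total p s with h2 | h2 <;>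
    rcases le_total q r with h3 | h3 <;> rcases le_total p r with h4 | h4 <;>
    simp only [h1, h2, h3, h4, min_eq_left, min_eq_right, max_eq_left, max_eq_right] <;>
    first
      | (rw [max_eq_left (by linarith)]; linarith)
      | (rw [max_eq_right (by linarith)]; linarith)

/-- The upper mass of an element is the lower mass of the next one; the induction adds the largest
element. -/
theorem sum_telescope (G : Finset B) (z : B → ℝ) (g : ℝ → ℝ) :
    ∑ b ∈ G, (g (massLE G z b) - g (massLT G z b)) = g (∑ b ∈ G, z b) - g 0 := by
  induction G using Finset.induction_on_max with
  | empty => simp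
  | insert m G hm ih =>
    have hmG : m ∉ G := fun h => (hm m h).false
    rw [Finset.sum_insert hmG]
    have e1 : massLE (insert m G) z m = ∑ b ∈ insert m G, z b := by
      rw [massLE, Finset.filter_true_of_mem]
      intro b hb
      rcases Finset.mem_insert.1 hb with rfl | h
      · exact le_rfl
      · exact (hm b h).le
    have e2 : massLT (insert m G) z m = ∑ b ∈ G, z b := by
      rw [massLT, Finset.filter_insert, if_neg (lt_irrefl m), Finset.filter_true_of_mem hm]
    have e3 : ∀ b ∈ G, massLE (insert m G) z b = massLE G z b := fun b hb => by
      rw [massLE, Finset.filter_insert, if_neg (not_le.2 (hm b hb)), massLE]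
    have e4 : ∀ b ∈ G, massLT (insert m G) z b = massLT G z b := fun b hb => by
      rw [massLT, Finset.filter_insert, if_neg (not_lt.2 (hm b hb).le), massLT]
    rw [Finset.sum_congr rfl fun b hb => by rw [e3 b hb, e4 b hb], ih, e1, e2]
    ring

variable {F : Finset A} {G : Finset B} {y : A → ℝ} {z : B → ℝ}

theorem coupling_eq (hy : ∀ a, 0 ≤ y a) (hz : ∀ b, 0 ≤ z b) (p : A × B) :
    coupling F G y z p = min (massLE F y p.1) (massLE G z p.2) -
      min (massLT F y p.1) (massLE G z p.2) - min (massLE F y p.1) (massLT G z p.2) +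
      min (massLT F y p.1) (massLT G z p.2) :=
  max_min_sub_max_eq (massLT_le_massLE hy _) (massLT_le_massLE hz _)

/-- Lay out consecutive intervals of lengths y a in [0, 1], and likewise for z. The coupling at (a,
b) is the overlap of the interval of a with that of b, and the intervals of the b cover all of [0,
1]. -/
theorem sum_coupling_snd (hy : ∀ a, 0 ≤ y a) (hz : ∀ b, 0 ≤ z b) (hyF : ∑ a ∈ F, y a = 1)
    (hzG : ∑ b ∈ G, z b = 1) {a : A} (ha : a ∉ F → y a = 0) :
    ∑ b ∈ G, coupling F G y z (a, b) = y a := by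
  have h1 := massLE_le_sum (F := F) hy a
  have h2 := massLT_le_massLE (F := F) hy a
  have h3 := massLT_nonneg (F := F) hy a
  rw [Finset.sum_congr rfl fun b _ => show coupling F G y z (a, b) =
      (fun t => min (massLE F y a) t - min (massLT F y a) t) (massLE G z b) -
      (fun t => min (massLE F y a) t - min (massLT F y a) t) (massLT G z b) by
    rw [coupling_eq hy hz]; ring, sum_telescope G z fun t =>
      min (massLE F y a) t - min (massLT F y a) t]
  rw [hyF] at h1
  simp only [hzG]
  rw [min_eq_left h1, min_eq_left (h2.trans h1), min_eq_right (h3.trans h2), min_eq_right h3,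
    massLE_eq F y ha]
  ring

theorem coupling_swap (p : A × B) : coupling G F z y p.swap = coupling F G y z p := by
  simp only [coupling, Prod.fst_swap, Prod.snd_swap]
  rw [min_comm, max_comm (massLT G z p.2)]

theorem sum_coupling_fst (hy : ∀ a, 0 ≤ y a) (hz : ∀ b, 0 ≤ z b) (hyF : ∑ a ∈ F, y a = 1)
    (hzG : ∑ b ∈ G, z b = 1) {b : B} (hb : b ∉ G → z b = 0) :
    ∑ a ∈ F, coupling F G y z (a, b) = z b := by
  rw [← sum_coupling_snd hz hy hzG hyF hb]
  exact Finset.sum_congr rfl fun a _ => (coupling_swap (a, b)).symm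

theorem coupling_ne_zero {p : A × B} (ha : p.1 ∉ F → y p.1 = 0)
    (hb : p.2 ∉ G → z p.2 = 0) (h : coupling F G y z p ≠ 0) : y p.1 ≠ 0 ∧ z p.2 ≠ 0 := by
  constructor
  · intro h0
    refine h (max_eq_left ?_)
    have := massLE_eq F y ha
    rw [h0, add_zero] at this
    have h1 := min_le_left (massLE F y p.1) (massLE G z p.2)
    have h2 := le_max_left (massLT F y p.1) (massLT G z p.2)
    linarith
  · intro h0
    refine h (max_eq_left ?_)
    have := massLE_eq G z hb
    rw [h0, add_zero] at this
    have h1 := min_le_right (massLE F y p.1) (massLE G z p.2)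
    have h2 := le_max_right (massLT F y p.1) (massLT G z p.2)
    linarith

/-- If p.1 < q.1 and q.2 < p.2, the interval of p.1 is to the left of that of q.1 while the interval
of p.2 is to the right of that of q.2, so the two overlaps cannot both have positive length. -/
theorem coupling_chain (hy : ∀ a, 0 ≤ y a) (hz : ∀ b, 0 ≤ z b) {p q : A × B}
    (hp : coupling F G y z p ≠ 0) (hq : coupling F G y z q ≠ 0) : p ≤ q ∨ q ≤ p := by
  have hpos : ∀ {p : A × B}, coupling F G y z p ≠ 0 →
      massLT F y p.1 < massLE G z p.2 ∧ massLT G z p.2 < massLE F y p.1 := by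
    intro p h
    have h0 : 0 < min (massLE F y p.1) (massLE G z p.2) - max (massLT F y p.1) (massLT G z p.2) := by
      by_contra h'
      exact h (max_eq_left (not_lt.1 h'))
    rw [sub_pos, max_lt_iff, lt_min_iff, lt_min_iff] at h0
    exact ⟨h0.1.2, h0.2.1⟩
  have key : ∀ {p q : A × B}, coupling F G y z p ≠ 0 → coupling F G y z q ≠ 0 →
      ¬ (p.1 < q.1 ∧ q.2 < p.2) := by
    rintro p q hp hq ⟨h1, h2⟩
    have a1 := (hpos hp).2
    have a2 := (hpos hq).1
    have a3 := massLE_le_massLT (F := F) hy h1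
    have a4 := massLE_le_massLT (F := G) hz h2
    linarith
  rcases lt_trichotomy p.1 q.1 with h | h | h
  · exact Or.inl ⟨h.le, not_lt.1 fun h' => key hp hq ⟨h, h'⟩⟩
  · rcases le_total p.2 q.2 with h' | h'
    · exact Or.inl ⟨h.le, h'⟩
    · exact Or.inr ⟨h.ge, h'⟩
  · exact Or.inr ⟨h.le, not_lt.1 fun h' => key hq hp ⟨h, h'⟩⟩

theorem sum_filter_and_eq_min {P : Type*} {S : Finset P} {x : P → ℝ} (hx : ∀ p, 0 ≤ x p)
    {p₁ p₂ : P → Prop} [DecidablePred p₁] [DecidablePred p₂]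
    (h : (∀ p ∈ S, p₁ p → p₂ p) ∨ ∀ p ∈ S, p₂ p → p₁ p) :
    ∑ p ∈ S with p₁ p ∧ p₂ p, x p = min (∑ p ∈ S with p₁ p, x p) (∑ p ∈ S with p₂ p, x p) := by
  rcases h with h | h
  · rw [min_eq_left, Finset.filter_congr fun p hp => show p₁ p ∧ p₂ p ↔ p₁ p from
      ⟨fun h => h.1, fun h' => ⟨h', h p hp h'⟩⟩]
    refine Finset.sum_le_sum_of_subset_of_nonneg (fun p hp => ?_) fun _ _ _ => hx _
    rw [Finset.mem_filter] at hp ⊢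
    exact ⟨hp.1, h p hp.1 hp.2⟩
  · rw [min_eq_right, Finset.filter_congr fun p hp => show p₁ p ∧ p₂ p ↔ p₂ p from
      ⟨fun h => h.2, fun h' => ⟨h p hp h', h'⟩⟩]
    refine Finset.sum_le_sum_of_subset_of_nonneg (fun p hp => ?_) fun _ _ _ => hx _
    rw [Finset.mem_filter] at hp ⊢
    exact ⟨hp.1, h p hp.1 hp.2⟩

/-- A distribution supported on a chain is the monotone coupling of its marginals. -/
theorem eq_coupling_of_chain {S : Finset (A × B)} {x : A × B → ℝ} (hx : ∀ p, 0 ≤ x p)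
    (hxS : ∀ p ∉ S, x p = 0) (hS : ∀ p ∈ S, ∀ q ∈ S, p ≤ q ∨ q ≤ p)
    (hSF : ∀ p ∈ S, p.1 ∈ F) (hSG : ∀ p ∈ S, p.2 ∈ G)
    (hy : ∀ a, y a = ∑ p ∈ S with p.1 = a, x p) (hz : ∀ b, z b = ∑ p ∈ S with p.2 = b, x p)
    (p : A × B) : x p = coupling F G y z p := by
  have hmass : ∀ (r : A → Prop) [DecidablePred r],
      ∑ a ∈ F with r a, y a = ∑ p ∈ S with r p.1, x p := by
    intro r _
    rw [Finset.sum_congr rfl fun a _ => hy a]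
    rw [← Finset.sum_fiberwise_of_maps_to (s := S.filter fun p => r p.1) (t := F.filter r)
      (g := Prod.fst) fun p hp => by
        rw [Finset.mem_filter] at hp ⊢; exact ⟨hSF p hp.1, hp.2⟩]
    refine Finset.sum_congr rfl fun a ha => ?_
    rw [Finset.filter_filter]
    refine Finset.sum_congr (Finset.filter_congr fun p _ => ?_) fun _ _ => rfl
    exact ⟨fun h => ⟨h ▸ (Finset.mem_filter.1 ha).2, h⟩, fun h => h.2⟩
  have hmass' : ∀ (r : B → Prop) [DecidablePred r],
      ∑ b ∈ G with r b, z b = ∑ p ∈ S with r p.2, x p := by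
    intro r _
    rw [Finset.sum_congr rfl fun a _ => hz a]
    rw [← Finset.sum_fiberwise_of_maps_to (s := S.filter fun p => r p.2) (t := G.filter r)
      (g := Prod.snd) fun p hp => by
        rw [Finset.mem_filter] at hp ⊢; exact ⟨hSG p hp.1, hp.2⟩]
    refine Finset.sum_congr rfl fun a ha => ?_
    rw [Finset.filter_filter]
    refine Finset.sum_congr (Finset.filter_congr fun p _ => ?_) fun _ _ => rfl
    exact ⟨fun h => ⟨h ▸ (Finset.mem_filter.1 ha).2, h⟩, fun h => h.2⟩
  have hy0 : ∀ a, 0 ≤ y a := fun a => by rw [hy]; exact Finset.sum_nonneg fun _ _ => hx _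
  have hz0 : ∀ a, 0 ≤ z a := fun a => by rw [hz]; exact Finset.sum_nonneg fun _ _ => hx _
  -- On a chain, two conditions that are closed downwards in the separate coordinates are nested, so
  -- their joint mass is the smaller of the marginal masses.
  have hmin : ∀ (r₁ : A → Prop) (r₂ : B → Prop) [DecidablePred r₁] [DecidablePred r₂],
      (∀ a a', a ≤ a' → r₁ a' → r₁ a) → (∀ b b', b ≤ b' → r₂ b' → r₂ b) →
      ∑ p ∈ S with r₁ p.1 ∧ r₂ p.2, x p =
        min (∑ a ∈ F with r₁ a, y a) (∑ b ∈ G with r₂ b, z b) := by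
    intro r₁ r₂ _ _ h₁ h₂
    rw [hmass, hmass']
    refine sum_filter_and_eq_min hx (p₁ := fun p => r₁ p.1) (p₂ := fun p => r₂ p.2) ?_
    by_contra hne
    push Not at hne
    obtain ⟨⟨p, hp, hp1, hp2⟩, q, hq, hq1, hq2⟩ := hne
    rcases hS p hp q hq with h | h
    · exact hp2 (h₂ _ _ h.2 hq1)
    · exact hq2 (h₁ _ _ h.1 hp1)
  -- The four minima are masses of lower rectangles with corner p, closed or open in each
  -- coordinate; inclusion–exclusion isolates the point p.
  rw [coupling_eq hy0 hz0]
  simp only [massLE, massLT]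
  rw [← hmin (· ≤ p.1) (· ≤ p.2) (fun _ _ => le_trans) (fun _ _ => le_trans),
    ← hmin (· < p.1) (· ≤ p.2) (fun _ _ => lt_of_le_of_lt) (fun _ _ => le_trans),
    ← hmin (· ≤ p.1) (· < p.2) (fun _ _ => le_trans) (fun _ _ => lt_of_le_of_lt),
    ← hmin (· < p.1) (· < p.2) (fun _ _ => lt_of_le_of_lt) (fun _ _ => lt_of_le_of_lt)]
  simp only [Finset.sum_filter]
  rw [← Finset.sum_sub_distrib, ← Finset.sum_sub_distrib, ← Finset.sum_add_distrib]
  have hxp : x p = ∑ q ∈ S, if q = p then x q else 0 := by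
    rw [Finset.sum_ite_eq']
    split_ifs with h
    · rfl
    · exact hxS p h
  rw [hxp]
  refine Finset.sum_congr rfl fun q _ => ?_
  have hqp : q = p ↔ q.1 = p.1 ∧ q.2 = p.2 := Prod.ext_iff
  rcases lt_trichotomy q.1 p.1 with h1 | h1 | h1 <;> rcases lt_trichotomy q.2 p.2 with h2 | h2 | h2 <;>
    simp [hqp, h1, h2, le_of_lt, ne_of_lt, ne_of_gt, not_le_of_gt, not_lt_of_gt]

end Coupling

end ObstructorDim

namespace ObstructorDim

/-! ### Triangulated products of ordered complexes. -/

section ProductComplex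

variable {A B : Type} [LinearOrder A] [LinearOrder B]

/-- The standard triangulation of the product of two ordered simplicial complexes. -/
def productComplex (T₁ : AbstractSimplicialComplex A) (T₂ : AbstractSimplicialComplex B) :
    AbstractSimplicialComplex (A × B) where
  faces := {s | s.image Prod.fst ∈ T₁.faces ∧ s.image Prod.snd ∈ T₂.faces ∧
    ∀ p ∈ s, ∀ q ∈ s, p ≤ q ∨ q ≤ p}
  isRelLowerSet_faces := by
    rintro s ⟨h₁, h₂, h⟩
    refine ⟨Finset.image_nonempty.1 (T₁.isRelLowerSet_faces h₁).1, fun t hts ht => ⟨?_, ?_, ?_⟩⟩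
    · exact (T₁.isRelLowerSet_faces h₁).2 (Finset.image_subset_image hts) (ht.image _)
    · exact (T₂.isRelLowerSet_faces h₂).2 (Finset.image_subset_image hts) (ht.image _)
    · exact fun p hp q hq => h p (hts hp) q (hts hq)
  singleton_mem v := by
    refine ⟨?_, ?_, ?_⟩
    · rw [Finset.image_singleton]; exact T₁.singleton_mem _
    · rw [Finset.image_singleton]; exact T₂.singleton_mem _
    · intro p hp q hq
      rw [Finset.mem_singleton.1 hp, Finset.mem_singleton.1 hq]
      exact Or.inl le_rfl

variable {T₁ : AbstractSimplicialComplex A} {T₂ : AbstractSimplicialComplex B}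

theorem productComplex_locallyFinite (h₁ : ∀ v, {s ∈ T₁.faces | v ∈ s}.Finite)
    (h₂ : ∀ v, {s ∈ T₂.faces | v ∈ s}.Finite) (v : A × B) :
    {s ∈ (productComplex T₁ T₂).faces | v ∈ s}.Finite := by
  classical
  let F := (h₁ v.1).toFinset.biUnion id ×ˢ (h₂ v.2).toFinset.biUnion id
  refine (F.powerset.finite_toSet).subset fun s hs => ?_
  rw [Finset.mem_coe, Finset.mem_powerset]
  intro p hp
  refine Finset.mem_product.2 ⟨Finset.mem_biUnion.2 ⟨s.image Prod.fst, ?_, ?_⟩,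
    Finset.mem_biUnion.2 ⟨s.image Prod.snd, ?_, ?_⟩⟩
  · exact (h₁ v.1).mem_toFinset.2 ⟨hs.1.1, Finset.mem_image_of_mem _ hs.2⟩
  · exact Finset.mem_image_of_mem _ hp
  · exact (h₂ v.2).mem_toFinset.2 ⟨hs.1.2.1, Finset.mem_image_of_mem _ hs.2⟩
  · exact Finset.mem_image_of_mem _ hp

/-- The image distribution under `g`. -/
noncomputable def marginal {X Y : Type} [DecidableEq Y] (g : X → Y) (T : AbstractSimplicialComplex X)
    (x : realization T) (a : Y) : ℝ := ∑ p ∈ carrier x with g p = a, (x : X → ℝ) p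

section Marginal

variable {X Y : Type} [DecidableEq Y] {g : X → Y} {T : AbstractSimplicialComplex X}
  {T' : AbstractSimplicialComplex Y}

theorem marginal_nonneg (x : realization T) (a : Y) : 0 ≤ marginal g T x a :=
  Finset.sum_nonneg fun _ _ => coord_nonneg x _

theorem marginal_ne_zero_iff {x : realization T} {a : Y} :
    marginal g T x a ≠ 0 ↔ a ∈ (carrier x).image g := by
  rw [Finset.mem_image, Ne, marginal, Finset.sum_eq_zero_iff_of_nonneg fun _ _ => coord_nonneg x _]
  push Not
  constructor
  · rintro ⟨p, hp, -⟩
    exact ⟨p, (Finset.mem_filter.1 hp).1, (Finset.mem_filter.1 hp).2⟩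
  · rintro ⟨p, hp, h⟩
    exact ⟨p, Finset.mem_filter.2 ⟨hp, h⟩, mem_carrier.1 hp⟩

theorem sum_marginal (x : realization T) : ∑ a ∈ (carrier x).image g, marginal g T x a = 1 := by
  rw [← sum_eq_one_of_carrier_subset x subset_rfl]
  exact Finset.sum_fiberwise_of_maps_to (fun p hp => Finset.mem_image_of_mem g hp) _

theorem marginal_mem (h : ∀ s ∈ T.faces, s.image g ∈ T'.faces) (x : realization T) :
    marginal g T x ∈ realization T' :=
  mem_realization_of (marginal_nonneg x) (h _ (carrier_mem_faces x))
    (fun _ => marginal_ne_zero_iff.1) (fun _ => marginal_ne_zero_iff.1) (sum_marginal x)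

theorem continuous_marginal (hT : ∀ v : X, {s ∈ T.faces | v ∈ s}.Finite) :
    Continuous (marginal g T) := by
  refine continuous_pi fun a => ?_
  refine (continuous_sum_carrier hT (fun p => g p = a) 1).congr fun x => ?_
  simp [marginal]

/-- The map of realizations induced by a simplicial map. -/
noncomputable def simplicialMap (g : X → Y) (h : ∀ s ∈ T.faces, s.image g ∈ T'.faces)
    (x : realization T) : realization T' :=
  ⟨marginal g T x, marginal_mem h x⟩

theorem carrier_simplicialMap (h : ∀ s ∈ T.faces, s.image g ∈ T'.faces) (x : realization T) :
    carrier (simplicialMap g h x) = (carrier x).image g := by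
  ext a
  rw [mem_carrier]
  exact marginal_ne_zero_iff

theorem continuous_simplicialMap (hT : ∀ v : X, {s ∈ T.faces | v ∈ s}.Finite)
    (h : ∀ s ∈ T.faces, s.image g ∈ T'.faces) : Continuous (simplicialMap g h) :=
  (continuous_marginal hT).subtype_mk _

theorem eq_vertexPoint_of_carrier {x : realization T} {v : X} (h : carrier x = {v}) :
    x = vertexPoint T v := by
  classical
  have h1 := sum_eq_one_of_carrier_subset x subset_rfl
  rw [h, Finset.sum_singleton] at h1
  refine Subtype.ext (funext fun w => ?_)
  rw [vertexPoint_apply]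
  split_ifs with hw
  · rw [hw, h1]
  · refine notMem_carrier.1 ?_
    rw [h, Finset.mem_singleton]
    exact hw

theorem simplicialMap_vertexPoint (h : ∀ s ∈ T.faces, s.image g ∈ T'.faces) (v : X) :
    simplicialMap g h (vertexPoint T v) = vertexPoint T' (g v) := by
  classical
  refine eq_vertexPoint_of_carrier ?_
  rw [carrier_simplicialMap, carrier_vertexPoint, Finset.image_singleton]

end Marginal

theorem continuous_massLE (h₁ : ∀ v, {s ∈ T₁.faces | v ∈ s}.Finite) (a : A) :
    Continuous fun y : realization T₁ => massLE (carrier y) y a :=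
  (continuous_sum_carrier h₁ (fun p => p ≤ a) 1).congr fun x => by simp [massLE]

theorem continuous_massLT (h₁ : ∀ v, {s ∈ T₁.faces | v ∈ s}.Finite) (a : A) :
    Continuous fun y : realization T₁ => massLT (carrier y) y a :=
  (continuous_sum_carrier h₁ (fun p => p < a) 1).congr fun x => by simp [massLT]

/-- The monotone coupling of two points. -/
noncomputable def couplingFun (y : realization T₁) (z : realization T₂) : A × B → ℝ :=
  coupling (carrier y) (carrier z) y z

theorem couplingFun_nonneg (y : realization T₁) (z : realization T₂) (p : A × B) :
    0 ≤ couplingFun y z p := le_max_left _ _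

theorem couplingFun_ne_zero {y : realization T₁} {z : realization T₂} {p : A × B}
    (h : couplingFun y z p ≠ 0) : p ∈ carrier y ×ˢ carrier z := by
  have := coupling_ne_zero notMem_carrier.1 notMem_carrier.1 h
  exact Finset.mem_product.2 ⟨mem_carrier.2 this.1, mem_carrier.2 this.2⟩

theorem sum_couplingFun_snd (y : realization T₁) (z : realization T₂) (a : A) :
    ∑ b ∈ carrier z, couplingFun y z (a, b) = (y : A → ℝ) a :=
  sum_coupling_snd (coord_nonneg y) (coord_nonneg z) (sum_eq_one_of_carrier_subset y subset_rfl)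
    (sum_eq_one_of_carrier_subset z subset_rfl) notMem_carrier.1

theorem sum_couplingFun_fst (y : realization T₁) (z : realization T₂) (b : B) :
    ∑ a ∈ carrier y, couplingFun y z (a, b) = (z : B → ℝ) b :=
  sum_coupling_fst (coord_nonneg y) (coord_nonneg z) (sum_eq_one_of_carrier_subset y subset_rfl)
    (sum_eq_one_of_carrier_subset z subset_rfl) notMem_carrier.1

theorem couplingFun_mem (y : realization T₁) (z : realization T₂) :
    couplingFun y z ∈ realization (productComplex T₁ T₂) := by
  classical
  have hsum : ∑ p ∈ carrier y ×ˢ carrier z, couplingFun y z p = 1 := by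
    rw [Finset.sum_product, Finset.sum_congr rfl fun a _ => sum_couplingFun_snd y z a]
    exact sum_eq_one_of_carrier_subset y subset_rfl
  set s := (carrier y ×ˢ carrier z).filter fun p => couplingFun y z p ≠ 0 with hs
  have hmem : ∀ p, couplingFun y z p ≠ 0 → p ∈ s := fun p hp =>
    Finset.mem_filter.2 ⟨couplingFun_ne_zero hp, hp⟩
  have hne : s.Nonempty := by
    by_contra h
    rw [Finset.not_nonempty_iff_eq_empty] at h
    rw [Finset.sum_eq_zero fun p _ => by_contra fun hp => by
      have := hmem p hp
      rw [h] at this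
      exact absurd this (Finset.notMem_empty p)] at hsum
    exact zero_ne_one hsum
  have hsub : ∀ p ∈ s, p.1 ∈ carrier y ∧ p.2 ∈ carrier z := fun p hp =>
    Finset.mem_product.1 (Finset.mem_filter.1 hp).1
  refine mem_realization_of (couplingFun_nonneg y z) (s := s) ⟨?_, ?_, ?_⟩ hmem
    (fun p hp => couplingFun_ne_zero hp) hsum
  · exact (T₁.isRelLowerSet_faces (carrier_mem_faces y)).2
      (Finset.image_subset_iff.2 fun p hp => (hsub p hp).1) (hne.image _)
  · exact (T₂.isRelLowerSet_faces (carrier_mem_faces z)).2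
      (Finset.image_subset_iff.2 fun p hp => (hsub p hp).2) (hne.image _)
  · exact fun p hp q hq => coupling_chain (coord_nonneg y) (coord_nonneg z)
      (Finset.mem_filter.1 hp).2 (Finset.mem_filter.1 hq).2

theorem image_fst_mem {s} (h : s ∈ (productComplex T₁ T₂).faces) : s.image Prod.fst ∈ T₁.faces := h.1

theorem image_snd_mem {s} (h : s ∈ (productComplex T₁ T₂).faces) : s.image Prod.snd ∈ T₂.faces :=
  h.2.1

/-- The realization of the product complex is the product of the realizations. -/
noncomputable def productHomeo (h₁ : ∀ v, {s ∈ T₁.faces | v ∈ s}.Finite)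
    (h₂ : ∀ v, {s ∈ T₂.faces | v ∈ s}.Finite) :
    realization (productComplex T₁ T₂) ≃ₜ realization T₁ × realization T₂ where
  toFun x := (simplicialMap Prod.fst (fun _ => image_fst_mem) x,
    simplicialMap Prod.snd (fun _ => image_snd_mem) x)
  invFun q := ⟨couplingFun q.1 q.2, couplingFun_mem q.1 q.2⟩
  left_inv x := by
    refine Subtype.ext (funext fun p => ?_)
    refine (eq_coupling_of_chain (S := carrier x) (coord_nonneg x) (fun _ => notMem_carrier.1)
      (carrier_mem_faces x).2.2 ?_ ?_ (fun a => rfl) (fun b => rfl) p).symm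
    · intro p hp
      rw [carrier_simplicialMap]
      exact Finset.mem_image_of_mem _ hp
    · intro p hp
      rw [carrier_simplicialMap]
      exact Finset.mem_image_of_mem _ hp
  right_inv := by
    rintro ⟨y, z⟩
    have hc : ∀ {p}, p ∈ carrier (⟨couplingFun y z, couplingFun_mem y z⟩ :
        realization (productComplex T₁ T₂)) → p ∈ carrier y ×ˢ carrier z := fun hp =>
      couplingFun_ne_zero (mem_carrier.1 hp)
    refine Prod.ext (Subtype.ext (funext fun a => ?_)) (Subtype.ext (funext fun b => ?_))
    · refine Eq.trans ?_ (sum_couplingFun_snd y z a)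
      rw [← Finset.sum_singleton (fun a => ∑ b ∈ carrier z, couplingFun y z (a, b)) a,
        ← Finset.sum_product]
      refine Finset.sum_subset (fun p hp => ?_) fun p hp hp' => ?_
      · rw [Finset.mem_filter] at hp
        exact Finset.mem_product.2 ⟨Finset.mem_singleton.2 hp.2, (Finset.mem_product.1 (hc hp.1)).2⟩
      · exact notMem_carrier.1 fun h => hp' (Finset.mem_filter.2
          ⟨h, Finset.mem_singleton.1 (Finset.mem_product.1 hp).1⟩)
    · refine Eq.trans ?_ (sum_couplingFun_fst y z b)
      rw [← Finset.sum_singleton (fun b => ∑ a ∈ carrier y, couplingFun y z (a, b)) b,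
        ← Finset.sum_product_right]
      refine Finset.sum_subset (fun p hp => ?_) fun p hp hp' => ?_
      · rw [Finset.mem_filter] at hp
        exact Finset.mem_product.2 ⟨(Finset.mem_product.1 (hc hp.1)).1, Finset.mem_singleton.2 hp.2⟩
      · exact notMem_carrier.1 fun h => hp' (Finset.mem_filter.2
          ⟨h, Finset.mem_singleton.1 (Finset.mem_product.1 hp).2⟩)
  continuous_toFun :=
    (continuous_simplicialMap (productComplex_locallyFinite h₁ h₂) _).prodMk
      (continuous_simplicialMap (productComplex_locallyFinite h₁ h₂) _)
  continuous_invFun := by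
    -- Each coordinate of the coupling is built by max and min from cumulative masses, which are
    -- locally finite sums of coordinates.
    refine Continuous.subtype_mk (continuous_pi fun p => ?_) _
    have c1 := (continuous_massLE h₁ p.1).comp (continuous_fst (Y := realization T₂))
    have c2 := (continuous_massLT h₁ p.1).comp (continuous_fst (Y := realization T₂))
    have c3 := (continuous_massLE h₂ p.2).comp (continuous_snd (X := realization T₁))
    have c4 := (continuous_massLT h₂ p.2).comp (continuous_snd (X := realization T₁))
    exact continuous_const.max ((c1.min c3).sub (c2.max c4))

end ProductComplex

/-! ### The open cone over a join as a product of open cones. -/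

section JoinCone

variable {V₁ V₂ : Type} {K₁ : AbstractSimplicialComplex V₁} {K₂ : AbstractSimplicialComplex V₂}

theorem sumElim_mem_coneSimplex {σ : Finset (V₁ ⊕ V₂)} {y : V₁ → ℝ} {z : V₂ → ℝ} :
    Sum.elim y z ∈ coneSimplex σ ↔ y ∈ coneSimplex σ.toLeft ∧ z ∈ coneSimplex σ.toRight := by
  simp only [coneSimplex, Set.mem_ofPred_eq, Sum.forall, Sum.elim_inl, Sum.elim_inr,
    Finset.mem_toLeft, Finset.mem_toRight]
  tauto

theorem coneSimplex_mono {V : Type} {σ τ : Finset V} (h : σ ⊆ τ) : coneSimplex σ ⊆ coneSimplex τ :=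
  fun _ hx => ⟨hx.1, fun v hv => hx.2 v fun h' => hv (h h')⟩

/-- The cone over the empty simplex is the cone point, which lies in the cone over any vertex; hence
the need for a vertex. -/
theorem mem_openCone_of_augmented {V : Type} [Nonempty V] {K : AbstractSimplicialComplex V}
    {σ : Finset V} (h : σ ∈ K.faces ∨ σ = ∅) {x : V → ℝ} (hx : x ∈ coneSimplex σ) :
    x ∈ openCone K := by
  rcases h with h | rfl
  · exact Set.mem_iUnion₂.2 ⟨σ, h, hx⟩
  · obtain ⟨v⟩ := ‹Nonempty V›
    exact Set.mem_iUnion₂.2 ⟨{v}, K.singleton_mem v, coneSimplex_mono (Finset.empty_subset _) hx⟩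

theorem sumElim_mem_openCone [Nonempty V₁] [Nonempty V₂] {y : V₁ → ℝ} {z : V₂ → ℝ} :
    Sum.elim y z ∈ openCone (joinComplex K₁ K₂) ↔ y ∈ openCone K₁ ∧ z ∈ openCone K₂ := by
  constructor
  · intro h
    obtain ⟨s, hs, h⟩ := Set.mem_iUnion₂.1 h
    rw [sumElim_mem_coneSimplex] at h
    exact ⟨mem_openCone_of_augmented hs.2.1 h.1, mem_openCone_of_augmented hs.2.2 h.2⟩
  · rintro ⟨hy, hz⟩
    obtain ⟨s, hs, hy⟩ := Set.mem_iUnion₂.1 hy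
    obtain ⟨t, ht, hz⟩ := Set.mem_iUnion₂.1 hz
    refine Set.mem_iUnion₂.2 ⟨s.disjSum t, ⟨?_, ?_, ?_⟩, sumElim_mem_coneSimplex.2 ⟨?_, ?_⟩⟩
    · obtain ⟨v, hv⟩ := (K₁.isRelLowerSet_faces hs).1
      exact ⟨Sum.inl v, Finset.inl_mem_disjSum.2 hv⟩
    · rw [Finset.toLeft_disjSum]; exact Or.inl hs
    · rw [Finset.toRight_disjSum]; exact Or.inl ht
    · rwa [Finset.toLeft_disjSum]
    · rwa [Finset.toRight_disjSum]

theorem comp_mem_openCone [Nonempty V₁] [Nonempty V₂] (x : openCone (joinComplex K₁ K₂)) :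
    (x : V₁ ⊕ V₂ → ℝ) ∘ Sum.inl ∈ openCone K₁ ∧ (x : V₁ ⊕ V₂ → ℝ) ∘ Sum.inr ∈ openCone K₂ := by
  rw [← sumElim_mem_openCone, Sum.elim_comp_inl_inr]
  exact x.2

/-- The open cone over a join is the product of the open cones. -/
def joinConeHomeo (K₁ : AbstractSimplicialComplex V₁) (K₂ : AbstractSimplicialComplex V₂)
    [Nonempty V₁] [Nonempty V₂] : openCone K₁ × openCone K₂ ≃ₜ openCone (joinComplex K₁ K₂) where
  toFun p := ⟨Sum.elim p.1 p.2, sumElim_mem_openCone.2 ⟨p.1.2, p.2.2⟩⟩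
  invFun x := (⟨(x : V₁ ⊕ V₂ → ℝ) ∘ Sum.inl, (comp_mem_openCone x).1⟩,
    ⟨(x : V₁ ⊕ V₂ → ℝ) ∘ Sum.inr, (comp_mem_openCone x).2⟩)
  left_inv p := rfl
  right_inv x := Subtype.ext (Sum.elim_comp_inl_inr _)
  continuous_toFun := by
    refine Continuous.subtype_mk (continuous_pi ?_) _
    rintro (v | v)
    · exact (continuous_apply v).comp (continuous_subtype_val.comp continuous_fst)
    · exact (continuous_apply v).comp (continuous_subtype_val.comp continuous_snd)
  continuous_invFun := by
    refine Continuous.prodMk (Continuous.subtype_mk (continuous_pi fun v => ?_) _)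
      (Continuous.subtype_mk (continuous_pi fun v => ?_) _)
    · exact (continuous_apply _).comp continuous_subtype_val
    · exact (continuous_apply _).comp continuous_subtype_val

/-- The cone over `σ` is a subcomplex. -/
def ConeTriangulation.HasSubcomplex {V X : Type} {K : AbstractSimplicialComplex V}
    (T : ConeTriangulation K X) (σ : Finset V) : Prop :=
  ∃ L ⊆ T.complex.faces, ∀ x : realization T.complex,
    (T.homeo x : V → ℝ) ∈ coneSimplex σ ↔ ∃ s ∈ L, carrier x ⊆ s

theorem ConeTriangulation.hasSubcomplex {V X : Type} {K : AbstractSimplicialComplex V}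
    (T : ConeTriangulation K X) {σ : Finset V} (hσ : σ ∈ K.faces) : T.HasSubcomplex σ := by
  obtain ⟨L, hL, h⟩ := T.subcomplex σ hσ
  refine ⟨L, hL, fun x => ?_⟩
  rw [← mem_biUnion_closedSimplex_iff]
  exact Set.ext_iff.1 h x

/-- Used with disjoint σ and τ, to see that the cone point is a subcomplex. -/
theorem ConeTriangulation.HasSubcomplex.inter {V X : Type} [DecidableEq V]
    {K : AbstractSimplicialComplex V} {T : ConeTriangulation K X} {σ τ : Finset V}
    (hσ : T.HasSubcomplex σ) (hτ : T.HasSubcomplex τ) : T.HasSubcomplex (σ ∩ τ) := by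
  obtain ⟨L, hL, hσ⟩ := hσ
  obtain ⟨M, hM, hτ⟩ := hτ
  have hc : ∀ x : V → ℝ, x ∈ coneSimplex (σ ∩ τ) ↔ x ∈ coneSimplex σ ∧ x ∈ coneSimplex τ := by
    intro x
    constructor
    · exact fun h => ⟨coneSimplex_mono Finset.inter_subset_left h,
        coneSimplex_mono Finset.inter_subset_right h⟩
    · rintro ⟨h1, h2⟩
      refine ⟨h1.1, fun v hv => ?_⟩
      by_cases h : v ∈ σ
      · exact h2.2 v fun h' => hv (Finset.mem_inter.2 ⟨h, h'⟩)
      · exact h1.2 v h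
  refine ⟨{s ∈ T.complex.faces | (∃ t ∈ L, s ⊆ t) ∧ ∃ t ∈ M, s ⊆ t}, fun s hs => hs.1, fun x => ?_⟩
  rw [hc, hσ, hτ]
  constructor
  · exact fun h => ⟨carrier x, ⟨carrier_mem_faces x, h⟩, subset_rfl⟩
  · rintro ⟨s, ⟨-, ⟨t, ht, hst⟩, u, hu, hsu⟩, hxs⟩
    exact ⟨⟨t, ht, hxs.trans hst⟩, u, hu, hxs.trans hsu⟩

/-- Triangulations of two open cones give a triangulation of the open cone over the join. -/
theorem exists_coneTriangulation_join [Nonempty V₁] [Nonempty V₂] {X₁ X₂ : Type}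
    (T₁ : ConeTriangulation K₁ X₁) (T₂ : ConeTriangulation K₂ X₂)
    (h₁ : T₁.HasSubcomplex ∅) (h₂ : T₂.HasSubcomplex ∅) :
    ∃ T : ConeTriangulation (joinComplex K₁ K₂) (X₁ × X₂),
      (∀ p q, (∃ s ∈ T.complex.faces, p ∈ s ∧ q ∈ s) →
        (∃ s ∈ T₁.complex.faces, p.1 ∈ s ∧ q.1 ∈ s) ∧
        ∃ s ∈ T₂.complex.faces, p.2 ∈ s ∧ q.2 ∈ s) ∧
      ∀ σ p, p ∈ T.verticesIn σ ↔
        p.1 ∈ T₁.verticesIn σ.toLeft ∧ p.2 ∈ T₂.verticesIn σ.toRight := by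
  classical
  -- Any linear orders will do: they only select a triangulation of the products of simplices.
  let _ : LinearOrder X₁ := linearOrderOfSTO WellOrderingRel
  let _ : LinearOrder X₂ := linearOrderOfSTO WellOrderingRel
  let e := (productHomeo T₁.locallyFinite T₂.locallyFinite).trans
    ((T₁.homeo.prodCongr T₂.homeo).trans (joinConeHomeo K₁ K₂))
  have he : ∀ x σ, (e x : V₁ ⊕ V₂ → ℝ) ∈ coneSimplex σ ↔
      (T₁.homeo (simplicialMap Prod.fst (fun _ => image_fst_mem) x) : V₁ → ℝ) ∈
        coneSimplex σ.toLeft ∧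
      (T₂.homeo (simplicialMap Prod.snd (fun _ => image_snd_mem) x) : V₂ → ℝ) ∈
        coneSimplex σ.toRight := fun x σ => sumElim_mem_coneSimplex
  refine ⟨⟨productComplex T₁.complex T₂.complex,
    productComplex_locallyFinite T₁.locallyFinite T₂.locallyFinite, e, fun σ hσ => ?_⟩, ?_, ?_⟩
  -- A simplex of the join may miss a factor; its cone then projects to the cone point there, which
  -- is why `h₁` and `h₂` are needed.
  · obtain ⟨L₁, -, hL₁⟩ : T₁.HasSubcomplex σ.toLeft := by
      rcases hσ.2.1 with h | h
      · exact T₁.hasSubcomplex h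
      · rwa [h]
    obtain ⟨L₂, -, hL₂⟩ : T₂.HasSubcomplex σ.toRight := by
      rcases hσ.2.2 with h | h
      · exact T₂.hasSubcomplex h
      · rwa [h]
    refine ⟨{s ∈ (productComplex T₁.complex T₂.complex).faces |
      (∃ t ∈ L₁, s.image Prod.fst ⊆ t) ∧ ∃ t ∈ L₂, s.image Prod.snd ⊆ t}, fun s hs => hs.1, ?_⟩
    ext x
    rw [Set.mem_ofPred_eq, Set.mem_ofPred_eq, mem_biUnion_closedSimplex_iff, he, hL₁, hL₂,
      carrier_simplicialMap, carrier_simplicialMap]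
    constructor
    · exact fun h => ⟨carrier x, ⟨carrier_mem_faces x, h⟩, subset_rfl⟩
    · rintro ⟨s, ⟨-, ⟨t, ht, hst⟩, u, hu, hsu⟩, hxs⟩
      exact ⟨⟨t, ht, (Finset.image_subset_image hxs).trans hst⟩,
        u, hu, (Finset.image_subset_image hxs).trans hsu⟩
  · rintro p q ⟨s, hs, hp, hq⟩
    exact ⟨⟨_, hs.1, Finset.mem_image_of_mem _ hp, Finset.mem_image_of_mem _ hq⟩,
      ⟨_, hs.2.1, Finset.mem_image_of_mem _ hp, Finset.mem_image_of_mem _ hq⟩⟩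
  · intro σ p
    have := he (vertexPoint _ p) σ
    rwa [simplicialMap_vertexPoint, simplicialMap_vertexPoint] at this

end JoinCone

end ObstructorDim

namespace ObstructorDim

set_option linter.unusedSectionVars false

/-! ### The cone over a finite discrete complex, triangulated by rays. -/

section DiscreteCone

variable {ι : Type}

/-- The points at height `n` of the ray `i`; the rays start at a common point `none`. -/
def node (i : ι) : ℕ → Option (ι × ℕ)
  | 0 => none
  | n + 1 => some (i, n)

/-- The distance to the cone point. -/
def height : Option (ι × ℕ) → ℕ
  | none => 0
  | some (_, n) => n + 1

/-- The ray of a vertex other than the cone point. -/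
def rayIndex (v : Option (ι × ℕ)) : Option ι := v.map Prod.fst

@[simp] theorem height_node (i : ι) (n : ℕ) : height (node i n) = n := by cases n <;> rfl

@[simp] theorem rayIndex_node_succ (i : ι) (n : ℕ) : rayIndex (node i (n + 1)) = some i := rfl

theorem node_injective (i : ι) : Function.Injective (node i) := fun m n h => by
  rw [← height_node i m, h, height_node]

theorem height_pos {v : Option (ι × ℕ)} {j : ι} (h : rayIndex v = some j) : 0 < height v := by
  rcases v with _ | ⟨i, n⟩
  · cases h
  · exact Nat.succ_pos n

variable [DecidableEq ι]

/-- The edge between the heights `n` and `n + 1` of the ray `i`. -/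
def rayEdge (i : ι) (n : ℕ) : Finset (Option (ι × ℕ)) := {node i n, node i (n + 1)}

theorem mem_rayEdge {i : ι} {n : ℕ} {v : Option (ι × ℕ)} :
    v ∈ rayEdge i n ↔ v = node i n ∨ v = node i (n + 1) := by
  rw [rayEdge, Finset.mem_insert, Finset.mem_singleton]

/-- Rays with a common origin. -/
def rayComplex (ι : Type) [DecidableEq ι] [Nonempty ι] :
    AbstractSimplicialComplex (Option (ι × ℕ)) where
  faces := {s | s.Nonempty ∧ ∃ i n, s ⊆ rayEdge i n}
  isRelLowerSet_faces := fun s ⟨hs, i, n, h⟩ =>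
    ⟨hs, fun _ ht hne => ⟨hne, i, n, ht.trans h⟩⟩
  singleton_mem v := by
    refine ⟨Finset.singleton_nonempty v, ?_⟩
    rcases v with _ | ⟨i, n⟩
    · obtain ⟨i⟩ := ‹Nonempty ι›
      exact ⟨i, 0, Finset.singleton_subset_iff.2 (mem_rayEdge.2 (Or.inl rfl))⟩
    · exact ⟨i, n, Finset.singleton_subset_iff.2 (mem_rayEdge.2 (Or.inr rfl))⟩

variable [Fintype ι] [Nonempty ι]

theorem rayComplex_locallyFinite (v : Option (ι × ℕ)) :
    {s ∈ (rayComplex ι).faces | v ∈ s}.Finite := by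
  let F : Finset (Option (ι × ℕ)) :=
    (Finset.univ ×ˢ Finset.range (height v + 2)).image fun p : ι × ℕ => node p.1 p.2
  refine F.powerset.finite_toSet.subset ?_
  rintro s ⟨⟨-, i, n, hs⟩, hv⟩
  have hn : n ≤ height v := by
    rcases mem_rayEdge.1 (hs hv) with rfl | rfl <;> rw [height_node]
    exact Nat.le_succ n
  rw [Finset.mem_coe, Finset.mem_powerset]
  intro w hw
  rcases mem_rayEdge.1 (hs hw) with rfl | rfl
  · exact Finset.mem_image.2 ⟨(i, n), Finset.mem_product.2
      ⟨Finset.mem_univ _, Finset.mem_range.2 (by omega)⟩, rfl⟩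
  · exact Finset.mem_image.2 ⟨(i, n + 1), Finset.mem_product.2
      ⟨Finset.mem_univ _, Finset.mem_range.2 (by omega)⟩, rfl⟩

/-- Barycentric coordinates on the edges of the rays. -/
def edgePoint (i : ι) (n : ℕ) (u : ℝ) (v : Option (ι × ℕ)) : ℝ :=
  if v = node i n then 1 - u else if v = node i (n + 1) then u else 0

theorem edgePoint_left (i : ι) (n : ℕ) (u : ℝ) : edgePoint i n u (node i n) = 1 - u := if_pos rfl

theorem edgePoint_right (i : ι) (n : ℕ) (u : ℝ) : edgePoint i n u (node i (n + 1)) = u := by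
  rw [edgePoint, if_neg fun h => by simpa using node_injective i h, if_pos rfl]

theorem edgePoint_of_notMem {i : ι} {n : ℕ} {u : ℝ} {v : Option (ι × ℕ)} (h : v ∉ rayEdge i n) :
    edgePoint i n u v = 0 := by
  rw [mem_rayEdge, not_or] at h
  rw [edgePoint, if_neg h.1, if_neg h.2]

theorem sum_rayEdge (i : ι) (n : ℕ) (f : Option (ι × ℕ) → ℝ) :
    ∑ v ∈ rayEdge i n, f v = f (node i n) + f (node i (n + 1)) :=
  Finset.sum_pair fun h => by simpa using node_injective i h

theorem edgePoint_mem (i : ι) (n : ℕ) {u : ℝ} (h0 : 0 ≤ u) (h1 : u ≤ 1) :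
    edgePoint i n u ∈ realization (rayComplex ι) := by
  have hne : ∀ v, edgePoint i n u v ≠ 0 → v ∈ rayEdge i n := fun v hv =>
    by_contra fun h => hv (edgePoint_of_notMem h)
  refine mem_realization_of (fun v => ?_) (s := rayEdge i n)
    ⟨⟨node i n, mem_rayEdge.2 (Or.inl rfl)⟩, i, n, subset_rfl⟩ hne hne ?_
  · rw [edgePoint]
    split_ifs <;> linarith
  · rw [sum_rayEdge, edgePoint_left, edgePoint_right, sub_add_cancel]

theorem exists_eq_edgePoint (x : realization (rayComplex ι)) :
    ∃ i n u, 0 ≤ u ∧ u ≤ 1 ∧ (x : Option (ι × ℕ) → ℝ) = edgePoint i n u := by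
  obtain ⟨-, i, n, h⟩ := carrier_mem_faces x
  have h1 := sum_eq_one_of_carrier_subset x h
  rw [sum_rayEdge] at h1
  have h2 := coord_nonneg x (node i n)
  refine ⟨i, n, (x : Option (ι × ℕ) → ℝ) (node i (n + 1)), coord_nonneg x _, by linarith, ?_⟩
  funext v
  by_cases hv : v ∈ rayEdge i n
  · rcases mem_rayEdge.1 hv with rfl | rfl
    · rw [edgePoint_left]; linarith
    · rw [edgePoint_right]
  · rw [edgePoint_of_notMem hv]
    exact notMem_carrier.1 fun h' => hv (h h')

/-- The piecewise linear inverse of the triangulation of the rays. -/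
def tent (y : ι → ℝ) : Option (ι × ℕ) → ℝ
  | none => max 0 (1 - ∑ i, y i)
  | some (i, n) => max 0 (1 - |y i - (n + 1)|)

theorem tent_node_single (i : ι) {t : ℝ} (ht : 0 ≤ t) (k : ℕ) :
    tent (Pi.single i t) (node i k) = max 0 (1 - |t - k|) := by
  cases k with
  | zero => simp [node, tent, abs_of_nonneg ht]
  | succ k => simp [node, tent]

theorem tent_single (i : ι) (n : ℕ) {u : ℝ} (h0 : 0 ≤ u) (h1 : u ≤ 1) :
    tent (Pi.single i (n + u)) = edgePoint i n u := by
  have ht : (0 : ℝ) ≤ n + u := by positivity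
  funext v
  by_cases hv : ∃ k, v = node i k
  · obtain ⟨k, rfl⟩ := hv
    rw [tent_node_single i ht]
    rcases lt_trichotomy k n with h | rfl | h
    · rw [edgePoint_of_notMem fun h' => by
        rcases mem_rayEdge.1 h' with h' | h' <;> · have := node_injective i h'; omega]
      have : (k : ℝ) + 1 ≤ n := by exact_mod_cast h
      refine max_eq_left ?_
      have := le_abs_self (n + u - k)
      linarith
    · rw [edgePoint_left, abs_of_nonneg (by linarith), max_eq_right (by linarith)]
      ring
    · rcases Nat.lt_or_ge (n + 1) k with h' | h'
      · rw [edgePoint_of_notMem fun h' => by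
          rcases mem_rayEdge.1 h' with h' | h' <;> · have := node_injective i h'; omega]
        have : (n : ℝ) + 1 + 1 ≤ k := by exact_mod_cast h'
        refine max_eq_left ?_
        have := neg_le_abs (n + u - k)
        linarith
      · obtain rfl : k = n + 1 := by omega
        rw [edgePoint_right]
        push_cast
        rw [abs_of_nonpos (by linarith), max_eq_right (by linarith)]
        ring
  · rw [edgePoint_of_notMem fun h' => by
      rcases mem_rayEdge.1 h' with h' | h' <;> exact hv ⟨_, h'⟩]
    rcases v with _ | ⟨j, k⟩
    · exact absurd ⟨0, rfl⟩ hv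
    · have hj : j ≠ i := by
        rintro rfl
        exact hv ⟨k + 1, rfl⟩
      refine max_eq_left ?_
      rw [Pi.single_eq_of_ne hj, zero_sub, abs_neg, abs_of_nonneg (by positivity)]
      have : (0 : ℝ) ≤ k := by positivity
      linarith

theorem exists_eq_single (y : openCone (⊥ : AbstractSimplicialComplex ι)) :
    ∃ (i : ι) (n : ℕ) (u : ℝ), 0 ≤ u ∧ u ≤ 1 ∧ (y : ι → ℝ) = Pi.single i (n + u) := by
  obtain ⟨σ, ⟨i, rfl⟩, h0, h⟩ := Set.mem_iUnion₂.1 y.2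
  -- The integer part selects the edge of the ray and the fractional part the position on it.
  refine ⟨i, ⌊(y : ι → ℝ) i⌋₊, (y : ι → ℝ) i - ⌊(y : ι → ℝ) i⌋₊,
    sub_nonneg.2 (Nat.floor_le (h0 i)), by linarith [Nat.lt_floor_add_one ((y : ι → ℝ) i)], ?_⟩
  funext j
  by_cases hj : j = i
  · subst hj
    simp
  · rw [Pi.single_eq_of_ne hj]
    exact h j (by simpa using hj)

theorem single_mem_openCone (i : ι) {t : ℝ} (ht : 0 ≤ t) :
    Pi.single i t ∈ openCone (⊥ : AbstractSimplicialComplex ι) := by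
  refine Set.mem_iUnion₂.2 ⟨{i}, ⟨i, rfl⟩, fun j => ?_, fun j hj => ?_⟩
  · by_cases h : j = i
    · subst h; simpa using ht
    · rw [Pi.single_eq_of_ne h]
  · exact Pi.single_eq_of_ne (by simpa using hj) _

/-- The coordinates in the cone of a point on the rays. -/
noncomputable def rayCoord (x : realization (rayComplex ι)) (j : ι) : ℝ :=
  ∑ v ∈ carrier x with rayIndex v = some j, (height v : ℝ) * (x : Option (ι × ℕ) → ℝ) v

theorem rayCoord_eq {x : realization (rayComplex ι)} {i : ι} {n : ℕ} {u : ℝ}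
    (hx : (x : Option (ι × ℕ) → ℝ) = edgePoint i n u) : rayCoord x = Pi.single i (n + u) := by
  have hsub : carrier x ⊆ rayEdge i n := fun v hv => by_contra fun h =>
    mem_carrier.1 hv (by rw [hx, edgePoint_of_notMem h])
  funext j
  have : rayCoord x j = ∑ v ∈ rayEdge i n with rayIndex v = some j,
      (height v : ℝ) * (x : Option (ι × ℕ) → ℝ) v := by
    refine Finset.sum_subset (Finset.filter_subset_filter _ hsub) fun v hv hv' => ?_
    rw [Finset.mem_filter] at hv hv'
    rw [notMem_carrier.1 fun h => hv' ⟨h, hv.2⟩, mul_zero]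
  rw [this, Finset.sum_filter, sum_rayEdge, hx, edgePoint_left, edgePoint_right,
    height_node, height_node, rayIndex_node_succ]
  by_cases hj : j = i
  · subst hj
    rw [if_pos rfl, Pi.single_eq_same]
    cases n with
    | zero => simp
    | succ n =>
      rw [rayIndex_node_succ, if_pos rfl]
      push_cast
      ring
  · rw [Pi.single_eq_of_ne hj, if_neg fun h => hj (Option.some.inj h).symm]
    cases n with
    | zero => simp
    | succ n => rw [rayIndex_node_succ, if_neg fun h => hj (Option.some.inj h).symm, add_zero]

/-- The rays with a common origin are the open cone over a discrete complex. -/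
noncomputable def rayHomeo (ι : Type) [DecidableEq ι] [Fintype ι] [Nonempty ι] :
    realization (rayComplex ι) ≃ₜ openCone (⊥ : AbstractSimplicialComplex ι) where
  toFun x := ⟨rayCoord x, by
    obtain ⟨i, n, u, h0, -, hx⟩ := exists_eq_edgePoint x
    rw [rayCoord_eq hx]
    exact single_mem_openCone i (by positivity)⟩
  invFun y := ⟨tent y, by
    obtain ⟨i, n, u, h0, h1, hy⟩ := exists_eq_single y
    rw [hy, tent_single i n h0 h1]
    exact edgePoint_mem i n h0 h1⟩
  left_inv x := by
    obtain ⟨i, n, u, h0, h1, hx⟩ := exists_eq_edgePoint x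
    refine Subtype.ext ?_
    change tent (rayCoord x) = _
    rw [rayCoord_eq hx, tent_single i n h0 h1, hx]
  right_inv y := by
    obtain ⟨i, n, u, h0, h1, hy⟩ := exists_eq_single y
    refine Subtype.ext ?_
    rw [hy]
    exact rayCoord_eq (by rw [← tent_single i n h0 h1, ← hy])
  continuous_toFun := Continuous.subtype_mk (continuous_pi fun j =>
    continuous_sum_carrier rayComplex_locallyFinite _ fun v => (height v : ℝ)) _
  continuous_invFun := by
    refine Continuous.subtype_mk (continuous_pi fun v => ?_) _
    have hc : ∀ i, Continuous fun y : openCone (⊥ : AbstractSimplicialComplex ι) =>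
      (y : ι → ℝ) i := fun i => (continuous_apply i).comp continuous_subtype_val
    rcases v with _ | ⟨i, n⟩
    · exact continuous_const.max (continuous_const.sub (continuous_finsetSum _ fun i _ => hc i))
    · exact continuous_const.max (continuous_const.sub ((hc i).sub continuous_const).abs)

/-- All summands are nonnegative and heights are positive away from the cone point, so the
coordinate j vanishes exactly when no carrier vertex lies on the ray j. -/
theorem rayCoord_mem_coneSimplex {x : realization (rayComplex ι)} {σ : Finset ι} :
    rayCoord x ∈ coneSimplex σ ↔ ∀ v ∈ carrier x, ∀ j, rayIndex v = some j → j ∈ σ := by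
  have hnn : ∀ v, 0 ≤ (height v : ℝ) * (x : Option (ι × ℕ) → ℝ) v := fun v =>
    mul_nonneg (Nat.cast_nonneg _) (coord_nonneg x v)
  constructor
  · intro h v hv j hj
    by_contra hjσ
    have h0 := (Finset.sum_eq_zero_iff_of_nonneg fun v _ => hnn v).1 (h.2 j hjσ) v
      (Finset.mem_filter.2 ⟨hv, hj⟩)
    exact mul_ne_zero (Nat.cast_ne_zero.2 (height_pos hj).ne') (mem_carrier.1 hv) h0
  · refine fun h => ⟨fun j => Finset.sum_nonneg fun v _ => hnn v, fun j hj =>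
      Finset.sum_eq_zero fun v hv => absurd ?_ hj⟩
    exact h v (Finset.mem_filter.1 hv).1 j (Finset.mem_filter.1 hv).2

/-- The triangulation of the open cone over a discrete complex by rays. -/
theorem exists_coneTriangulation_bot :
    ∃ T : ConeTriangulation (⊥ : AbstractSimplicialComplex ι) (Option (ι × ℕ)),
      (∀ σ, T.HasSubcomplex σ) ∧
      (∀ v w, (∃ s ∈ T.complex.faces, v ∈ s ∧ w ∈ s) →
        ∃ i n, v ∈ rayEdge i n ∧ w ∈ rayEdge i n) ∧
      ∀ σ v, v ∈ T.verticesIn σ ↔ ∀ j, rayIndex v = some j → j ∈ σ := by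
  have hsub : ∀ (σ : Finset ι) (x : realization (rayComplex ι)),
      rayCoord x ∈ coneSimplex σ ↔ ∃ s ∈ {s ∈ (rayComplex ι).faces |
        ∀ v ∈ s, ∀ j, rayIndex v = some j → j ∈ σ}, carrier x ⊆ s := fun σ x => by
    rw [rayCoord_mem_coneSimplex]
    exact ⟨fun h => ⟨carrier x, ⟨carrier_mem_faces x, h⟩, subset_rfl⟩,
      fun ⟨s, hs, hxs⟩ v hv => hs.2 v (hxs hv)⟩
  refine ⟨⟨rayComplex ι, rayComplex_locallyFinite, rayHomeo ι, fun σ _ =>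
    ⟨{s ∈ (rayComplex ι).faces | ∀ v ∈ s, ∀ j, rayIndex v = some j → j ∈ σ}, fun s hs => hs.1, ?_⟩⟩,
    fun σ => ⟨_, fun s hs => hs.1, hsub σ⟩, ?_, ?_⟩
  · ext x
    rw [Set.mem_ofPred_eq, Set.mem_ofPred_eq, mem_biUnion_closedSimplex_iff]
    exact hsub σ x
  · rintro v w ⟨s, ⟨-, i, n, hs⟩, hv, hw⟩
    exact ⟨i, n, hs hv, hs hw⟩
  · intro σ v
    have := rayCoord_mem_coneSimplex (x := vertexPoint (rayComplex ι) v) (σ := σ)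
    simp only [carrier_vertexPoint, Finset.mem_singleton, forall_eq] at this
    exact this

end DiscreteCone

end ObstructorDim

namespace ObstructorDim

universe u v

/-! ### Proper Lipschitz expanding maps on cones. -/

section ConeMap

variable {V X : Type} {K : AbstractSimplicialComplex V} {Γ : Type u} [Group Γ]

/-- A proper, Lipschitz and expanding map on the vertices of a cone, where the cone point is
regarded as the cone over the empty simplex. -/
structure ConeTriangulation.IsConeMap (T : ConeTriangulation K X) (S : Finset Γ) (f : X → Γ) :
    Prop where
  proper : ∀ C : Set Γ, C.Finite → (f ⁻¹' C).Finite
  lipschitz : ∃ L : ℕ, ∀ v w : X, (∃ s ∈ T.complex.faces, v ∈ s ∧ w ∈ s) →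
    wordDist S (f v) (f w) ≤ L
  expanding : ∀ σ τ, (σ ∈ K.faces ∨ σ = ∅) → (τ ∈ K.faces ∨ τ = ∅) → Disjoint σ τ → ∀ D : ℕ,
    ∃ C : Set X, C.Finite ∧
      ∀ v ∈ T.verticesIn σ \ C, ∀ w ∈ T.verticesIn τ, D < wordDist S (f v) (f w)

theorem ConeTriangulation.verticesIn_empty_finite (T : ConeTriangulation K X) :
    (T.verticesIn ∅).Finite := by
  classical
  refine Set.Subsingleton.finite fun v hv w hw => ?_
  have h : vertexPoint T.complex v = vertexPoint T.complex w := by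
    refine T.homeo.injective (Subtype.ext (funext fun i => ?_))
    rw [hv.2 i (Finset.notMem_empty i), hw.2 i (Finset.notMem_empty i)]
  have h' := carrier_vertexPoint (T := T.complex) v
  rw [h, carrier_vertexPoint] at h'
  exact (Finset.singleton_injective h').symm

/-- Properness makes the second exceptional set superfluous: only finitely many vertices are mapped
within D of the image of the finite set C₂, and these can be added to C₁. Empty simplices cost
nothing, as the cone over ∅ contains at most one vertex. -/
theorem ConeTriangulation.isConeMap_of_expanding {S : Finset Γ}
    (hS : Subgroup.closure (S : Set Γ) = ⊤) {T : ConeTriangulation K X} {f : X → Γ}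
    (h₁ : ∀ C : Set Γ, C.Finite → (f ⁻¹' C).Finite)
    (h₂ : ∃ L : ℕ, ∀ v w : X, (∃ s ∈ T.complex.faces, v ∈ s ∧ w ∈ s) → wordDist S (f v) (f w) ≤ L)
    (h₃ : ∀ σ ∈ K.faces, ∀ τ ∈ K.faces, Disjoint σ τ → ∀ D : ℕ, ∃ C₁ C₂ : Set X,
      C₁.Finite ∧ C₂.Finite ∧
      ∀ v ∈ T.verticesIn σ \ C₁, ∀ w ∈ T.verticesIn τ \ C₂, D < wordDist S (f v) (f w)) :
    T.IsConeMap S f := by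
  refine ⟨h₁, h₂, fun σ τ hσ hτ hd D => ?_⟩
  have far : ∀ C : Set X, C.Finite → {x | ∃ w ∈ C, wordDist S (f w) (f x) ≤ D}.Finite := by
    intro C hC
    refine (h₁ _ (wordDist_nhd_finite hS (hC.image f) D)).subset ?_
    rintro x ⟨w, hw, h⟩
    exact ⟨f w, Set.mem_image_of_mem f hw, h⟩
  rcases hσ with hσ | rfl
  · rcases hτ with hτ | rfl
    · obtain ⟨C₁, C₂, hC₁, hC₂, h⟩ := h₃ σ hσ τ hτ hd D
      refine ⟨_, hC₁.union (far C₂ hC₂), fun v hv w hw => ?_⟩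
      by_cases hw' : w ∈ C₂
      · by_contra h'
        refine hv.2 (Or.inr ⟨w, hw', ?_⟩)
        rw [wordDist_comm]
        exact not_lt.1 h'
      · exact h v ⟨hv.1, fun h' => hv.2 (Or.inl h')⟩ w ⟨hw, hw'⟩
    · refine ⟨_, far _ T.verticesIn_empty_finite, fun v hv w hw => ?_⟩
      by_contra h'
      refine hv.2 ⟨w, hw, ?_⟩
      rw [wordDist_comm]
      exact not_lt.1 h'
  · exact ⟨_, T.verticesIn_empty_finite, fun v hv => absurd hv.1 hv.2⟩

theorem IsObstructor.exists_disjoint [Finite V] {m : ℕ} (h : IsObstructor K m) :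
    ∃ σ ∈ K.faces, ∃ τ ∈ K.faces, Disjoint σ τ := by
  obtain ⟨-, P, hP, -, ⟨f, -, hodd⟩, -⟩ := h
  obtain ⟨p, hp⟩ : P.Nonempty := by
    by_contra hne
    rw [Finset.not_nonempty_iff_eq_empty.1 hne, Finset.sum_empty] at hodd
    exact absurd hodd (by decide)
  induction p with
  | h σ τ => exact ⟨σ, (hP σ τ hp).1, τ, (hP σ τ hp).2.1, (hP σ τ hp).2.2.1⟩

theorem IsObstructor.nonempty [Finite V] {m : ℕ} (h : IsObstructor K m) : Nonempty V := by
  obtain ⟨σ, hσ, -⟩ := h.exists_disjoint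
  obtain ⟨v, -⟩ := (K.isRelLowerSet_faces hσ).1
  exact ⟨v⟩

/-- An odd intersection count forces a pair of disjoint simplices, and their cones meet exactly in
the cone point. -/
theorem IsObstructor.hasSubcomplex_empty [Finite V] {m : ℕ} (h : IsObstructor K m)
    (T : ConeTriangulation K X) : T.HasSubcomplex ∅ := by
  classical
  obtain ⟨σ, hσ, τ, hτ, hd⟩ := h.exists_disjoint
  rw [← Finset.disjoint_iff_inter_eq_empty.1 hd]
  exact (T.hasSubcomplex hσ).inter (T.hasSubcomplex hτ)

theorem ConeTriangulation.IsConeMap.admitsObstructor [Finite V] {m : ℕ} {S : Finset Γ}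
    {T : ConeTriangulation K X} {f : X → Γ} (hf : T.IsConeMap S f) (hK : IsObstructor K m) :
    AdmitsObstructor S m := by
  refine ⟨V, inferInstance, K, X, T, f, hK, hf.proper, hf.lipschitz, fun σ hσ τ hτ hd D => ?_⟩
  obtain ⟨C, hC, h⟩ := hf.expanding σ τ (Or.inl hσ) (Or.inl hτ) hd D
  exact ⟨C, ∅, hC, Set.finite_empty, fun v hv w hw => h v hv w hw.1⟩

theorem AdmitsObstructor.exists_isConeMap {S : Finset Γ} (hS : Subgroup.closure (S : Set Γ) = ⊤)
    {m : ℕ} (h : AdmitsObstructor S m) :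
    ∃ (V : Type) (_ : Finite V) (K : AbstractSimplicialComplex V) (X : Type)
      (T : ConeTriangulation K X) (f : X → Γ), IsObstructor K m ∧ T.IsConeMap S f := by
  obtain ⟨V, hV, K, X, T, f, hK, h₁, h₂, h₃⟩ := h
  exact ⟨V, hV, K, X, T, f, hK, T.isConeMap_of_expanding hS h₁ h₂ h₃⟩

end ConeMap

/-! ### Obstructors and retractions. -/

section Retract

variable {Γ : Type u} {Δ : Type v} [Group Γ] [Group Δ]

/-- Obstructors can be pushed into a group along a retract. -/
theorem AdmitsObstructor.of_retract {S : Finset Γ} {S' : Finset Δ}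
    (hS : Subgroup.closure (S : Set Γ) = ⊤) (hS' : Subgroup.closure (S' : Set Δ) = ⊤)
    (φ : Γ →* Δ) (π : Δ →* Γ) (hπ : ∀ x, π (φ x) = x) {m : ℕ} (h : AdmitsObstructor S m) :
    AdmitsObstructor S' m := by
  obtain ⟨V, hV, K, X, T, f, hK, h₁, ⟨L, h₂⟩, h₃⟩ := h
  obtain ⟨A, hA⟩ := exists_wordDist_map_le hS hS' φ
  obtain ⟨B, hB⟩ := exists_wordDist_map_le hS' hS π
  refine ⟨V, hV, K, X, T, φ ∘ f, hK, fun C hC => (h₁ _ (hC.image π)).subset fun x hx =>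
    ⟨φ (f x), hx, hπ _⟩, ⟨A * L, fun v w h => (hA _ _).trans (Nat.mul_le_mul_left _ (h₂ v w h))⟩,
    fun σ hσ τ hτ hd D => ?_⟩
  obtain ⟨C₁, C₂, hC₁, hC₂, h⟩ := h₃ σ hσ τ hτ hd (B * D)
  refine ⟨C₁, C₂, hC₁, hC₂, fun v hv w hw => ?_⟩
  have h1 := h v hv w hw
  have h2 := hB (φ (f v)) (φ (f w))
  rw [hπ, hπ] at h2
  exact lt_of_mul_lt_mul_left' (h1.trans_le h2)

/-- A retract with finite kernel does not change the obstructor dimension. -/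
theorem obdim_le_of_retract {S : Finset Γ} {S' : Finset Δ}
    (hS : Subgroup.closure (S : Set Γ) = ⊤) (hS' : Subgroup.closure (S' : Set Δ) = ⊤)
    (φ : Γ →* Δ) (π : Δ →* Γ) (hπ : ∀ x, π (φ x) = x) (hk : {g | π g = 1}.Finite) :
    obdim S ≤ obdim S' := by
  by_cases hΓ : Finite Γ
  · rw [obdim, if_pos hΓ]
    exact bot_le
  have hΔ : ¬ Finite Δ := fun h => hΓ (Finite.of_injective φ (Function.LeftInverse.injective hπ))
  have h2 : TwoEnded S ↔ TwoEnded S' := by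
    rw [twoEnded_iff hS, twoEnded_iff hS', hasEnds_iff_of_retract φ π hπ hk,
      hasEnds_iff_of_retract φ π hπ hk]
  rw [obdim, obdim, if_neg hΓ, if_neg hΔ]
  by_cases h : TwoEnded S
  · rw [if_pos h, if_pos (h2.1 h)]
  · rw [if_neg h, if_neg fun h' => h (h2.2 h')]
    exact iSup₂_le fun m hm => le_iSup₂ (f := fun (m : ℕ) (_ : AdmitsObstructor S' m) =>
      ((m + 2 : ℕ) : ℕ∞)) m (hm.of_retract hS hS' φ π hπ)

end Retract

set_option linter.unusedSectionVars false

/-! ### Cone maps defined by rays, and the three-point obstructor. -/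

section Rays

variable {ι : Type} [Fintype ι] [DecidableEq ι] [Nonempty ι] {Γ : Type u} [Group Γ]

/-- The map given by rays starting at the identity. -/
def rayMap (ρ : ι → ℕ → Γ) : Option (ι × ℕ) → Γ
  | none => 1
  | some (i, n) => ρ i (n + 1)

theorem rayMap_node {ρ : ι → ℕ → Γ} (h : ∀ i, ρ i 0 = 1) (i : ι) (n : ℕ) :
    rayMap ρ (node i n) = ρ i n := by
  cases n with
  | zero => exact (h i).symm
  | succ n => rfl

theorem exists_eq_node (v : Option (ι × ℕ)) : ∃ i n, v = node i n := by
  rcases v with _ | ⟨i, n⟩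
  · obtain ⟨i⟩ := ‹Nonempty ι›
    exact ⟨i, 0, rfl⟩
  · exact ⟨i, n + 1, rfl⟩

theorem eq_node_of_rayIndex {v : Option (ι × ℕ)} {i : ι}
    (h : ∀ j, rayIndex v = some j → j ∈ ({i} : Finset ι)) : v = node i (height v) := by
  rcases v with _ | ⟨j, n⟩
  · rfl
  · obtain rfl := Finset.mem_singleton.1 (h j rfl)
    rfl

/-- Diverging rays define a map on the cone over a discrete complex. -/
theorem exists_isConeMap_bot {S : Finset Γ} (hS : Subgroup.closure (S : Set Γ) = ⊤)
    {ρ : ι → ℕ → Γ} (h0 : ∀ i, ρ i 0 = 1) (hinj : ∀ i, Function.Injective (ρ i)) {L : ℕ}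
    (hL : ∀ i n, wordDist S (ρ i n) (ρ i (n + 1)) ≤ L)
    (hdiv : ∀ i j, i ≠ j → ∀ D : ℕ, ∃ N, ∀ m ≥ N, ∀ n ≥ N, D < wordDist S (ρ i m) (ρ j n)) :
    ∃ T : ConeTriangulation (⊥ : AbstractSimplicialComplex ι) (Option (ι × ℕ)),
      T.HasSubcomplex ∅ ∧ T.IsConeMap S (rayMap ρ) := by
  obtain ⟨T, hsub, hadj, hmem⟩ := exists_coneTriangulation_bot (ι := ι)
  refine ⟨T, hsub ∅, T.isConeMap_of_expanding hS (fun C hC => ?_) ⟨L, ?_⟩ ?_⟩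
  · refine (Set.finite_iUnion fun i => ((hC.preimage (hinj i).injOn).image (node i))).subset ?_
    intro v hv
    obtain ⟨i, n, rfl⟩ := exists_eq_node v
    refine Set.mem_iUnion.2 ⟨i, n, ?_, rfl⟩
    rwa [Set.mem_preimage, rayMap_node h0] at hv
  · intro v w h
    obtain ⟨i, n, hv, hw⟩ := hadj v w h
    rcases mem_rayEdge.1 hv with rfl | rfl <;> rcases mem_rayEdge.1 hw with rfl | rfl <;>
      simp only [rayMap_node h0]
    · rw [wordDist_self]; exact Nat.zero_le _
    · exact hL i n
    · rw [wordDist_comm]; exact hL i n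
    · rw [wordDist_self]; exact Nat.zero_le _
  · rintro σ ⟨i, rfl⟩ τ ⟨j, rfl⟩ hd D
    obtain ⟨N, hN⟩ := hdiv i j (fun h => by simp [h] at hd) D
    have hfin : ∀ i : ι, (node i '' {n | n < N}).Finite := fun i => (Set.finite_lt_nat N).image _
    refine ⟨_, _, hfin i, hfin j, ?_⟩
    rintro v ⟨hv, hv'⟩ w ⟨hw, hw'⟩
    rw [hmem] at hv hw
    rw [eq_node_of_rayIndex hv] at hv' ⊢
    rw [eq_node_of_rayIndex hw] at hw' ⊢
    rw [rayMap_node h0, rayMap_node h0]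
    exact hN _ (not_lt.1 fun h => hv' ⟨_, h, rfl⟩) _ (not_lt.1 fun h => hw' ⟨_, h, rfl⟩)

/-- Three points form a 0-obstructor complex. -/
theorem isObstructor_bot_fin_three : IsObstructor (⊥ : AbstractSimplicialComplex (Fin 3)) 0 := by
  have hmem : ∀ i j : Fin 3, s(({i} : Finset (Fin 3)), {j}) ∈
      (Finset.univ.image fun i : Fin 3 => s(({i} : Finset (Fin 3)), {i + 1})) ↔ j ≠ i := by decide
  refine ⟨?_, Finset.univ.image fun i : Fin 3 => s(({i} : Finset (Fin 3)), {i + 1}), ?_, ?_, ?_, ?_⟩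
  · rintro σ ⟨i, rfl⟩
    simp
  · intro σ τ h
    obtain ⟨i, -, hi⟩ := Finset.mem_image.1 h
    have hd : Disjoint ({i} : Finset (Fin 3)) {i + 1} := by
      clear hi
      decide +revert
    rcases Sym2.eq_iff.1 hi with ⟨rfl, rfl⟩ | ⟨rfl, rfl⟩
    · exact ⟨⟨_, rfl⟩, ⟨_, rfl⟩, hd, rfl⟩
    · exact ⟨⟨_, rfl⟩, ⟨_, rfl⟩, hd.symm, rfl⟩
  · rintro α ⟨i, rfl⟩ β ⟨j, rfl⟩ - h
    simp at h
  · refine ⟨0, fun s hs => ?_, ?_⟩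
    · have : Subsingleton s := Finset.card_le_one_iff_subsingleton_coe.1 hs
      exact affineIndependent_of_subsingleton ℝ _
    -- ℝ⁰ is a single point, so each of the three pairs contributes one intersection, and 3 is odd.
    · rw [Finset.sum_congr rfl (g := fun _ => 1)]
      · decide
      · intro p hp
        obtain ⟨i, -, rfl⟩ := Finset.mem_image.1 hp
        rw [intersectionNumber, Set.ncard_eq_one]
        refine ⟨0, Set.eq_singleton_iff_unique_mem.2 ⟨fun σ hσ => subset_convexHull ℝ _ ?_,
          fun y _ => Subsingleton.elim _ _⟩⟩
        rcases Sym2.mem_iff.1 hσ with rfl | rfl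
        · exact ⟨i, by simp, rfl⟩
        · exact ⟨i + 1, by simp, rfl⟩
  · rintro σ ⟨i, rfl⟩ -
    have : {v : Fin 3 | s(({i} : Finset (Fin 3)), {v}) ∈
        (Finset.univ.image fun i : Fin 3 => s(({i} : Finset (Fin 3)), {i + 1}))} =
        ((Finset.univ.filter fun v => v ≠ i : Finset (Fin 3)) : Set (Fin 3)) := by
      ext v
      simpa using hmem i v
    rw [this, Set.ncard_coe_finset]
    clear this
    decide +revert

end Rays

end ObstructorDim

/-! ### Superadditivity of the obstructor dimension. -/

namespace ObstructorDim

universe u v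

variable {Γ₁ : Type u} {Γ₂ : Type v} [Group Γ₁] [Group Γ₂] {S₁ : Finset Γ₁} {S₂ : Finset Γ₂}
  {S : Finset (Γ₁ × Γ₂)}

/-- A vertex outside A₁ × A₂ is outside the exceptional set in some coordinate, and one-sided
expansion there applies whatever the other vertex is. With exceptional sets on both sides, the two
vertices might be good only in different coordinates. Simplices of the join may miss a factor, which
is where the empty simplices enter. -/
theorem ConeTriangulation.IsConeMap.prod (hS₁ : Subgroup.closure (S₁ : Set Γ₁) = ⊤)
    (hS₂ : Subgroup.closure (S₂ : Set Γ₂) = ⊤) (hS : Subgroup.closure (S : Set (Γ₁ × Γ₂)) = ⊤)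
    {V₁ V₂ X₁ X₂ : Type} [Nonempty V₁] [Nonempty V₂]
    {K₁ : AbstractSimplicialComplex V₁} {K₂ : AbstractSimplicialComplex V₂}
    {T₁ : ConeTriangulation K₁ X₁} {T₂ : ConeTriangulation K₂ X₂} {f₁ : X₁ → Γ₁} {f₂ : X₂ → Γ₂}
    (h₁ : T₁.HasSubcomplex ∅) (h₂ : T₂.HasSubcomplex ∅)
    (hf₁ : T₁.IsConeMap S₁ f₁) (hf₂ : T₂.IsConeMap S₂ f₂) :
    ∃ T : ConeTriangulation (joinComplex K₁ K₂) (X₁ × X₂), T.IsConeMap S (Prod.map f₁ f₂) := by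
  obtain ⟨T, hadj, hmem⟩ := exists_coneTriangulation_join T₁ T₂ h₁ h₂
  obtain ⟨A, hA⟩ := wordDist_fst_le hS₁ hS
  obtain ⟨B, hB⟩ := wordDist_snd_le hS₂ hS
  obtain ⟨C, hC⟩ := wordDist_prod_le hS₁ hS₂ hS
  obtain ⟨L₁, hL₁⟩ := hf₁.lipschitz
  obtain ⟨L₂, hL₂⟩ := hf₂.lipschitz
  refine ⟨T, fun F hF => ?_, ⟨C * (L₁ + L₂), fun p q h => ?_⟩, fun σ τ hσ hτ hd D => ?_⟩
  · refine ((hf₁.proper _ (hF.image Prod.fst)).prod (hf₂.proper _ (hF.image Prod.snd))).subset ?_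
    exact fun p hp => ⟨⟨_, hp, rfl⟩, ⟨_, hp, rfl⟩⟩
  · exact (hC _ _).trans (Nat.mul_le_mul_left _
      (Nat.add_le_add (hL₁ _ _ (hadj p q h).1) (hL₂ _ _ (hadj p q h).2)))
  · have hd' := disjoint_iff_toLeft_toRight.1 hd
    have hl : ∀ σ, (σ ∈ (joinComplex K₁ K₂).faces ∨ σ = ∅) →
        (σ.toLeft ∈ K₁.faces ∨ σ.toLeft = ∅) ∧ (σ.toRight ∈ K₂.faces ∨ σ.toRight = ∅) := by
      rintro σ (h | rfl)
      · exact h.2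
      · exact ⟨Or.inr rfl, Or.inr rfl⟩
    obtain ⟨A₁, hA₁, h₁⟩ := hf₁.expanding _ _ (hl σ hσ).1 (hl τ hτ).1 hd'.1 (A * D)
    obtain ⟨A₂, hA₂, h₂⟩ := hf₂.expanding _ _ (hl σ hσ).2 (hl τ hτ).2 hd'.2 (B * D)
    refine ⟨A₁ ×ˢ A₂, hA₁.prod hA₂, ?_⟩
    rintro p ⟨hp, hpA⟩ q hq
    rw [hmem] at hp hq
    by_cases hp1 : p.1 ∈ A₁
    · have hp2 : p.2 ∉ A₂ := fun h => hpA ⟨hp1, h⟩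
      exact lt_of_mul_lt_mul_left' ((h₂ _ ⟨hp.2, hp2⟩ _ hq.2).trans_le
        (hB (Prod.map f₁ f₂ p) (Prod.map f₁ f₂ q)))
    · exact lt_of_mul_lt_mul_left' ((h₁ _ ⟨hp.1, hp1⟩ _ hq.1).trans_le
        (hA (Prod.map f₁ f₂ p) (Prod.map f₁ f₂ q)))

theorem AdmitsObstructor.prod (hS₁ : Subgroup.closure (S₁ : Set Γ₁) = ⊤)
    (hS₂ : Subgroup.closure (S₂ : Set Γ₂) = ⊤) (hS : Subgroup.closure (S : Set (Γ₁ × Γ₂)) = ⊤)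
    {m₁ m₂ : ℕ} (h₁ : AdmitsObstructor S₁ m₁) (h₂ : AdmitsObstructor S₂ m₂) :
    AdmitsObstructor S (m₁ + m₂ + 2) := by
  classical
  obtain ⟨V₁, _, K₁, X₁, T₁, f₁, hK₁, hf₁⟩ := h₁.exists_isConeMap hS₁
  obtain ⟨V₂, _, K₂, X₂, T₂, f₂, hK₂, hf₂⟩ := h₂.exists_isConeMap hS₂
  have := Fintype.ofFinite V₁
  have := Fintype.ofFinite V₂
  have := hK₁.nonempty
  have := hK₂.nonempty
  obtain ⟨T, hT⟩ := hf₁.prod hS₁ hS₂ hS (hK₁.hasSubcomplex_empty T₁) (hK₂.hasSubcomplex_empty T₂)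
    hf₂
  exact hT.admitsObstructor (hK₁.join hK₂)

/-- A geodesic ray from the identity. -/
theorem exists_injective_ray {Γ : Type u} [Group Γ] {S : Finset Γ} [Infinite Γ]
    (hS : Subgroup.closure (S : Set Γ) = ⊤) : ∃ r : ℕ → Γ, r 0 = 1 ∧ Function.Injective r ∧
      (∀ i, wordDist S (r i) (r (i + 1)) ≤ 1) ∧ ∀ i, wordDist S 1 (r i) = i := by
  obtain ⟨r, h1, h2⟩ := exists_ray hS
  refine ⟨r, ?_, fun i j h => ?_, h1, h2⟩
  · by_contra h
    exact (wordDist_pos hS (Ne.symm h)).ne' (h2 0)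
  · rw [← h2 i, h, h2 j]

/-- The cone over a point is a ray, and an infinite group contains a geodesic ray. Joining with that
point raises m by 1. -/
theorem AdmitsObstructor.prod_infinite (hS₁ : Subgroup.closure (S₁ : Set Γ₁) = ⊤)
    (hS₂ : Subgroup.closure (S₂ : Set Γ₂) = ⊤) (hS : Subgroup.closure (S : Set (Γ₁ × Γ₂)) = ⊤)
    [Infinite Γ₂] {m : ℕ} (h : AdmitsObstructor S₁ m) : AdmitsObstructor S (m + 1) := by
  classical
  obtain ⟨V₁, _, K₁, X₁, T₁, f₁, hK₁, hf₁⟩ := h.exists_isConeMap hS₁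
  have := Fintype.ofFinite V₁
  have := hK₁.nonempty
  obtain ⟨r, h0, hinj, hL, -⟩ := exists_injective_ray hS₂
  obtain ⟨T₂, h₂, hf₂⟩ := exists_isConeMap_bot (ι := Unit) hS₂ (ρ := fun _ => r) (fun _ => h0)
    (fun _ => hinj) (fun _ => hL) fun i j h => absurd rfl h
  obtain ⟨T, hT⟩ := hf₁.prod hS₁ hS₂ hS (hK₁.hasSubcomplex_empty T₁) h₂ hf₂
  exact hT.admitsObstructor hK₁.join_point

theorem AdmitsObstructor.prod_infinite_left (hS₁ : Subgroup.closure (S₁ : Set Γ₁) = ⊤)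
    (hS₂ : Subgroup.closure (S₂ : Set Γ₂) = ⊤) (hS : Subgroup.closure (S : Set (Γ₁ × Γ₂)) = ⊤)
    [Infinite Γ₁] {m : ℕ} (h : AdmitsObstructor S₂ m) : AdmitsObstructor S (m + 1) := by
  classical
  have hS' : Subgroup.closure ((S.image Prod.swap : Finset (Γ₂ × Γ₁)) : Set (Γ₂ × Γ₁)) = ⊤ := by
    have h1 := MonoidHom.map_closure (MulEquiv.prodComm : Γ₁ × Γ₂ ≃* Γ₂ × Γ₁).toMonoidHom S
    rw [hS, Subgroup.map_top_of_surjective _ (MulEquiv.prodComm).surjective] at h1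
    rw [Finset.coe_image]
    exact h1.symm
  exact (h.prod_infinite hS₂ hS₁ hS').of_retract hS' hS
    (MulEquiv.prodComm : Γ₂ × Γ₁ ≃* Γ₁ × Γ₂).toMonoidHom
    (MulEquiv.prodComm : Γ₁ × Γ₂ ≃* Γ₂ × Γ₁).toMonoidHom fun _ => rfl

/-- A product of two infinite groups contains a coarse tripod. -/
theorem admitsObstructor_zero (hS₁ : Subgroup.closure (S₁ : Set Γ₁) = ⊤)
    (hS₂ : Subgroup.closure (S₂ : Set Γ₂) = ⊤) (hS : Subgroup.closure (S : Set (Γ₁ × Γ₂)) = ⊤)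
    [Infinite Γ₁] [Infinite Γ₂] : AdmitsObstructor S 0 := by
  obtain ⟨r₁, h01, hinj1, hL1, hd1⟩ := exists_injective_ray hS₁
  obtain ⟨r₂, h02, hinj2, hL2, hd2⟩ := exists_injective_ray hS₂
  obtain ⟨A, hA⟩ := wordDist_fst_le hS₁ hS
  obtain ⟨B, hB⟩ := wordDist_snd_le hS₂ hS
  obtain ⟨C, hC⟩ := wordDist_prod_le hS₁ hS₂ hS
  -- Two axes and the diagonal. For any two of these rays there is a coordinate in which one stays
  -- at 1 and the other moves away along a geodesic.
  let ρ : Fin 3 → ℕ → Γ₁ × Γ₂ := ![fun n => (r₁ n, 1), fun n => (1, r₂ n), fun n => (r₁ n, r₂ n)]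
  -- The bound exceeds both A * D and B * D, so a single threshold serves for either projection,
  -- with Lipschitz constants A and B.
  have key1 : ∀ {m D : ℕ} {x y : Γ₁ × Γ₂}, A * D + B * D + 1 ≤ m → x.1 = 1 → y.1 = r₁ m →
      D < wordDist S x y ∧ D < wordDist S y x := by
    intro m D x y hm hx hy
    have h1 := hA x y
    rw [hx, hy, hd1] at h1
    have : D < wordDist S x y := lt_of_mul_lt_mul_left' (a := A) (by omega)
    exact ⟨this, by rwa [wordDist_comm]⟩
  have key2 : ∀ {m D : ℕ} {x y : Γ₁ × Γ₂}, A * D + B * D + 1 ≤ m → x.2 = 1 → y.2 = r₂ m →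
      D < wordDist S x y ∧ D < wordDist S y x := by
    intro m D x y hm hx hy
    have h1 := hB x y
    rw [hx, hy, hd2] at h1
    have : D < wordDist S x y := lt_of_mul_lt_mul_left' (a := B) (by omega)
    exact ⟨this, by rwa [wordDist_comm]⟩
  have h : ∃ T : ConeTriangulation (⊥ : AbstractSimplicialComplex (Fin 3)) (Option (Fin 3 × ℕ)),
      T.HasSubcomplex ∅ ∧ T.IsConeMap S (rayMap ρ) := by
    refine exists_isConeMap_bot hS (L := C * (1 + 1)) ?_ ?_ ?_ ?_
    · intro i
      fin_cases i <;> simp [ρ, h01, h02]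
    · intro i
      fin_cases i
      · exact fun m n h => hinj1 (congrArg Prod.fst h)
      · exact fun m n h => hinj2 (congrArg Prod.snd h)
      · exact fun m n h => hinj1 (congrArg Prod.fst h)
    · intro i n
      refine (hC _ _).trans (Nat.mul_le_mul_left _ (Nat.add_le_add ?_ ?_)) <;> fin_cases i
      · exact hL1 n
      · exact (wordDist_self (S := S₁) 1).trans_le zero_le_one
      · exact hL1 n
      · exact (wordDist_self (S := S₂) 1).trans_le zero_le_one
      · exact hL2 n
      · exact hL2 n
    · intro i j hij D
      refine ⟨A * D + B * D + 1, fun m hm n hn => ?_⟩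
      fin_cases i <;> fin_cases j
      · exact absurd rfl hij
      · exact (key1 hm rfl rfl).2
      · exact (key2 hn rfl rfl).1
      · exact (key1 hn rfl rfl).1
      · exact absurd rfl hij
      · exact (key1 hn rfl rfl).1
      · exact (key2 hm rfl rfl).2
      · exact (key1 hm rfl rfl).2
      · exact absurd rfl hij
  obtain ⟨T, -, hT⟩ := h
  exact hT.admitsObstructor isObstructor_bot_fin_three

/-- The numbers bounding the obstructor dimension of an infinite group from below, up to the
trivial bound `1`. -/
def obdimSet {Γ : Type u} [Group Γ] (S : Finset Γ) : Set ℕ :=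
  {n | n = 1 ∨ ∃ m, AdmitsObstructor S m ∧ n = m + 2}

/-- Only an upper bound is wanted, so the value 1 may be included for every group. This makes the
index set nonempty and lets the 2-ended case be treated together with the others. -/
theorem obdim_le_iSup {Γ : Type u} [Group Γ] (S : Finset Γ) :
    obdim S ≤ ⨆ n ∈ obdimSet S, (n : ℕ∞) := by
  rw [obdim]
  split_ifs
  · exact bot_le
  · exact le_iSup₂_of_le 1 (Or.inl rfl) le_rfl
  · exact iSup₂_le fun m hm => le_iSup₂_of_le (m + 2) (Or.inr ⟨m, hm, rfl⟩) le_rfl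

theorem obdim_add_le_of_infinite (hS₁ : Subgroup.closure (S₁ : Set Γ₁) = ⊤)
    (hS₂ : Subgroup.closure (S₂ : Set Γ₂) = ⊤) (hS : Subgroup.closure (S : Set (Γ₁ × Γ₂)) = ⊤)
    [Infinite Γ₁] [Infinite Γ₂] : obdim S₁ + obdim S₂ ≤ obdim S := by
  have hobdim : obdim S = ⨆ (m : ℕ) (_ : AdmitsObstructor S m), ((m + 2 : ℕ) : ℕ∞) := by
    rw [obdim, if_neg, if_neg]
    · rw [twoEnded_iff hS]
      exact fun h => not_hasEnds_prod hS₁ hS₂ h.1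
    · exact not_finite_iff_infinite.2 inferInstance
  have hle : ∀ {m : ℕ}, AdmitsObstructor S m → ((m + 2 : ℕ) : ℕ∞) ≤ obdim S := fun hm => by
    rw [hobdim]
    exact le_iSup₂_of_le _ hm le_rfl
  refine (add_le_add (obdim_le_iSup S₁) (obdim_le_iSup S₂)).trans ?_
  refine ENat.biSup_add_biSup_le' (p := (· ∈ obdimSet S₁)) (q := (· ∈ obdimSet S₂))
    ⟨1, Or.inl rfl⟩ ⟨1, Or.inl rfl⟩ ?_
  -- The cases are 1 + 1 = 0 + 2, 1 + (m₂ + 2) = (m₂ + 1) + 2, its mirror image, and (m₁ + 2) + (m₂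
  -- + 2) = (m₁ + m₂ + 2) + 2.
  rintro n₁ (rfl | ⟨m₁, h₁, rfl⟩) n₂ (rfl | ⟨m₂, h₂, rfl⟩)
  · exact hle (admitsObstructor_zero hS₁ hS₂ hS)
  · have := hle (AdmitsObstructor.prod_infinite_left hS₁ hS₂ hS h₂)
    rw [← Nat.cast_add]
    convert! this using 2
    omega
  · have := hle (h₁.prod_infinite hS₁ hS₂ hS)
    rw [← Nat.cast_add]
    convert! this using 2
  · have := hle (h₁.prod hS₁ hS₂ hS h₂)
    rw [← Nat.cast_add]
    convert! this using 2
    omega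

theorem obdim_eq_zero {Γ : Type u} [Group Γ] [h : Finite Γ] (S : Finset Γ) : obdim S = 0 :=
  if_pos h

/-- A finite factor contributes 0 and is the kernel of the projection to the other factor, which is
split by the inclusion. -/
theorem obdim_add_le (hS₁ : Subgroup.closure (S₁ : Set Γ₁) = ⊤)
    (hS₂ : Subgroup.closure (S₂ : Set Γ₂) = ⊤) (hS : Subgroup.closure (S : Set (Γ₁ × Γ₂)) = ⊤) :
    obdim S₁ + obdim S₂ ≤ obdim S := by
  rcases finite_or_infinite Γ₁ with h₁ | h₁
  · rw [obdim_eq_zero S₁, zero_add]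
    refine obdim_le_of_retract hS₂ hS (MonoidHom.inr Γ₁ Γ₂) (MonoidHom.snd Γ₁ Γ₂) (fun _ => rfl) ?_
    refine (Set.finite_range fun x : Γ₁ => ((x, 1) : Γ₁ × Γ₂)).subset ?_
    rintro ⟨x, y⟩ h
    exact ⟨x, Prod.ext rfl (Eq.symm h)⟩
  rcases finite_or_infinite Γ₂ with h₂ | h₂
  · rw [obdim_eq_zero S₂, add_zero]
    refine obdim_le_of_retract hS₁ hS (MonoidHom.inl Γ₁ Γ₂) (MonoidHom.fst Γ₁ Γ₂) (fun _ => rfl) ?_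
    refine (Set.finite_range fun x : Γ₂ => ((1, x) : Γ₁ × Γ₂)).subset ?_
    rintro ⟨x, y⟩ h
    exact ⟨y, Prod.ext (Eq.symm h) rfl⟩
  exact obdim_add_le_of_infinite hS₁ hS₂ hS

end ObstructorDim

theorem mainTheorem9 {Γ₁ Γ₂ : Type*} [Group Γ₁] [Group Γ₂]
    (S₁ : Finset Γ₁) (S₂ : Finset Γ₂) (S : Finset (Γ₁ × Γ₂))
    (hS₁ : Subgroup.closure (S₁ : Set Γ₁) = ⊤) (hS₂ : Subgroup.closure (S₂ : Set Γ₂) = ⊤)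
    (hS : Subgroup.closure (S : Set (Γ₁ × Γ₂)) = ⊤) :
    ObstructorDim.obdim S₁ + ObstructorDim.obdim S₂ ≤ ObstructorDim.obdim S ∧
    ObstructorDim.updim S ≤ ObstructorDim.updim S₁ + ObstructorDim.updim S₂ ∧
    ObstructorDim.actdim (Γ₁ × Γ₂) ≤ ObstructorDim.actdim Γ₁ + ObstructorDim.actdim Γ₂ :=
  ⟨ObstructorDim.obdim_add_le hS₁ hS₂ hS, ObstructorDim.updim_prod_le hS₁ hS₂ hS,
    ObstructorDim.actdim_prod_le⟩
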